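/- Let $\tfrac12\le\gamma<1$, $T>0$, $\mathbb T=\mathbb R/2\pi\mathbb Z$, $e_k(x)=e^{ikx}$, $A=-\partial_x^2$. Let $(W(k))_{k\in\mathbb Z}$ be standard complex Brownian motions on a probability space $(\Omega,\mathbb P)$, independent up to the reality constraint $W(-k)=\overline{W(k)}$, and let $(q_k)_{k\in\mathbb Z}\subset\mathbb C$ satisfy $c_1|k|^\gamma\le|q_k|\le c_2|k|^\gamma$ for all $k\in\mathbb Z$ with constants $c_1,c_2>0$ (so $q_0=0$). Let $z=z^{(\gamma)}$ be the Ornstein–Uhlenbeck process with Fourier modes $$\hat z_t(k)=\int_0^t e^{-k^2(t-s)}q_k\,dW_s(k),\qquad t\in[0,T].$$ Let $\psi:\mathbb R\to\mathbb R$ be smooth, even and compactly supported with $\psi(0)=1$, and for $\varepsilon>0$ set $$z^\varepsilon_t=\sum_{k\in\mathbb Z}\psi(\varepsilon k)\hat z_t(k)e_k,\qquad (z^\varepsilon)^{\diamond2}_t=(z^\varepsilon_t)^2-\mathbb E[(z^\varepsilon_t)^2],\qquad J(z^\varepsilon)^\diamond_t=\int_0^te^{-(t-s)A}\partial_x(z^\varepsilon)^{\diamond2}_s\,ds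 .$$ Fix a smooth dyadic partition of unity with Littlewood–Paley blocks $(\Delta_j)_{j\ge-1}$. Let $\mathcal C^\beta$ be the closure of $C^\infty(\mathbb T)$ under $\|u\|_{\mathcal C^\beta}=\sup_{j\ge-1}2^{j\beta}\|\Delta_ju\|_{L^\infty}$, and let $C_T\mathcal C^\beta$ be the space of continuous functions $[0,T]\to\mathcal C^\beta$ with the supremum norm. Then there is a process $J(z)^\diamond$ on $[0,T]$ with the following properties. 1. Let $\eta=0$ if $\gamma>\tfrac12$, and let $\eta>0$ be arbitrary if $\gamma=\tfrac12$. There is a constant $C$ such that for all $k\in\mathbb Z\setminus\{0\}$, $s,t\in[0,T]$ and $h\in[0,1]$, $$\mathbb E\big[|\widehat{J(z)^\diamond_t}(k)|^2\big]\le\frac{C}{|k|^{5-4\gamma-\eta}},\qquad \mathbb E\big[|\widehat{J(z)^\diamond_t}(k)-\widehat{J(z)^\diamond_s}(k)|^2\big]\le\frac{C\,|t-s|^h}{|k|^{5-4\gamma-\eta-2h}} .$$ 2. For every $\beta<2-2\gamma$ and every $p>1$, $J(z)^\diamond$ and all $J(z^\varepsilon)^\diamond$, $\varepsilon>0$, belong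 to $L^p(\Omega;C_T\mathcal C^\beta)$, and $$\lim_{\varepsilon\to0}\mathbb E\Big[\big\|J(z^\varepsilon)^\diamond-J(z)^\diamond\big\|^p_{C_T\mathcal C^\beta}\Big]=0 .$$ Moreover, if $\gamma\ge\tfrac34$, the renormalised square itself does not exist at fixed times: for every $t\in(0,T]$ and every $k\in\mathbb Z\setminus\{0\}$, the Fourier modes $\widehat{(z^\varepsilon)^{\diamond2}_t}(k)$ do not converge in probability as $\varepsilon\to0$. -/

import Mathlib

open MeasureTheory ProbabilityTheory Filter Topology Set
open scoped NNReal ENNReal ComplexConjugate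

noncomputable section

namespace BurgersOU

/-! ### Fourier series and Besov–Hölder spaces on the torus `ℝ / 2πℤ`

A distribution `u` on the torus is represented by the sequence `k ↦ û(k)` of its Fourier
coefficients, `u = ∑ û(k) e_k` with `e_k(x) = exp(ikx)`.  The sequences that come from
distributions are those of at most polynomial growth; this is automatic as soon as a Besov norm
(below) is finite, since `|φ_j(k) û(k)| ≤ ‖Δ_j u‖_{L^∞}` and `∑_j φ_j(k) = 1`. -/

/-- The Fourier basis function `e_k(x) = exp(ikx)`. -/
def expMode (k : ℤ) (x : ℝ) : ℂ := Complex.exp (Complex.I * k * x)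

/-- The Fourier coefficients `(2π)⁻¹ ∫_0^{2π} exp(-ikx) f(x) dx` of a function on the torus. -/
def torusCoeff (f : ℝ → ℂ) (k : ℤ) : ℂ := fourierCoeffOn Real.two_pi_pos f k

/-- `u` is (the Fourier series of) a smooth function on the torus. -/
def IsSmooth (u : ℤ → ℂ) : Prop :=
  ∃ f : ℝ → ℂ, ContDiff ℝ (⊤ : ℕ∞) f ∧ Function.Periodic f (2 * Real.pi) ∧ u = torusCoeff f

/-- Dyadic partition of unity on `ℝ`: smooth radial functions with values in `[0, 1]`, `χ`
supported in a ball, `φ` supported in an annulus, `χ + ∑_{j ≥ 0} φ(2^{-j} ·) = 1`, and only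
neighbouring pieces overlap. -/
structure IsDyadicPartition (χ φ : ℝ → ℝ) : Prop where
  smooth_chi : ContDiff ℝ (⊤ : ℕ∞) χ
  smooth_phi : ContDiff ℝ (⊤ : ℕ∞) φ
  even_chi : ∀ ξ, χ (-ξ) = χ ξ
  even_phi : ∀ ξ, φ (-ξ) = φ ξ
  chi_mem : ∀ ξ, χ ξ ∈ Icc (0 : ℝ) 1
  phi_mem : ∀ ξ, φ ξ ∈ Icc (0 : ℝ) 1
  sum_eq_one : ∀ ξ, HasSum (fun j : ℕ => φ (ξ / 2 ^ j)) (1 - χ ξ)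
  supp_chi : ∃ R > 0, tsupport χ ⊆ {ξ | |ξ| ≤ R}
  supp_phi : ∃ r > 0, ∃ R > r, tsupport φ ⊆ {ξ | r ≤ |ξ| ∧ |ξ| ≤ R}
  disjoint_chi : ∀ j : ℕ, 1 ≤ j →
    Disjoint (tsupport χ) (tsupport fun ξ : ℝ => φ (ξ / 2 ^ j))
  disjoint_phi : ∀ i j : ℕ, i + 1 < j →
    Disjoint (tsupport fun ξ : ℝ => φ (ξ / 2 ^ i)) (tsupport fun ξ : ℝ => φ (ξ / 2 ^ j))

/-- The Littlewood–Paley symbols, shifted by one: index `0` is `φ_{-1} = χ` and index `j + 1` is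
`φ_j = φ(2^{-j} ·)`. -/
def lpSymbol (χ φ : ℝ → ℝ) : ℕ → ℝ → ℝ
  | 0 => χ
  | j + 1 => fun ξ => φ (ξ / 2 ^ j)

/-- The Littlewood–Paley block with (shifted) index `n`; a finite sum, the symbols having compact
support. -/
def lpBlock (χ φ : ℝ → ℝ) (n : ℕ) (u : ℤ → ℂ) (x : ℝ) : ℂ :=
  ∑' k : ℤ, (lpSymbol χ φ n (k : ℝ) : ℂ) * u k * expMode k x

/-- The norm of `B^β_{∞,∞}`: `sup_{j ≥ -1} 2^{jβ} ‖Δ_j u‖_{L^∞}`, with `j = n - 1`. -/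
def besovNorm (χ φ : ℝ → ℝ) (β : ℝ) (u : ℤ → ℂ) : ℝ≥0∞ :=
  ⨆ n : ℕ, (2 : ℝ≥0∞) ^ (((n : ℝ) - 1) * β) * ⨆ x : ℝ, ‖lpBlock χ φ n u x‖ₑ

/-- The space `𝒞^β`: closure of the smooth functions for the norm of `B^β_{∞,∞}`. -/
def besovHolder (χ φ : ℝ → ℝ) (β : ℝ) : Set (ℤ → ℂ) :=
  {u | ∀ δ : ℝ≥0∞, 0 < δ → ∃ v, IsSmooth v ∧ besovNorm χ φ β (u - v) < δ}

/-- The space `C_T 𝒞^β` of continuous functions from `[0, T]` to `𝒞^β` (the values of `u` outside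
`[0, T]` are irrelevant). -/
def pathSpace (χ φ : ℝ → ℝ) (T β : ℝ) : Set (ℝ → ℤ → ℂ) :=
  {u | (∀ t ∈ Icc 0 T, u t ∈ besovHolder χ φ β) ∧
    ∀ t ∈ Icc 0 T,
      Tendsto (fun s => besovNorm χ φ β (u s - u t)) (𝓝[Icc 0 T] t) (𝓝 0)}

/-- The norm `sup_{t ∈ [0, T]} ‖u_t‖_{𝒞^β}` of `C_T 𝒞^β`. -/
def pathNorm (χ φ : ℝ → ℝ) (T β : ℝ) (u : ℝ → ℤ → ℂ) : ℝ≥0∞ :=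
  ⨆ t ∈ Icc 0 T, besovNorm χ φ β (u t)

variable {Ω : Type*} [MeasurableSpace Ω]

/-- `X` belongs to `L^p(Ω; C_T 𝒞^β)`.  Measurability of all Fourier modes at all times is
measurability as a random element of the separable Banach space `C_T 𝒞^β`. -/
structure MemLpPath (χ φ : ℝ → ℝ) (T β p : ℝ) (X : ℝ → Ω → ℤ → ℂ) (P : Measure Ω) : Prop where
  aemeasurable : ∀ t ∈ Icc 0 T, ∀ k : ℤ, AEMeasurable (fun ω => X t ω k) P
  mem_pathSpace : ∀ᵐ ω ∂P, (fun t => X t ω) ∈ pathSpace χ φ T β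
  moment_lt_top : ∫⁻ ω, pathNorm χ φ T β (fun t => X t ω) ^ p ∂P < ∞

/-! ### The cylindrical Brownian motion and the Ornstein–Uhlenbeck process -/

/-- The real components of a family of complex processes indexed by `ℤ`: `Re W(0)`, and, for
`k > 0`, `√2 Re W(k)` (index `k`) and `√2 Im W(k)` (index `-k`). -/
def realComponent (W : ℤ → ℝ≥0 → Ω → ℂ) (k : ℤ) (t : ℝ≥0) (ω : Ω) : ℝ :=
  if k = 0 then (W 0 t ω).re
  else if 0 < k then √2 * (W k t ω).re
  else √2 * (W (-k) t ω).im

/-- `W` is the family of Fourier modes of a (real) cylindrical Brownian motion: standard complex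
Brownian motions, `E|W_t(k)|² = t`, independent up to the reality constraint
`W(-k) = conj W(k)`. -/
structure IsCylindricalBrownian (W : ℤ → ℝ≥0 → Ω → ℂ) (P : Measure Ω) : Prop where
  conj_symm : ∀ k, ∀ᵐ ω ∂P, ∀ t, W (-k) t ω = conj (W k t ω)
  brownian : ∀ k, IsBrownianReal (realComponent W k) P
  indep : iIndepFun (fun (k : ℤ) (ω : Ω) (t : ℝ≥0) => realComponent W k t ω) P

/-- The Wiener integral `∫_0^t f(s) dw_s` of a deterministic `C¹` function `f` along a continuous
path `w`, i.e. the Riemann–Stieltjes integral, in its integrated-by-parts form. -/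
def wienerIntegral (f : ℝ → ℝ) (w : ℝ≥0 → ℂ) (t : ℝ) : ℂ :=
  f t * w t.toNNReal - f 0 * w 0 - ∫ s in (0 : ℝ)..t, ((deriv f s : ℝ) : ℂ) * w s.toNNReal

/-- The Fourier modes `ẑ_t(k) = ∫_0^t exp(-k²(t-s)) q_k dW_s(k)` of the stochastic convolution
`z_t = ∫_0^t e^{-(t-s)A} Q dW_s`, where `Q e_k = q_k e_k`. -/
def ouProcess (q : ℤ → ℂ) (W : ℤ → ℝ≥0 → Ω → ℂ) (t : ℝ) (ω : Ω) (k : ℤ) : ℂ :=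
  q k * wienerIntegral (fun s => Real.exp (-(k : ℝ) ^ 2 * (t - s))) (fun s => W k s ω) t

/-- The regularisation `u^ε(x) = ∑_k ψ(εk) û(k) e_k(x)`; a finite sum if `ψ` has compact support
and `ε > 0`. -/
def regularize (ψ : ℝ → ℝ) (ε : ℝ) (u : ℤ → ℂ) (x : ℝ) : ℂ :=
  ∑' k : ℤ, (ψ (ε * k) : ℂ) * u k * expMode k x

/-- The renormalised square `(z^ε)^{⋄2}_t(x) = z^ε_t(x)² - E[z^ε_t(x)²]`. -/
def wickSquare (ψ : ℝ → ℝ) (q : ℤ → ℂ) (W : ℤ → ℝ≥0 → Ω → ℂ) (P : Measure Ω)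
    (ε t : ℝ) (ω : Ω) (x : ℝ) : ℂ :=
  regularize ψ ε (ouProcess q W t ω) x ^ 2 -
    ∫ ω', regularize ψ ε (ouProcess q W t ω') x ^ 2 ∂P

/-- The derivative `∂_x` on Fourier coefficients. -/
def derivX (u : ℤ → ℂ) (k : ℤ) : ℂ := Complex.I * k * u k

/-- The heat semigroup `e^{-tA}`, `A = -∂_x²`, on Fourier coefficients. -/
def heat (t : ℝ) (u : ℤ → ℂ) (k : ℤ) : ℂ := (Real.exp (-(k : ℝ) ^ 2 * t) : ℂ) * u k

/-- The Fourier modes of `J(z^ε)^⋄_t = ∫_0^t e^{-(t-s)A} ∂_x (z^ε)^{⋄2}_s ds`. -/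
def regularizedJ (ψ : ℝ → ℝ) (q : ℤ → ℂ) (W : ℤ → ℝ≥0 → Ω → ℂ) (P : Measure Ω)
    (ε t : ℝ) (ω : Ω) (k : ℤ) : ℂ :=
  ∫ s in (0 : ℝ)..t, heat (t - s) (derivX (torusCoeff (wickSquare ψ q W P ε s ω))) k

end BurgersOU

end

/-!
Almost surely the Wiener integrals along `W` are the modes `w_k` of a family of Ornstein–Uhlenbeck
processes living in a Gaussian space (`IsCylindricalBrownian.exists_ouFamily`). For `k ≠ 0` the
Fourier modes of the renormalised square are quadratic expressions `∑_{l+m=k} a(l, m) z(l) z(m)` with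
symbol `a(l, m) = ψ(εl) ψ(εm)` (`IsOUFamily.torusCoeff_wickSquare`), hence elements of the second
chaos. The estimates are proved for arbitrary finitely supported symmetric symbols `a`, and applied
to the symbols of the regularisations and to their differences.

*Variances.* By Isserlis' formula, distinct modes are uncorrelated, and the covariance in time of the
summand `(l, k - l)` decays like `exp(-(l² + (k - l)²)|s - r|)`. Integration in time therefore gains
the factor `2 / (l² + (k - l)²)`, which together with the heat kernel compensates the derivative
(`IsOUFamily.integral_norm_sq_quadJ_le`, `IsOUFamily.integral_norm_sq_quadJ_sub_le`); the remaining
sum over `l` converges for all `γ < 1`, and is of order `|k|^{4γ-5}`, up to an arbitrarily small power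
if `γ = 1/2` (`quadEnergy_le`). These bounds are uniform in `ε`, and pass to the limit by Fatou's
lemma.

*Path norms.* In the second chaos all moments are controlled by the variance (`hypercontractivity`):
the rotation by `π/4` of two independent copies of a Gaussian vector turns the difference of two
copies of a quadratic form into a bilinear form in independent vectors, which is conditionally
Gaussian. A Littlewood–Paley block of the Duhamel integral is thus a random function of time and
space whose increments have high moments of order `δ³`, and chaining along dyadic grids
(`enorm_pow_le_chainSum`, `lintegral_chainSum_le`) bounds its supremum. The bounds for the blocks add
up to a geometric series when `β < 2 - 2γ` (`IsDyadicPartition.exists_lintegral_pathSup_le`). Since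
`|ψ(εl) ψ(εm) - ψ(ε'l) ψ(ε'm)|² = O((δ max(|l|, |m|))^κ)` for `ε, ε' ≤ δ`, the gap between `β` and
`2 - 2γ` yields a rate of convergence. The limit is constructed along `ε = 2^{-n}`, where the
convergence is almost sure (`IsOUSetup.ae_tendsto_pathNorm`), and the rate extends to all `ε`
(`IsOUSetup.exists_momentLE_sub_limitJ`).

*Divergence.* At a fixed time there is no gain from the integration in time. For `γ ≥ 3/4` the
variance `∑_l |l|^{2γ-2} |k-l|^{2γ-2}` of a mode diverges at least like the harmonic series
(`exists_finset_pairVar_ge`), so that the variance of the difference of two regularisations is large.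
Hypercontractivity and the Paley–Zygmund inequality show that this difference is then large with a
probability bounded below (`IsOUFamily.measure_quadMode_ge`), so that there is no convergence in
probability (`IsOUSetup.not_tendstoInMeasure`).
-/

namespace BurgersOU

set_option linter.unusedSectionVars false

/-! ### Moments of Gaussian variables -/

section GaussianMoments

variable {Ω : Type*} {mΩ : MeasurableSpace Ω} {P : Measure Ω}

/-- The `2n`-th moment of the standard Gaussian law. -/
noncomputable def gaussMoment (n : ℕ) : ℝ≥0∞ := ∫⁻ x, ‖x‖ₑ ^ (2 * n) ∂(gaussianReal 0 1)

lemma lintegral_enorm_pow_lt_top {E : Type*} [NormedAddCommGroup E] {f : Ω → E} {n : ℕ}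
    (hn : n ≠ 0) (hf : MemLp f n P) : ∫⁻ ω, ‖f ω‖ₑ ^ n ∂P < ∞ := by
  have h2 := lintegral_rpow_enorm_lt_top_of_eLpNorm_lt_top (by simpa using hn)
    (ENNReal.natCast_ne_top n) hf.eLpNorm_lt_top
  simpa using h2

lemma gaussMoment_ne_top (n : ℕ) : gaussMoment n ≠ ∞ := by
  rcases Nat.eq_zero_or_pos n with rfl | hn
  · simp [gaussMoment]
  exact (lintegral_enorm_pow_lt_top (by omega)
    (memLp_id_gaussianReal' (μ := 0) (v := 1) ((2 * n : ℕ) : ℝ≥0∞)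
      (ENNReal.natCast_ne_top _))).ne

lemma lintegral_enorm_sq_stdGaussian : ∫⁻ x, ‖x‖ₑ ^ 2 ∂(gaussianReal 0 1) = 1 := by
  have h := variance_fun_id_gaussianReal (μ := 0) (v := 1)
  have h3 := evariance_eq_lintegral_ofReal (fun x : ℝ => x) (gaussianReal 0 1)
  rw [← ofReal_variance (X := fun x : ℝ => x) ((memLp_id_gaussianReal' (μ := 0) (v := 1) 2 (by simp) :
    MemLp (fun x : ℝ => x) 2 (gaussianReal 0 1)))] at h3
  rw [h] at h3
  have h4 : ∫ x, x ∂(gaussianReal 0 1) = 0 := integral_id_gaussianReal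
  rw [h4] at h3
  simp only [NNReal.coe_one, ENNReal.ofReal_one, sub_zero] at h3
  rw [h3]
  refine lintegral_congr fun x => ?_
  rw [← ofReal_norm, ← ENNReal.ofReal_pow (norm_nonneg _), Real.norm_eq_abs, sq_abs]

/-- A centred Gaussian variable is its standard deviation times a standard one. -/
lemma HasGaussianLaw.lintegral_even_moment {X : Ω → ℝ} (hX : HasGaussianLaw X P)
    (h0 : ∫ ω, X ω ∂P = 0) (n : ℕ) :
    ∫⁻ ω, ‖X ω‖ₑ ^ (2 * n) ∂P = gaussMoment n * (∫⁻ ω, ‖X ω‖ₑ ^ 2 ∂P) ^ n := by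
  have hlaw : P.map X = gaussianReal 0 Var[X; P].toNNReal := by
    rw [hX.map_eq_gaussianReal, h0]
  set v := Var[X; P].toNNReal
  have hm : gaussianReal 0 v = (gaussianReal 0 1).map (fun x => (√v : ℝ) * x) := by
    rw [gaussianReal_map_const_mul]
    congr 1
    · simp
    · ext; simp
  have key : ∀ m : ℕ, ∫⁻ ω, ‖X ω‖ₑ ^ m ∂P
      = ‖(√v : ℝ)‖ₑ ^ m * ∫⁻ x, ‖x‖ₑ ^ m ∂(gaussianReal 0 1) := by
    intro m
    rw [← lintegral_map' (f := fun x : ℝ => ‖x‖ₑ ^ m) (by fun_prop) hX.aemeasurable, hlaw, hm,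
      lintegral_map (by fun_prop) (by fun_prop), ← lintegral_const_mul _ (by fun_prop)]
    refine lintegral_congr fun x => ?_
    rw [enorm_mul, mul_pow]
  rw [key, key, lintegral_enorm_sq_stdGaussian, gaussMoment, mul_one, pow_mul, mul_comm]

lemma add_pow_le_two_pow_mul (a b : ℝ≥0∞) (n : ℕ) :
    (a + b) ^ n ≤ 2 ^ n * (a ^ n + b ^ n) := by
  have h : a + b ≤ 2 * max a b := by
    rw [two_mul]; exact add_le_add (le_max_left _ _) (le_max_right _ _)
  calc (a + b) ^ n ≤ (2 * max a b) ^ n := by gcongr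
    _ = 2 ^ n * max a b ^ n := mul_pow _ _ _
    _ ≤ _ := by
      gcongr
      rcases le_total a b with h | h
      · rw [max_eq_right h]; exact le_add_self
      · rw [max_eq_left h]; exact le_self_add

lemma enorm_le_enorm_re_add_im (z : ℂ) : ‖z‖ₑ ≤ ‖z.re‖ₑ + ‖z.im‖ₑ := by
  rw [← ofReal_norm, ← ofReal_norm, ← ofReal_norm,
    ← ENNReal.ofReal_add (norm_nonneg _) (norm_nonneg _)]
  exact ENNReal.ofReal_le_ofReal (Complex.norm_le_abs_re_add_abs_im z)

lemma enorm_re_le (z : ℂ) : ‖z.re‖ₑ ≤ ‖z‖ₑ := by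
  rw [← ofReal_norm, ← ofReal_norm]
  exact ENNReal.ofReal_le_ofReal (Complex.abs_re_le_norm z)

lemma enorm_im_le (z : ℂ) : ‖z.im‖ₑ ≤ ‖z‖ₑ := by
  rw [← ofReal_norm, ← ofReal_norm]
  exact ENNReal.ofReal_le_ofReal (Complex.abs_im_le_norm z)

/-- The constant in `lintegral_even_moment_complex_le`. -/
noncomputable def gaussConst (n : ℕ) : ℝ≥0∞ := 2 ^ (2 * n) * (2 * gaussMoment n)

lemma gaussConst_ne_top (n : ℕ) : gaussConst n ≠ ∞ :=
  ENNReal.mul_ne_top (by simp) (ENNReal.mul_ne_top (by simp) (gaussMoment_ne_top n))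

/-- The even moments of a complex variable with centred Gaussian real and imaginary parts are
controlled by the second one. -/
lemma lintegral_even_moment_complex_le {Z : Ω → ℂ}
    (hr : HasGaussianLaw (fun ω => (Z ω).re) P) (hr0 : ∫ ω, (Z ω).re ∂P = 0)
    (hi : HasGaussianLaw (fun ω => (Z ω).im) P) (hi0 : ∫ ω, (Z ω).im ∂P = 0) (n : ℕ) :
    ∫⁻ ω, ‖Z ω‖ₑ ^ (2 * n) ∂P ≤ gaussConst n * (∫⁻ ω, ‖Z ω‖ₑ ^ 2 ∂P) ^ n := by
  have hrm := hr.aemeasurable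
  calc ∫⁻ ω, ‖Z ω‖ₑ ^ (2 * n) ∂P
      ≤ ∫⁻ ω, 2 ^ (2 * n) * (‖(Z ω).re‖ₑ ^ (2 * n) + ‖(Z ω).im‖ₑ ^ (2 * n)) ∂P := by
        refine lintegral_mono fun ω => ?_
        refine le_trans ?_ (add_pow_le_two_pow_mul _ _ _)
        gcongr
        exact enorm_le_enorm_re_add_im _
    _ = 2 ^ (2 * n) * (∫⁻ ω, ‖(Z ω).re‖ₑ ^ (2 * n) ∂P + ∫⁻ ω, ‖(Z ω).im‖ₑ ^ (2 * n) ∂P) := by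
        rw [lintegral_const_mul' _ _ (by simp), lintegral_add_left' (by fun_prop)]
    _ ≤ 2 ^ (2 * n) * (gaussMoment n * (∫⁻ ω, ‖Z ω‖ₑ ^ 2 ∂P) ^ n
          + gaussMoment n * (∫⁻ ω, ‖Z ω‖ₑ ^ 2 ∂P) ^ n) := by
        rw [HasGaussianLaw.lintegral_even_moment hr hr0, HasGaussianLaw.lintegral_even_moment hi hi0]
        gcongr
        · exact enorm_re_le _
        · exact enorm_im_le _
    _ = _ := by rw [gaussConst]; ring

end GaussianMoments

/-! ### Quadratic forms in Gaussian vectors: decoupling, hypercontractivity, Isserlis' formula -/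

section QuadraticForms

variable {E : Type*} [NormedAddCommGroup E] [NormedSpace ℝ E] [CompleteSpace E]
  [SecondCountableTopology E] [MeasurableSpace E] [BorelSpace E] {μ : Measure E} [IsGaussian μ]

lemma integrable_norm_pow_gaussian (n : ℕ) : Integrable (fun x : E => ‖x‖ ^ n) μ :=
  (IsGaussian.memLp_id μ n (ENNReal.natCast_ne_top n)).integrable_norm_pow'

lemma integrable_of_norm_le_pow {F : Type*} [NormedAddCommGroup F] {f : E → F}
    (hf : AEStronglyMeasurable f μ) (C : ℝ) (n : ℕ) (h : ∀ x, ‖f x‖ ≤ C * ‖x‖ ^ n) :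
    Integrable f μ :=
  ((integrable_norm_pow_gaussian n).const_mul C).mono' hf (ae_of_all _ h)

/-- Rotation by `π/4`: functions of `x` and `y` with `x, y` independent centred Gaussian become
functions of `(u + v) / √2` and `(v - u) / √2`. -/
lemma map_rotation_pi_div_four (h0 : μ[id] = 0) :
    (μ.prod μ).map (fun p : E × E => ((√2 / 2 : ℝ) • (p.1 + p.2), (√2 / 2 : ℝ) • (p.2 - p.1)))
      = μ.prod μ := by
  conv_rhs => rw [← IsGaussian.map_rotation_eq_self h0 (Real.pi / 4)]
  congr 1
  ext p
  · simp [ContinuousLinearMap.rotation_apply]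
  · simp only [ContinuousLinearMap.rotation_apply, Real.cos_pi_div_four, Real.sin_pi_div_four]
    module

/-- The polarised form `(u, v) ↦ B(u, v) + B(v, u)`. -/
noncomputable def polar (B : E →L[ℝ] E →L[ℝ] ℂ) : E →L[ℝ] E →L[ℝ] ℂ := B + B.flip

omit [CompleteSpace E] [SecondCountableTopology E] [MeasurableSpace E] [BorelSpace E] in
@[simp] lemma polar_apply (B : E →L[ℝ] E →L[ℝ] ℂ) (u v : E) : polar B u v = B u v + B v u := rfl

omit [CompleteSpace E] [SecondCountableTopology E] [MeasurableSpace E] [BorelSpace E] in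
/-- The rotation turns the difference `B(x, x) - B(y, y)` of two copies of a quadratic form into a
bilinear form in the independent variables `u` and `v`: this is the decoupling identity. -/
lemma quadratic_rotation_sub (B : E →L[ℝ] E →L[ℝ] ℂ) (u v : E) :
    B ((√2 / 2 : ℝ) • (u + v)) ((√2 / 2 : ℝ) • (u + v)) -
      B ((√2 / 2 : ℝ) • (v - u)) ((√2 / 2 : ℝ) • (v - u)) = polar B u v := by
  have h : ((√2 : ℝ) : ℂ) ^ 2 = 2 := by
    rw [← Complex.ofReal_pow, Real.sq_sqrt (by norm_num)]; norm_num
  simp only [map_smul, map_add, map_sub, FunLike.coe_smul, Pi.smul_apply, FunLike.coe_add,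
    Pi.add_apply, FunLike.coe_sub, Pi.sub_apply, polar_apply, Complex.real_smul]
  push_cast
  linear_combination (1 / 2 : ℂ) * (B u v + B v u) * h

lemma lintegral_quadratic_sub (h0 : μ[id] = 0) (B : E →L[ℝ] E →L[ℝ] ℂ) (n : ℕ) :
    ∫⁻ x, ∫⁻ y, ‖B x x - B y y‖ₑ ^ n ∂μ ∂μ = ∫⁻ u, ∫⁻ v, ‖polar B u v‖ₑ ^ n ∂μ ∂μ := by
  have hB : Continuous (fun p : E × E => B p.1 p.1 - B p.2 p.2) := by fun_prop
  have hB' : Continuous (fun p : E × E => polar B p.1 p.2) := by fun_prop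
  rw [← lintegral_prod (fun p : E × E => ‖B p.1 p.1 - B p.2 p.2‖ₑ ^ n)
      (by exact (hB.measurable.enorm.pow_const n).aemeasurable),
    ← lintegral_prod (fun p : E × E => ‖polar B p.1 p.2‖ₑ ^ n)
      (by exact (hB'.measurable.enorm.pow_const n).aemeasurable)]
  conv_lhs => rw [← map_rotation_pi_div_four h0]
  rw [lintegral_map (hB.measurable.enorm.pow_const n) (by fun_prop)]
  simp only [quadratic_rotation_sub]

lemma integral_quadratic_sub_mul (h0 : μ[id] = 0) (B B' : E →L[ℝ] E →L[ℝ] ℂ) :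
    ∫ p : E × E, (B p.1 p.1 - B p.2 p.2) * (B' p.1 p.1 - B' p.2 p.2) ∂(μ.prod μ)
      = ∫ p : E × E, polar B p.1 p.2 * polar B' p.1 p.2 ∂(μ.prod μ) := by
  have hB : Continuous (fun p : E × E =>
    (B p.1 p.1 - B p.2 p.2) * (B' p.1 p.1 - B' p.2 p.2)) := by fun_prop
  conv_lhs => rw [← map_rotation_pi_div_four h0]
  rw [integral_map (by fun_prop) hB.aestronglyMeasurable]
  simp only [quadratic_rotation_sub]

omit [CompleteSpace E] [SecondCountableTopology E] [MeasurableSpace E] [BorelSpace E] in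
lemma norm_bilin_le (B : E →L[ℝ] E →L[ℝ] ℂ) (u v : E) : ‖B u v‖ ≤ ‖B‖ * ‖u‖ * ‖v‖ :=
  B.le_opNorm₂ u v

lemma integrable_quadratic (B : E →L[ℝ] E →L[ℝ] ℂ) : Integrable (fun x => B x x) μ :=
  integrable_of_norm_le_pow (by fun_prop) ‖B‖ 2 fun x => (norm_bilin_le B x x).trans_eq (by ring)

/-- A complex-valued linear functional of a centred Gaussian vector has Gaussian-type moments. -/
lemma lintegral_even_moment_linear_le (h0 : μ[id] = 0) (L : E →L[ℝ] ℂ) (n : ℕ) :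
    ∫⁻ x, ‖L x‖ₑ ^ (2 * n) ∂μ ≤ gaussConst n * (∫⁻ x, ‖L x‖ₑ ^ 2 ∂μ) ^ n := by
  have key : ∀ M : StrongDual ℝ E, HasGaussianLaw (fun x => M x) μ ∧ ∫ x, M x ∂μ = 0 := by
    intro M
    refine ⟨(IsGaussian.hasGaussianLaw_id (μ := μ)).map_fun M, ?_⟩
    rw [IsGaussian.integral_dual]
    simp only [id_eq] at h0
    simp [h0]
  have hr := key (Complex.reCLM.comp L)
  have hi := key (Complex.imCLM.comp L)
  exact lintegral_even_moment_complex_le hr.1 hr.2 hi.1 hi.2 n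

/-- Minkowski's inequality for the conditional variance `u ↦ ∫ ‖D(u, v)‖² dμ(v)` of a
decoupled bilinear form. -/
lemma lintegral_condVar_pow_le (h0 : μ[id] = 0) (D : E →L[ℝ] E →L[ℝ] ℂ)
    (hD : ∀ u v, D u v = D v u) (n : ℕ) :
    ∫⁻ u, (∫⁻ v, ‖D u v‖ₑ ^ 2 ∂μ) ^ n ∂μ
      ≤ gaussConst n * (∫⁻ u, ∫⁻ v, ‖D u v‖ₑ ^ 2 ∂μ ∂μ) ^ n := by
  rcases Nat.eq_zero_or_pos n with rfl | hn
  · simp [gaussConst, gaussMoment]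
  have hcont : Continuous (fun p : E × E => D p.1 p.2) := by fun_prop
  have hg : Measurable (fun p : E × E => ‖D p.1 p.2‖ₑ ^ 2) := hcont.measurable.enorm.pow_const 2
  set S : E → ℝ≥0∞ := fun u => ∫⁻ v, ‖D u v‖ₑ ^ 2 ∂μ with hS
  have hSm : Measurable S := hg.lintegral_prod_right'
  set M := ∫⁻ u, S u ^ n ∂μ with hM
  set I := ∫⁻ u, S u ∂μ with hI
  have hnR : (0 : ℝ) < n := by exact_mod_cast hn
  have hMtop : M ≠ ∞ := by
    have hm : ∀ k : ℕ, ∫⁻ v : E, ‖v‖ₑ ^ k ∂μ ≠ ∞ := by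
      intro k
      rcases Nat.eq_zero_or_pos k with rfl | hk
      · simp
      · exact (lintegral_enorm_pow_lt_top hk.ne' (IsGaussian.memLp_id μ k
          (ENNReal.natCast_ne_top k))).ne
    have hle : ∀ u, S u ≤ (‖D‖ₑ ^ 2 * ∫⁻ v, ‖v‖ₑ ^ 2 ∂μ) * ‖u‖ₑ ^ 2 := by
      intro u
      rw [hS, mul_right_comm, ← lintegral_const_mul' _ _ (by finiteness)]
      refine lintegral_mono fun v => ?_
      have : ‖D u v‖ₑ ≤ ‖D‖ₑ * ‖u‖ₑ * ‖v‖ₑ := by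
        rw [← ofReal_norm, ← ofReal_norm, ← ofReal_norm, ← ofReal_norm,
          ← ENNReal.ofReal_mul (norm_nonneg _), ← ENNReal.ofReal_mul (by positivity)]
        exact ENNReal.ofReal_le_ofReal (norm_bilin_le D u v)
      calc ‖D u v‖ₑ ^ 2 ≤ (‖D‖ₑ * ‖u‖ₑ * ‖v‖ₑ) ^ 2 := by gcongr
        _ = _ := by ring
    have hK : (‖D‖ₑ ^ 2 * ∫⁻ v, ‖v‖ₑ ^ 2 ∂μ) ≠ ∞ := ENNReal.mul_ne_top (by finiteness) (hm 2)
    refine ne_top_of_le_ne_top (b := (‖D‖ₑ ^ 2 * ∫⁻ v, ‖v‖ₑ ^ 2 ∂μ) ^ n *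
      ∫⁻ u, ‖u‖ₑ ^ (2 * n) ∂μ) (ENNReal.mul_ne_top (ENNReal.pow_ne_top hK) (hm _)) ?_
    rw [← lintegral_const_mul' _ _ (ENNReal.pow_ne_top hK)]
    refine lintegral_mono fun u => ?_
    refine (pow_le_pow_left' (hle u) n).trans_eq ?_
    rw [mul_pow, ← pow_mul]
  rcases eq_or_ne M 0 with hM0 | hM0
  · rw [hM0]; exact zero_le
  set q : ℝ := (n : ℝ)⁻¹ with hq
  have hq0 : 0 ≤ q := by positivity
  have hq1 : 0 ≤ 1 - q := by
    rw [hq, sub_nonneg]; exact inv_le_one_of_one_le₀ (by exact_mod_cast hn)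
  -- Hölder's inequality in `u`, for each fixed `v`
  have hstep : M ≤ M ^ (1 - q) * ((gaussConst n) ^ q * I) := by
    calc M = ∫⁻ u, ∫⁻ v, S u ^ (n - 1) * ‖D u v‖ₑ ^ 2 ∂μ ∂μ := by
          refine lintegral_congr fun u => ?_
          rw [lintegral_const_mul _ (by fun_prop)]
          change S u ^ n = S u ^ (n - 1) * S u
          rw [← pow_succ, Nat.sub_add_cancel hn]
      _ = ∫⁻ v, ∫⁻ u, S u ^ (n - 1) * ‖D u v‖ₑ ^ 2 ∂μ ∂μ := by
          refine lintegral_lintegral_swap ?_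
          exact (((hSm.comp measurable_fst).pow_const (n - 1)).mul hg).aemeasurable
      _ ≤ ∫⁻ v, M ^ (1 - q) * ((gaussConst n) ^ q * S v) ∂μ := by
          refine lintegral_mono fun v => ?_
          have hgv : Measurable fun u => ‖D u v‖ₑ ^ (2 * n) := by fun_prop
          have h1 : ∀ u, S u ^ (n - 1) * ‖D u v‖ₑ ^ 2
              = (S u ^ n) ^ (1 - q) * (‖D u v‖ₑ ^ (2 * n)) ^ q := by
            intro u
            congr 1
            · rw [← ENNReal.rpow_natCast, ← ENNReal.rpow_natCast, ← ENNReal.rpow_mul]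
              congr 1
              rw [Nat.cast_sub hn, hq]; field_simp; simp
            · rw [← ENNReal.rpow_natCast, ← ENNReal.rpow_natCast, ← ENNReal.rpow_mul]
              congr 1
              rw [hq]; push_cast; field_simp
          simp_rw [h1]
          refine (ENNReal.lintegral_mul_norm_pow_le (hSm.pow_const n).aemeasurable
            hgv.aemeasurable hq1 hq0 (by ring)).trans ?_
          gcongr
          have h2 := lintegral_even_moment_linear_le h0 (D v) n
          have h3 : ∫⁻ u, ‖D u v‖ₑ ^ (2 * n) ∂μ ≤ gaussConst n * S v ^ n := by
            simp_rw [fun u => hD u v]; exact h2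
          calc (∫⁻ u, ‖D u v‖ₑ ^ (2 * n) ∂μ) ^ q ≤ (gaussConst n * S v ^ n) ^ q := by gcongr
            _ = (gaussConst n) ^ q * S v := by
              rw [ENNReal.mul_rpow_of_nonneg _ _ hq0, ← ENNReal.rpow_natCast (S v),
                ← ENNReal.rpow_mul, hq, mul_inv_cancel₀ hnR.ne', ENNReal.rpow_one]
      _ = M ^ (1 - q) * ((gaussConst n) ^ q * I) := by
          rw [lintegral_const_mul _ (by fun_prop), lintegral_const_mul _ hSm]
  have hMq : M ^ q ≤ (gaussConst n) ^ q * I := by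
    have h4 : M = M ^ (1 - q) * M ^ q := by
      rw [← ENNReal.rpow_add _ _ hM0 hMtop]; simp
    have h5 : M ^ (1 - q) ≠ ∞ := ENNReal.rpow_ne_top_of_nonneg hq1 hMtop
    have h6 : M ^ (1 - q) ≠ 0 := by
      simp [ENNReal.rpow_eq_zero_iff, hM0, hMtop]
    have h7 : M ^ (1 - q) * M ^ q ≤ M ^ (1 - q) * ((gaussConst n) ^ q * I) := by
      rw [← h4]; exact hstep
    exact (ENNReal.mul_le_mul_iff_right h6 h5).1 h7
  calc M = (M ^ q) ^ n := by
        rw [← ENNReal.rpow_natCast, ← ENNReal.rpow_mul, hq, inv_mul_cancel₀ hnR.ne',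
          ENNReal.rpow_one]
    _ ≤ ((gaussConst n) ^ q * I) ^ n := by gcongr
    _ = gaussConst n * I ^ n := by
        rw [mul_pow, ← ENNReal.rpow_natCast, ← ENNReal.rpow_mul, hq, inv_mul_cancel₀ hnR.ne',
          ENNReal.rpow_one]

/-- The constant of `hypercontractivity_quadratic`. -/
noncomputable def hyperConst (n : ℕ) : ℝ≥0∞ := gaussConst n * (gaussConst n * 8 ^ n)

lemma hyperConst_ne_top (n : ℕ) : hyperConst n ≠ ∞ :=
  ENNReal.mul_ne_top (gaussConst_ne_top n)
    (ENNReal.mul_ne_top (gaussConst_ne_top n) (by simp))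

/-- Hypercontractivity: the even moments of a centred quadratic form in a Gaussian vector are
controlled by its variance. Decoupling replaces `Q(x) - E Q` by `D(u, v)` with `u, v`
independent, which is Gaussian in `v` for fixed `u`. -/
theorem hypercontractivity_quadratic (h0 : μ[id] = 0) (B : E →L[ℝ] E →L[ℝ] ℂ) (n : ℕ) :
    ∫⁻ x, ‖B x x - ∫ y, B y y ∂μ‖ₑ ^ (2 * n) ∂μ
      ≤ hyperConst n * (∫⁻ x, ‖B x x - ∫ y, B y y ∂μ‖ₑ ^ 2 ∂μ) ^ n := by
  set m := ∫ y, B y y ∂μ with hm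
  have hI := integrable_quadratic (μ := μ) B
  have h1 : ∫⁻ x, ‖B x x - m‖ₑ ^ (2 * n) ∂μ
      ≤ ∫⁻ x, ∫⁻ y, ‖B x x - B y y‖ₑ ^ (2 * n) ∂μ ∂μ := by
    refine lintegral_mono fun x => ?_
    have h2 : B x x - m = ∫ y, (B x x - B y y) ∂μ := by
      rw [integral_sub (integrable_const _) hI]; simp [hm]
    have h3 : ‖B x x - m‖ₑ ≤ ∫⁻ y, ‖B x x - B y y‖ₑ ∂μ := by
      rw [h2]; exact enorm_integral_le_lintegral_enorm _
    refine (pow_le_pow_left' h3 _).trans ?_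
    have h4 := eLpNorm_le_eLpNorm_of_exponent_le (p := 1) (q := ((2 * n : ℕ) : ℝ≥0∞)) (μ := μ)
      (f := fun y => B x x - B y y)
    rcases Nat.eq_zero_or_pos n with rfl | hn
    · simp
    have h5 := h4 (by exact_mod_cast (by omega : 1 ≤ 2 * n)) (by fun_prop)
    rw [eLpNorm_one_eq_lintegral_enorm, eLpNorm_eq_lintegral_rpow_enorm_toReal
      (by simpa using hn.ne') (ENNReal.natCast_ne_top _)] at h5
    refine (pow_le_pow_left' h5 _).trans_eq ?_
    rw [← ENNReal.rpow_natCast, ← ENNReal.rpow_mul]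
    have hne : ((2 * n : ℕ) : ℝ) ≠ 0 := by exact_mod_cast (by omega : 2 * n ≠ 0)
    simp only [ENNReal.toReal_natCast]
    rw [one_div, inv_mul_cancel₀ hne, ENNReal.rpow_one]
    simp only [ENNReal.rpow_natCast]
  have hcont : Continuous fun x => B x x - m := by fun_prop
  have hgm : Measurable fun x => ‖B x x - m‖ₑ ^ 2 := hcont.measurable.enorm.pow_const 2
  have h6 : ∫⁻ x, ∫⁻ y, ‖B x x - B y y‖ₑ ^ 2 ∂μ ∂μ ≤ 8 * ∫⁻ x, ‖B x x - m‖ₑ ^ 2 ∂μ := by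
    calc ∫⁻ x, ∫⁻ y, ‖B x x - B y y‖ₑ ^ 2 ∂μ ∂μ
        ≤ ∫⁻ x, ∫⁻ y, (2 ^ 2 * ‖B x x - m‖ₑ ^ 2 + 2 ^ 2 * ‖B y y - m‖ₑ ^ 2) ∂μ ∂μ := by
          refine lintegral_mono fun x => lintegral_mono fun y => ?_
          rw [← mul_add]
          refine le_trans ?_ (add_pow_le_two_pow_mul _ _ 2)
          gcongr
          have : B x x - B y y = (B x x - m) - (B y y - m) := by ring
          rw [this]; exact enorm_sub_le
      _ = 8 * ∫⁻ x, ‖B x x - m‖ₑ ^ 2 ∂μ := by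
          simp_rw [lintegral_add_left measurable_const]
          rw [lintegral_add_right _ measurable_const]
          simp only [lintegral_const, measure_univ, mul_one]
          rw [lintegral_const_mul _ hgm]
          ring
  rw [lintegral_quadratic_sub h0] at h1 h6
  calc _ ≤ _ := h1
    _ ≤ ∫⁻ u, gaussConst n * (∫⁻ v, ‖polar B u v‖ₑ ^ 2 ∂μ) ^ n ∂μ :=
        lintegral_mono fun u => lintegral_even_moment_linear_le h0 _ n
    _ = gaussConst n * ∫⁻ u, (∫⁻ v, ‖polar B u v‖ₑ ^ 2 ∂μ) ^ n ∂μ :=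
        lintegral_const_mul' _ _ (gaussConst_ne_top n)
    _ ≤ gaussConst n * (gaussConst n * (∫⁻ u, ∫⁻ v, ‖polar B u v‖ₑ ^ 2 ∂μ ∂μ) ^ n) := by
        gcongr
        exact lintegral_condVar_pow_le h0 _ (fun u v => by simp [add_comm]) n
    _ ≤ gaussConst n * (gaussConst n * (8 * ∫⁻ x, ‖B x x - m‖ₑ ^ 2 ∂μ) ^ n) := by gcongr
    _ = _ := by rw [hyperConst, mul_pow]; ring

/-- Isserlis' formula for complex linear functionals of a centred Gaussian vector. -/
theorem integral_mul_four_gaussian (h0 : μ[id] = 0) (L₁ L₂ L₃ L₄ : E →L[ℝ] ℂ) :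
    ∫ x, L₁ x * L₂ x * (L₃ x * L₄ x) ∂μ =
      (∫ x, L₁ x * L₂ x ∂μ) * (∫ x, L₃ x * L₄ x ∂μ) +
      (∫ x, L₁ x * L₃ x ∂μ) * (∫ x, L₂ x * L₄ x ∂μ) +
      (∫ x, L₁ x * L₄ x ∂μ) * (∫ x, L₂ x * L₃ x ∂μ) := by
  let bil : (E →L[ℝ] ℂ) → (E →L[ℝ] ℂ) → (E →L[ℝ] E →L[ℝ] ℂ) := fun L L' =>
    ((ContinuousLinearMap.mul ℝ ℂ).comp L).flip.comp L' |>.flip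
  have hbil : ∀ L L' u v, bil L L' u v = L u * L' v := fun L L' u v => rfl
  have hI2 : ∀ L L' : E →L[ℝ] ℂ, Integrable (fun x => L x * L' x) μ := fun L L' =>
    integrable_quadratic (bil L L')
  have hI4 : Integrable (fun x => L₁ x * L₂ x * (L₃ x * L₄ x)) μ := by
    refine integrable_of_norm_le_pow (by fun_prop) (‖L₁‖ * ‖L₂‖ * (‖L₃‖ * ‖L₄‖)) 4 fun x => ?_
    simp only [norm_mul]
    calc _ ≤ (‖L₁‖ * ‖x‖) * (‖L₂‖ * ‖x‖) * ((‖L₃‖ * ‖x‖) * (‖L₄‖ * ‖x‖)) := by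
          gcongr <;> exact ContinuousLinearMap.le_opNorm _ _
      _ = _ := by ring
  have key := integral_quadratic_sub_mul h0 (bil L₁ L₂) (bil L₃ L₄)
  simp only [hbil, polar_apply] at key
  have hc : Integrable (fun _ : E => (1 : ℂ)) μ := integrable_const _
  have e1 : ∀ p : E × E, (L₁ p.1 * L₂ p.1 - L₁ p.2 * L₂ p.2) *
      (L₃ p.1 * L₄ p.1 - L₃ p.2 * L₄ p.2) =
      (L₁ p.1 * L₂ p.1 * (L₃ p.1 * L₄ p.1) * 1 + 1 * (L₁ p.2 * L₂ p.2 * (L₃ p.2 * L₄ p.2))) -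
      ((L₁ p.1 * L₂ p.1) * (L₃ p.2 * L₄ p.2) + (L₃ p.1 * L₄ p.1) * (L₁ p.2 * L₂ p.2)) := by
    intro p; ring
  have e2 : ∀ p : E × E, (L₁ p.1 * L₂ p.2 + L₁ p.2 * L₂ p.1) *
      (L₃ p.1 * L₄ p.2 + L₃ p.2 * L₄ p.1) =
      ((L₁ p.1 * L₃ p.1) * (L₂ p.2 * L₄ p.2) + (L₁ p.1 * L₄ p.1) * (L₂ p.2 * L₃ p.2)) +
      ((L₂ p.1 * L₃ p.1) * (L₁ p.2 * L₄ p.2) + (L₂ p.1 * L₄ p.1) * (L₁ p.2 * L₃ p.2)) := by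
    intro p; ring
  simp only [e1, e2] at key
  have i1 := hI4.mul_prod hc
  have i2 := hc.mul_prod hI4
  have i3 := (hI2 L₁ L₂).mul_prod (hI2 L₃ L₄)
  have i4 := (hI2 L₃ L₄).mul_prod (hI2 L₁ L₂)
  have j1 := (hI2 L₁ L₃).mul_prod (hI2 L₂ L₄)
  have j2 := (hI2 L₁ L₄).mul_prod (hI2 L₂ L₃)
  have j3 := (hI2 L₂ L₃).mul_prod (hI2 L₁ L₄)
  have j4 := (hI2 L₂ L₄).mul_prod (hI2 L₁ L₃)
  have k1 := integral_sub (i1.add i2) (i3.add i4)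
  have k2 := integral_add (j1.add j2) (j3.add j4)
  simp only [Pi.add_apply] at k1 k2
  rw [k1, k2, integral_add i1 i2, integral_add i3 i4, integral_add j1 j2, integral_add j3 j4,
    integral_prod_mul (fun x => L₁ x * L₂ x * (L₃ x * L₄ x)) (fun _ => (1 : ℂ)),
    integral_prod_mul (fun _ => (1 : ℂ)) (fun x => L₁ x * L₂ x * (L₃ x * L₄ x)),
    integral_prod_mul (fun x => L₁ x * L₂ x) (fun x => L₃ x * L₄ x),
    integral_prod_mul (fun x => L₃ x * L₄ x) (fun x => L₁ x * L₂ x),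
    integral_prod_mul (fun x => L₁ x * L₃ x) (fun x => L₂ x * L₄ x),
    integral_prod_mul (fun x => L₁ x * L₄ x) (fun x => L₂ x * L₃ x),
    integral_prod_mul (fun x => L₂ x * L₃ x) (fun x => L₁ x * L₄ x),
    integral_prod_mul (fun x => L₂ x * L₄ x) (fun x => L₁ x * L₃ x)] at key
  simp only [integral_const, probReal_univ, one_smul, mul_one, one_mul] at key
  linear_combination (1 / 2 : ℂ) * key

end QuadraticForms

/-! ### Closed subspaces of `L²` and time integrals -/

section L2Subspace

variable {Ω : Type*} {mΩ : MeasurableSpace Ω} {P : Measure Ω} {𝕜 : Type*} [RCLike 𝕜]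

/-- The class in `L²` of the function `f` exists and belongs to the subspace `V`. -/
def InSub (V : Submodule 𝕜 (Lp 𝕜 2 P)) (f : Ω → 𝕜) : Prop :=
  ∃ hf : MemLp f 2 P, hf.toLp f ∈ V

namespace InSub

variable {V : Submodule 𝕜 (Lp 𝕜 2 P)} {f g : Ω → 𝕜}

lemma memLp (hf : InSub V f) : MemLp f 2 P := hf.1

lemma congr (hf : InSub V f) (h : f =ᵐ[P] g) : InSub V g := by
  obtain ⟨h1, h2⟩ := hf
  refine ⟨h1.ae_eq h, ?_⟩
  rwa [← MemLp.toLp_congr h1 (h1.ae_eq h) h]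

lemma of_mem {X : Lp 𝕜 2 P} (hX : X ∈ V) : InSub V X :=
  ⟨Lp.memLp X, by rwa [Lp.toLp_coeFn]⟩

lemma add (hf : InSub V f) (hg : InSub V g) : InSub V (fun ω => f ω + g ω) :=
  ⟨hf.1.add hg.1, by
    have := V.add_mem hf.2 hg.2
    rwa [← MemLp.toLp_add] at this⟩

lemma const_mul (hf : InSub V f) (c : 𝕜) : InSub V (fun ω => c * f ω) :=
  ⟨hf.1.const_mul c, by
    have := V.smul_mem c hf.2
    rwa [← MemLp.toLp_const_smul] at this⟩

lemma zero : InSub V (fun _ => (0 : 𝕜)) :=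
  (of_mem V.zero_mem).congr (Lp.coeFn_zero 𝕜 2 P)

lemma sub (hf : InSub V f) (hg : InSub V g) : InSub V (fun ω => f ω - g ω) := by
  convert hf.add (hg.const_mul (-1)) using 2
  ring

lemma sum {ι : Type*} (s : Finset ι) {F : ι → Ω → 𝕜} (h : ∀ i ∈ s, InSub V (F i)) :
    InSub V (fun ω => ∑ i ∈ s, F i ω) := by
  classical
  induction s using Finset.induction_on with
  | empty => simpa using zero
  | insert i s hi ih =>
    simp only [Finset.sum_insert hi]
    exact (h i (by simp)).add (ih fun j hj => h j (by simp [hj]))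

end InSub

variable {S : Type*} [MeasurableSpace S] {ν : Measure S} [IsFiniteMeasure ν] [SFinite P]
  {G : S → Ω → 𝕜}

/-- Cauchy–Schwarz for the average of a process over a finite measure. -/
lemma lintegral_enorm_sq_integral_le (hG : StronglyMeasurable (Function.uncurry G)) :
    ∫⁻ ω, ‖∫ s, G s ω ∂ν‖ₑ ^ 2 ∂P ≤ ν univ * ∫⁻ s, ∫⁻ ω, ‖G s ω‖ₑ ^ 2 ∂P ∂ν := by
  have hm : Measurable (fun p : S × Ω => ‖G p.1 p.2‖ₑ) := hG.measurable.enorm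
  rw [lintegral_lintegral_swap (by exact (hm.pow_const 2).aemeasurable),
    ← lintegral_const_mul' _ _ (measure_ne_top ν univ)]
  refine lintegral_mono fun ω => ?_
  have h1 : ‖∫ s, G s ω ∂ν‖ₑ ≤ ∫⁻ s, ‖G s ω‖ₑ ∂ν := enorm_integral_le_lintegral_enorm _
  have hmω : Measurable (fun s => ‖G s ω‖ₑ) := hm.comp measurable_prodMk_right
  have h2 := ENNReal.lintegral_mul_norm_pow_le (μ := ν) (f := fun s => ‖G s ω‖ₑ ^ 2)
    (g := fun _ => 1) (hmω.pow_const 2).aemeasurable aemeasurable_const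
    (p := 1 / 2) (q := 1 / 2) (by norm_num) (by norm_num) (by norm_num)
  have h3 : ∀ s, (‖G s ω‖ₑ ^ 2) ^ (1 / 2 : ℝ) * (1 : ℝ≥0∞) ^ (1 / 2 : ℝ) = ‖G s ω‖ₑ := by
    intro s
    rw [ENNReal.one_rpow, mul_one, ← ENNReal.rpow_natCast, ← ENNReal.rpow_mul]
    norm_num
  simp only [h3, lintegral_const, one_mul] at h2
  calc ‖∫ s, G s ω ∂ν‖ₑ ^ 2
      ≤ ((∫⁻ s, ‖G s ω‖ₑ ^ 2 ∂ν) ^ (1 / 2 : ℝ) * ν univ ^ (1 / 2 : ℝ)) ^ 2 := by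
        gcongr; exact h1.trans h2
    _ = ν univ * ∫⁻ s, ‖G s ω‖ₑ ^ 2 ∂ν := by
        rw [mul_pow, ← ENNReal.rpow_natCast, ← ENNReal.rpow_natCast, ← ENNReal.rpow_mul,
          ← ENNReal.rpow_mul]
        norm_num [mul_comm]

omit [SFinite P] in
lemma memLp_two_iff_lintegral {f : Ω → 𝕜} (hf : AEStronglyMeasurable f P) :
    MemLp f 2 P ↔ ∫⁻ ω, ‖f ω‖ₑ ^ 2 ∂P < ∞ := by
  rw [MemLp, eLpNorm_lt_top_iff_lintegral_rpow_enorm_lt_top (by norm_num) (by norm_num)]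
  simp [hf]

/-- The time integral of an `L²`-bounded process is square integrable. -/
lemma memLp_integral (hG : StronglyMeasurable (Function.uncurry G))
    {M : ℝ≥0∞} (hM : M ≠ ∞) (hGM : ∀ᵐ s ∂ν, ∫⁻ ω, ‖G s ω‖ₑ ^ 2 ∂P ≤ M) :
    MemLp (fun ω => ∫ s, G s ω ∂ν) 2 P := by
  have hG' : StronglyMeasurable (fun p : Ω × S => G p.2 p.1) :=
    hG.comp_measurable measurable_swap
  rw [memLp_two_iff_lintegral hG'.integral_prod_right'.aestronglyMeasurable]
  refine (lintegral_enorm_sq_integral_le hG).trans_lt ?_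
  refine ENNReal.mul_lt_top (measure_lt_top ν univ) ?_
  refine (lintegral_mono_ae hGM).trans_lt ?_
  rw [lintegral_const]
  exact ENNReal.mul_lt_top hM.lt_top (measure_lt_top ν univ)

/-- Exchange of expectation and time integral against a square integrable variable. -/
lemma integral_integral_mul (hG : StronglyMeasurable (Function.uncurry G))
    {M : ℝ≥0∞} (hM : M ≠ ∞) (hGM : ∀ᵐ s ∂ν, ∫⁻ ω, ‖G s ω‖ₑ ^ 2 ∂P ≤ M)
    {Y : Ω → 𝕜} (hY : MemLp Y 2 P) :
    ∫ ω, (∫ s, G s ω ∂ν) * Y ω ∂P = ∫ s, ∫ ω, G s ω * Y ω ∂P ∂ν := by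
  have hYm : AEStronglyMeasurable (fun p : S × Ω => Y p.2) (ν.prod P) :=
    hY.1.comp_quasiMeasurePreserving Measure.quasiMeasurePreserving_snd
  have hint : Integrable (fun p : S × Ω => G p.1 p.2 * Y p.2) (ν.prod P) := by
    have hm : AEStronglyMeasurable (fun p : S × Ω => G p.1 p.2 * Y p.2) (ν.prod P) :=
      hG.aestronglyMeasurable.mul hYm
    refine ⟨hm, ?_⟩
    rw [HasFiniteIntegral, lintegral_prod _ hm.enorm]
    have hYfin : ∫⁻ ω, ‖Y ω‖ₑ ^ 2 ∂P < ∞ := (memLp_two_iff_lintegral hY.1).1 hY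
    have hb : ∀ᵐ s ∂ν, ∫⁻ ω, ‖G s ω * Y ω‖ₑ ∂P ≤ M + ∫⁻ ω, ‖Y ω‖ₑ ^ 2 ∂P := by
      filter_upwards [hGM] with s hs
      calc ∫⁻ ω, ‖G s ω * Y ω‖ₑ ∂P ≤ ∫⁻ ω, (‖G s ω‖ₑ ^ 2 + ‖Y ω‖ₑ ^ 2) ∂P := by
            refine lintegral_mono fun ω => ?_
            rw [enorm_mul]
            rcases le_total ‖G s ω‖ₑ ‖Y ω‖ₑ with h | h
            · calc _ ≤ ‖Y ω‖ₑ * ‖Y ω‖ₑ := by gcongr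
                _ ≤ _ := by rw [← sq]; exact le_add_self
            · calc _ ≤ ‖G s ω‖ₑ * ‖G s ω‖ₑ := by gcongr
                _ ≤ _ := by rw [← sq]; exact le_self_add
        _ = ∫⁻ ω, ‖G s ω‖ₑ ^ 2 ∂P + ∫⁻ ω, ‖Y ω‖ₑ ^ 2 ∂P :=
            lintegral_add_right' _ (hY.1.enorm.pow_const 2)
        _ ≤ _ := by gcongr
    refine (lintegral_mono_ae hb).trans_lt ?_
    rw [lintegral_const]
    exact ENNReal.mul_lt_top (ENNReal.add_lt_top.2 ⟨hM.lt_top, hYfin⟩) (measure_lt_top ν univ)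
  rw [integral_integral_swap hint]
  refine integral_congr_ae (ae_of_all _ fun ω => ?_)
  exact (integral_mul_const (Y ω) (fun s => G s ω)).symm

/-- The pathwise time integral of a process with values in a closed subspace of `L²` stays in this
subspace, as it is orthogonal to the orthogonal complement. -/
lemma InSub.integral {V : Submodule 𝕜 (Lp 𝕜 2 P)} (hV : IsClosed (V : Set (Lp 𝕜 2 P)))
    (hG : StronglyMeasurable (Function.uncurry G))
    {M : ℝ≥0∞} (hM : M ≠ ∞) (hGM : ∀ᵐ s ∂ν, ∫⁻ ω, ‖G s ω‖ₑ ^ 2 ∂P ≤ M)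
    (hGV : ∀ᵐ s ∂ν, InSub V (G s)) :
    InSub V (fun ω => ∫ s, G s ω ∂ν) := by
  have hmem := memLp_integral (ν := ν) hG hM hGM
  refine ⟨hmem, ?_⟩
  have : CompleteSpace V := hV.completeSpace_coe
  rw [← Submodule.orthogonal_orthogonal V, Submodule.mem_orthogonal]
  intro Y hY
  rw [Submodule.mem_orthogonal'] at hY
  have hinner : ∀ (f : Ω → 𝕜) (hf : MemLp f 2 P),
      inner 𝕜 Y (hf.toLp f) = ∫ ω, f ω * (starRingEnd 𝕜) (Y ω) ∂P := by
    intro f hf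
    rw [L2.inner_def]
    refine integral_congr_ae ?_
    filter_upwards [hf.coeFn_toLp] with ω hω
    rw [hω, RCLike.inner_apply]
  have hYs : MemLp (fun ω => (starRingEnd 𝕜) (Y ω)) 2 P := (Lp.memLp Y).star
  rw [hinner, integral_integral_mul hG hM hGM hYs]
  refine integral_eq_zero_of_ae ?_
  filter_upwards [hGV] with s hs
  have := hY _ hs.2
  rwa [hinner] at this

end L2Subspace

/-! ### Gaussian spaces and their second chaos -/

section GaussianSpace

variable {Ω : Type*} {mΩ : MeasurableSpace Ω} {P : Measure Ω} [IsProbabilityMeasure P]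

/-- A Gaussian space: a closed subspace of `L²` consisting of centred Gaussian variables. -/
structure IsGaussianSpace (H : Submodule ℝ (Lp ℝ 2 P)) : Prop where
  isClosed : IsClosed (H : Set (Lp ℝ 2 P))
  gaussian : ∀ X ∈ H, HasGaussianLaw X P
  centered : ∀ X ∈ H, ∫ ω, X ω ∂P = 0

/-- Expectations of Lipschitz functions are continuous on `L²`. -/
lemma continuous_integral_comp_lipschitz {F : Type*} [NormedAddCommGroup F] [NormedSpace ℝ F]
    {φ : ℝ → F} {K : ℝ≥0} (hφ : LipschitzWith K φ) :
    Continuous (fun X : Lp ℝ 2 P => ∫ ω, φ (X ω) ∂P) := by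
  have hint : ∀ X : Lp ℝ 2 P, Integrable (fun ω => φ (X ω)) P := by
    intro X
    have hX : Integrable X P := (Lp.memLp X).integrable (by norm_num)
    refine ((integrable_const ‖φ 0‖).add (hX.norm.const_mul K)).mono'
      (hφ.continuous.comp_aestronglyMeasurable hX.1) (ae_of_all _ fun ω => ?_)
    have h1 := hφ.dist_le_mul (X ω) 0
    rw [dist_eq_norm, dist_zero_right] at h1
    calc ‖φ (X ω)‖ = ‖φ 0 + (φ (X ω) - φ 0)‖ := by rw [add_sub_cancel]
      _ ≤ ‖φ 0‖ + ‖φ (X ω) - φ 0‖ := norm_add_le _ _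
      _ ≤ ‖φ 0‖ + K * ‖X ω‖ := by gcongr
  refine LipschitzWith.continuous (K := K) (LipschitzWith.of_dist_le_mul fun X Y => ?_)
  rw [dist_eq_norm, ← integral_sub (hint X) (hint Y), dist_eq_norm]
  have hXY : MemLp (X - Y : Lp ℝ 2 P) 2 P := Lp.memLp _
  calc ‖∫ ω, (φ (X ω) - φ (Y ω)) ∂P‖ ≤ ∫ ω, K * ‖(X - Y : Lp ℝ 2 P) ω‖ ∂P := by
        refine norm_integral_le_of_norm_le ((hXY.integrable (by norm_num)).norm.const_mul _) ?_
        filter_upwards [Lp.coeFn_sub X Y] with ω hω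
        rw [hω, Pi.sub_apply, ← dist_eq_norm, ← dist_eq_norm]
        exact hφ.dist_le_mul _ _
    _ = K * ∫ ω, ‖(X - Y : Lp ℝ 2 P) ω‖ ∂P := integral_const_mul _ _
    _ ≤ K * ‖X - Y‖ := by
        gcongr
        rw [integral_norm_eq_lintegral_enorm hXY.1, ← eLpNorm_one_eq_lintegral_enorm, Lp.norm_def]
        exact ENNReal.toReal_mono hXY.eLpNorm_ne_top
          (eLpNorm_le_eLpNorm_of_exponent_le (by norm_num) hXY.1)

lemma lipschitzWith_cexp_mul_I (t : ℝ) :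
    LipschitzWith ‖t‖₊ (fun x : ℝ => Complex.exp (t * x * Complex.I)) := by
  refine LipschitzWith.of_dist_le_mul fun x y => ?_
  rw [dist_eq_norm, dist_eq_norm]
  have h := Real.norm_exp_I_mul_ofReal_sub_one_le (x := t * x - t * y)
  have e : Complex.exp (t * x * Complex.I) - Complex.exp (t * y * Complex.I)
      = Complex.exp ((t * y : ℝ) * Complex.I) *
        (Complex.exp (Complex.I * (t * x - t * y : ℝ)) - 1) := by
    rw [mul_sub, ← Complex.exp_add]
    push_cast
    ring_nf
  rw [e, norm_mul, Complex.norm_exp_ofReal_mul_I, one_mul]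
  refine h.trans_eq ?_
  rw [← mul_sub, norm_mul]
  rfl

/-- The closure in `L²` of a space of centred Gaussian variables is a Gaussian space. -/
lemma isGaussianSpace_closure (H : Submodule ℝ (Lp ℝ 2 P))
    (hg : ∀ X ∈ H, HasGaussianLaw X P) (hc : ∀ X ∈ H, ∫ ω, X ω ∂P = 0) :
    IsGaussianSpace H.topologicalClosure := by
  have hcl : ∀ X ∈ H.topologicalClosure, ∫ ω, X ω ∂P = 0 := by
    have : IsClosed {X : Lp ℝ 2 P | ∫ ω, X ω ∂P = 0} :=
      isClosed_eq (continuous_integral_comp_lipschitz LipschitzWith.id) continuous_const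
    intro X hX
    exact closure_minimal (fun X hX => hc X hX) this hX
  have hvar : ∀ X : Lp ℝ 2 P, ∫ ω, X ω ∂P = 0 → Var[X; P] = ‖X‖ ^ 2 := by
    intro X hX
    rw [variance_of_integral_eq_zero (Lp.memLp X).1.aemeasurable hX, ← real_inner_self_eq_norm_sq,
      L2.inner_def]
    refine integral_congr_ae (ae_of_all _ fun ω => ?_)
    simp [sq]
  have hchar : ∀ (X : Lp ℝ 2 P) (t : ℝ),
      charFun (P.map X) t = ∫ ω, Complex.exp (t * X ω * Complex.I) ∂P := by
    intro X t
    rw [charFun_apply_real, integral_map (Lp.memLp X).1.aemeasurable (by fun_prop)]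
  refine ⟨H.isClosed_topologicalClosure, fun X hX => ?_, hcl⟩
  have hXm : AEMeasurable X P := (Lp.memLp X).1.aemeasurable
  have : IsProbabilityMeasure (P.map X) := Measure.isProbabilityMeasure_map hXm
  suffices hmap : P.map X = gaussianReal 0 (‖X‖₊ ^ 2) from ⟨by rw [hmap]; infer_instance⟩
  refine Measure.ext_of_charFun (funext fun t => ?_)
  have hclosed : IsClosed {X : Lp ℝ 2 P | ∫ ω, Complex.exp (t * X ω * Complex.I) ∂P
      = Complex.exp (-((‖X‖ : ℂ) ^ 2 * t ^ 2 / 2))} := by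
    refine isClosed_eq (continuous_integral_comp_lipschitz (lipschitzWith_cexp_mul_I t)) ?_
    fun_prop
  have hsub : (H : Set (Lp ℝ 2 P)) ⊆ {X : Lp ℝ 2 P | ∫ ω, Complex.exp (t * X ω * Complex.I) ∂P
      = Complex.exp (-((‖X‖ : ℂ) ^ 2 * t ^ 2 / 2))} := by
    intro Y hY
    have hmap := (hg Y hY).map_eq_gaussianReal
    rw [mem_ofPred_eq, ← hchar, hmap, charFun_gaussianReal, hc Y hY, hvar Y (hc Y hY)]
    congr 1
    rw [Real.coe_toNNReal _ (by positivity)]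
    push_cast
    ring
  have h := closure_minimal hsub hclosed hX
  rw [mem_ofPred_eq] at h
  rw [hchar, h, charFun_gaussianReal]
  congr 1
  push_cast
  simp

variable {H : Submodule ℝ (Lp ℝ 2 P)}

omit [IsProbabilityMeasure P] in
lemma InSub.hasGaussianLaw (hH : IsGaussianSpace H) {X : Ω → ℝ} (hX : InSub H X) :
    HasGaussianLaw X P :=
  (hH.gaussian _ hX.2).congr hX.1.coeFn_toLp

omit [IsProbabilityMeasure P] in
lemma InSub.integral_eq_zero (hH : IsGaussianSpace H) {X : Ω → ℝ} (hX : InSub H X) :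
    ∫ ω, X ω ∂P = 0 := by
  rw [← hH.centered _ hX.2]
  exact integral_congr_ae hX.1.coeFn_toLp.symm

/-- Complex variables whose real and imaginary parts belong to the real Gaussian space `H`. -/
def InGauss (H : Submodule ℝ (Lp ℝ 2 P)) (Z : Ω → ℂ) : Prop :=
  InSub H (fun ω => (Z ω).re) ∧ InSub H (fun ω => (Z ω).im)

namespace InGauss

variable {Z Z' : Ω → ℂ}

omit [IsProbabilityMeasure P] in
lemma aestronglyMeasurable (hZ : InGauss H Z) : AEStronglyMeasurable Z P := by
  have h := (hZ.1.memLp.1.aemeasurable.complex_ofReal).add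
    ((hZ.2.memLp.1.aemeasurable.complex_ofReal).mul_const Complex.I)
  refine (h.congr (ae_of_all _ fun ω => ?_)).aestronglyMeasurable
  exact Complex.re_add_im _

omit [IsProbabilityMeasure P] in
/-- Finite families in a Gaussian space are Gaussian vectors. -/
lemma isGaussian_map (hH : IsGaussianSpace H) {ι : Type*} [Fintype ι] {Z : ι → Ω → ℂ}
    (hZ : ∀ i, InGauss H (Z i)) :
    IsGaussian (P.map (fun ω i => Z i ω)) ∧ (P.map (fun ω i => Z i ω))[id] = 0 := by
  classical
  have hm : AEMeasurable (fun ω i => Z i ω) P :=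
    aemeasurable_pi_lambda _ fun i => (hZ i).aestronglyMeasurable.aemeasurable
  have hL : ∀ L : StrongDual ℝ (ι → ℂ), InSub H (fun ω => L (fun i => Z i ω)) := by
    intro L
    have e : ∀ ω, L (fun i => Z i ω) = ∑ i, (L (Pi.single i 1) * (Z i ω).re +
        L (Pi.single i Complex.I) * (Z i ω).im) := by
      intro ω
      have h1 : (fun i => Z i ω) = ∑ i, ((Z i ω).re • (Pi.single i (1 : ℂ) : ι → ℂ) +
          (Z i ω).im • (Pi.single i Complex.I : ι → ℂ)) := by
        ext j
        simp [Finset.sum_apply, Pi.single_apply, Finset.sum_add_distrib]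
      conv_lhs => rw [h1]
      simp [map_sum, mul_comm]
    simp only [e]
    exact InSub.sum _ fun i _ => ((hZ i).1.const_mul _).add ((hZ i).2.const_mul _)
  have hG : IsGaussian (P.map (fun ω i => Z i ω)) := by
    refine isGaussian_of_isGaussian_map fun L => ?_
    rw [AEMeasurable.map_map_of_aemeasurable (by fun_prop) hm]
    exact ((hL L).hasGaussianLaw hH).isGaussian_map
  refine ⟨hG, ?_⟩
  refine SeparatingDual.eq_zero_of_forall_dual_eq_zero (R := ℝ) fun L => ?_
  have h2 := IsGaussian.integral_dual (μ := P.map (fun ω i => Z i ω)) L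
  simp only [id_eq] at h2 ⊢
  rw [← h2, integral_map hm (by fun_prop)]
  exact (hL L).integral_eq_zero hH

/-- Isserlis' formula. -/
lemma integral_mul_four (hH : IsGaussianSpace H) {A B C D : Ω → ℂ} (hA : InGauss H A)
    (hB : InGauss H B) (hC : InGauss H C) (hD : InGauss H D) :
    ∫ ω, A ω * B ω * (C ω * D ω) ∂P =
      (∫ ω, A ω * B ω ∂P) * (∫ ω, C ω * D ω ∂P) +
      (∫ ω, A ω * C ω ∂P) * (∫ ω, B ω * D ω ∂P) +
      (∫ ω, A ω * D ω ∂P) * (∫ ω, B ω * C ω ∂P) := by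
  let Z : Fin 4 → Ω → ℂ := ![A, B, C, D]
  have hZ : ∀ i, InGauss H (Z i) := by
    intro i; fin_cases i
    exacts [hA, hB, hC, hD]
  obtain ⟨h1, h2⟩ := isGaussian_map hH hZ
  have hm : AEMeasurable (fun ω i => Z i ω) P :=
    aemeasurable_pi_lambda _ fun i => (hZ i).aestronglyMeasurable.aemeasurable
  let π : Fin 4 → ((Fin 4 → ℂ) →L[ℝ] ℂ) := fun i => ContinuousLinearMap.proj i
  have h := integral_mul_four_gaussian h2 (π 0) (π 1) (π 2) (π 3)
  have hc2 : ∀ i j : Fin 4, ∫ x, π i x * π j x ∂(P.map (fun ω i => Z i ω))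
      = ∫ ω, Z i ω * Z j ω ∂P := fun i j => by
    rw [integral_map hm (by fun_prop)]; rfl
  simp only [hc2] at h
  rw [integral_map hm (by fun_prop)] at h
  exact h

omit [IsProbabilityMeasure P] in
lemma memLp_of_nat (hH : IsGaussianSpace H) (hZ : InGauss H Z) (n : ℕ) : MemLp Z n P := by
  have h1 := (hZ.1.hasGaussianLaw hH).memLp (ENNReal.natCast_ne_top n)
  have h2 := (hZ.2.hasGaussianLaw hH).memLp (ENNReal.natCast_ne_top n)
  refine (h1.norm.add h2.norm).mono' hZ.aestronglyMeasurable (ae_of_all _ fun ω => ?_)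
  exact Complex.norm_le_abs_re_add_abs_im _

lemma memLp_mul (hH : IsGaussianSpace H) (hZ : InGauss H Z) (hZ' : InGauss H Z') :
    MemLp (fun ω => Z ω * Z' ω) 2 P := by
  have : ENNReal.HolderTriple 4 4 2 := ⟨by
    rw [← two_mul, show (4 : ℝ≥0∞) = 2 * 2 by norm_num,
      ENNReal.mul_inv (by norm_num) (by norm_num), ← mul_assoc,
      ENNReal.mul_inv_cancel (by norm_num) (by norm_num), one_mul]⟩
  exact (hZ'.memLp_of_nat hH 4).mul (hZ.memLp_of_nat hH 4)

end InGauss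

/-- The second homogeneous chaos over the Gaussian space `H`, as a closed complex subspace
of `L²`. -/
noncomputable def chaos (H : Submodule ℝ (Lp ℝ 2 P)) : Submodule ℂ (Lp ℂ 2 P) :=
  (Submodule.span ℂ {F : Lp ℂ 2 P | ∃ Z Z' : Ω → ℂ, InGauss H Z ∧ InGauss H Z' ∧
    F =ᵐ[P] fun ω => Z ω * Z' ω - ∫ ω', Z ω' * Z' ω' ∂P}).topologicalClosure

omit [IsProbabilityMeasure P] in
lemma isClosed_chaos : IsClosed (chaos H : Set (Lp ℂ 2 P)) :=
  Submodule.isClosed_topologicalClosure _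

lemma inSub_chaos_mul (hH : IsGaussianSpace H) {Z Z' : Ω → ℂ} (hZ : InGauss H Z)
    (hZ' : InGauss H Z') :
    InSub (chaos H) (fun ω => Z ω * Z' ω - ∫ ω', Z ω' * Z' ω' ∂P) := by
  have hm : MemLp (fun ω => Z ω * Z' ω - ∫ ω', Z ω' * Z' ω' ∂P) 2 P :=
    (hZ.memLp_mul hH hZ').sub (memLp_const _)
  exact ⟨hm, Submodule.le_topologicalClosure _ (Submodule.subset_span
    ⟨Z, Z', hZ, hZ', hm.coeFn_toLp⟩)⟩

/-- Hypercontractivity for finite linear combinations of Wick products, which are quadratic forms in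
a finite-dimensional Gaussian vector. -/
lemma hypercontractivity_span (hH : IsGaussianSpace H) {F : Lp ℂ 2 P}
    (hF : F ∈ Submodule.span ℂ {F : Lp ℂ 2 P | ∃ Z Z' : Ω → ℂ, InGauss H Z ∧ InGauss H Z' ∧
      F =ᵐ[P] fun ω => Z ω * Z' ω - ∫ ω', Z ω' * Z' ω' ∂P}) (n : ℕ) :
    ∫⁻ ω, ‖F ω‖ₑ ^ (2 * n) ∂P ≤ hyperConst n * (∫⁻ ω, ‖F ω‖ₑ ^ 2 ∂P) ^ n := by
  obtain ⟨m, c, g, rfl⟩ := Submodule.mem_span_set'.1 hF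
  choose Z Z' hZ hZ' hg using fun i => (g i).2
  let X : Fin m ⊕ Fin m → Ω → ℂ := Sum.elim Z Z'
  have hX : ∀ i, InGauss H (X i) := by rintro (i | i); exacts [hZ i, hZ' i]
  obtain ⟨h1, h2⟩ := InGauss.isGaussian_map hH hX
  set μ := P.map (fun ω i => X i ω) with hμ
  have hm : AEMeasurable (fun ω i => X i ω) P :=
    aemeasurable_pi_lambda _ fun i => (hX i).aestronglyMeasurable.aemeasurable
  let π : Fin m ⊕ Fin m → ((Fin m ⊕ Fin m → ℂ) →L[ℝ] ℂ) := fun i => ContinuousLinearMap.proj i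
  let B : (Fin m ⊕ Fin m → ℂ) →L[ℝ] (Fin m ⊕ Fin m → ℂ) →L[ℝ] ℂ :=
    ∑ i, c i • (((ContinuousLinearMap.mul ℝ ℂ).comp (π (.inl i))).flip.comp (π (.inr i))).flip
  have hB : ∀ x, B x x = ∑ i, c i * (x (.inl i) * x (.inr i)) := by
    intro x
    simp [B, π]
  have hBc : Continuous fun x => B x x := by fun_prop
  have hmean : ∫ x, B x x ∂μ = ∑ i, c i * ∫ ω, Z i ω * Z' i ω ∂P := by
    rw [hμ, integral_map hm hBc.aestronglyMeasurable]
    simp only [hB]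
    rw [integral_finsetSum]
    · refine Finset.sum_congr rfl fun i _ => ?_
      rw [integral_const_mul]; rfl
    · intro i _
      exact (((hZ i).memLp_mul hH (hZ' i)).integrable (by norm_num)).const_mul _
  have hae : (∑ i, c i • (g i : Lp ℂ 2 P) : Lp ℂ 2 P) =ᵐ[P]
      fun ω => B (fun i => X i ω) (fun i => X i ω) - ∫ x, B x x ∂μ := by
    have h3 : ∀ᵐ ω ∂P, ∀ i, (g i : Lp ℂ 2 P) ω = Z i ω * Z' i ω - ∫ ω', Z i ω' * Z' i ω' ∂P :=
      ae_all_iff.2 hg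
    have h4 : ∀ᵐ ω ∂P, ∀ i, (c i • (g i : Lp ℂ 2 P) : Lp ℂ 2 P) ω = c i * (g i : Lp ℂ 2 P) ω :=
      ae_all_iff.2 fun i => by
        filter_upwards [Lp.coeFn_smul (c i) (g i : Lp ℂ 2 P)] with ω hω
        rw [hω]; rfl
    filter_upwards [h3, h4, Lp.coeFn_finsetSum Finset.univ (fun i => c i • (g i : Lp ℂ 2 P))]
      with ω h3 h4 h5
    rw [h5, Finset.sum_apply, hB, hmean, ← Finset.sum_sub_distrib]
    refine Finset.sum_congr rfl fun i _ => ?_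
    rw [h4, h3, mul_sub]; rfl
  have hmom : ∀ k : ℕ, ∫⁻ ω, ‖(∑ i, c i • (g i : Lp ℂ 2 P) : Lp ℂ 2 P) ω‖ₑ ^ k ∂P
      = ∫⁻ x, ‖B x x - ∫ y, B y y ∂μ‖ₑ ^ k ∂μ := by
    intro k
    have hc : Continuous fun x => B x x - ∫ y, B y y ∂μ := by fun_prop
    rw [hμ, lintegral_map' (hc.measurable.enorm.pow_const k).aemeasurable hm]
    refine lintegral_congr_ae ?_
    filter_upwards [hae] with ω hω
    rw [hω]
  rw [hmom, hmom]
  exact hypercontractivity_quadratic h2 B n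

/-- Hypercontractivity in the second chaos. -/
theorem hypercontractivity (hH : IsGaussianSpace H) {F : Ω → ℂ} (hF : InSub (chaos H) F) (n : ℕ) :
    ∫⁻ ω, ‖F ω‖ₑ ^ (2 * n) ∂P ≤ hyperConst n * (∫⁻ ω, ‖F ω‖ₑ ^ 2 ∂P) ^ n := by
  obtain ⟨hmem, hV⟩ := hF
  obtain ⟨x, hx, hlim⟩ := mem_closure_iff_seq_limit.1 hV
  have htm : TendstoInMeasure P (fun k => (x k : Ω → ℂ)) atTop (hmem.toLp F) :=
    tendstoInMeasure_of_tendsto_Lp hlim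
  obtain ⟨ns, hns, hae⟩ := htm.exists_seq_tendsto_ae
  have hsq : ∀ X : Lp ℂ 2 P, ∫⁻ ω, ‖X ω‖ₑ ^ 2 ∂P = ‖X‖ₑ ^ 2 := by
    intro X
    rw [Lp.enorm_def, eLpNorm_eq_lintegral_rpow_enorm_toReal (by norm_num) (by norm_num),
      ← ENNReal.rpow_natCast, ← ENNReal.rpow_mul]
    simp
  have hF2 : ∀ k : ℕ, ∫⁻ ω, ‖F ω‖ₑ ^ k ∂P = ∫⁻ ω, ‖hmem.toLp F ω‖ₑ ^ k ∂P := by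
    intro k
    refine lintegral_congr_ae ?_
    filter_upwards [hmem.coeFn_toLp] with ω hω
    rw [hω]
  rw [hF2, hF2, hsq]
  have hpt : ∀ᵐ ω ∂P, ‖hmem.toLp F ω‖ₑ ^ (2 * n)
      = liminf (fun k => ‖x (ns k) ω‖ₑ ^ (2 * n)) atTop := by
    filter_upwards [hae] with ω hω
    exact (((ENNReal.continuous_pow (2 * n)).tendsto _).comp
      (continuous_enorm.tendsto _ |>.comp hω)).liminf_eq.symm
  rw [lintegral_congr_ae hpt]
  refine (lintegral_liminf_le' fun k =>
    ((Lp.aestronglyMeasurable (x (ns k))).enorm.pow_const _)).trans ?_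
  have hlim2 : Tendsto (fun k => hyperConst n * (‖x (ns k)‖ₑ ^ 2) ^ n) atTop
      (𝓝 (hyperConst n * (‖hmem.toLp F‖ₑ ^ 2) ^ n)) := by
    refine ENNReal.Tendsto.const_mul ?_ (Or.inr (hyperConst_ne_top n))
    refine ((ENNReal.continuous_pow n).tendsto _).comp (((ENNReal.continuous_pow 2).tendsto _).comp ?_)
    exact (continuous_enorm.tendsto _).comp (hlim.comp hns.tendsto_atTop)
  rw [← hlim2.liminf_eq]
  refine liminf_le_liminf (Eventually.of_forall fun k => ?_)
  change _ ≤ hyperConst n * (‖x (ns k)‖ₑ ^ 2) ^ n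
  rw [← hsq]
  exact hypercontractivity_span hH (hx (ns k)) n

end GaussianSpace

/-! ### The Gaussian space of a family of independent Brownian motions -/

section Brownian

variable {Ω : Type*} {mΩ : MeasurableSpace Ω} {P : Measure Ω}

/-- A process with almost surely continuous paths is indistinguishable from a measurable process
all of whose paths are continuous. -/
lemma exists_continuous_version {B : ℝ≥0 → Ω → ℝ} (hm : ∀ t, AEMeasurable (B t) P)
    (hc : ∀ᵐ ω ∂P, Continuous fun t => B t ω) :
    ∃ B' : ℝ≥0 → Ω → ℝ, (∀ t, Measurable (B' t)) ∧ (∀ ω, Continuous fun t => B' t ω) ∧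
      ∀ᵐ ω ∂P, ∀ t, B t ω = B' t ω := by
  classical
  let d : ℕ → ℝ≥0 := TopologicalSpace.denseSeq ℝ≥0
  have hgood : ∀ᵐ ω ∂P, (Continuous fun t => B t ω) ∧ ∀ n, B (d n) ω = (hm (d n)).mk _ ω :=
    hc.and (ae_all_iff.2 fun n => (hm (d n)).ae_eq_mk)
  set N : Set Ω := toMeasurable P
    {ω | ¬ ((Continuous fun t => B t ω) ∧ ∀ n, B (d n) ω = (hm (d n)).mk _ ω)} with hN
  have hN0 : P N = 0 := by rw [hN, measure_toMeasurable]; exact hgood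
  have hNm : MeasurableSet N := measurableSet_toMeasurable _ _
  have hout : ∀ ω, ω ∉ N → (Continuous fun t => B t ω) ∧ ∀ n, B (d n) ω = (hm (d n)).mk _ ω := by
    intro ω hω
    by_contra h
    exact hω (subset_toMeasurable _ _ h)
  let B' : ℝ≥0 → Ω → ℝ := fun t ω => if ω ∈ N then 0 else B t ω
  have hB'c : ∀ ω, Continuous fun t => B' t ω := by
    intro ω
    by_cases h : ω ∈ N
    · simpa [B', h] using continuous_const
    · simpa [B', h] using (hout ω h).1
  refine ⟨B', fun t => ?_, hB'c, ?_⟩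
  · have hd : ∀ n, Measurable (B' (d n)) := by
      intro n
      have : B' (d n) = fun ω => if ω ∈ N then 0 else (hm (d n)).mk _ ω := by
        ext ω
        by_cases h : ω ∈ N
        · simp [B', h]
        · simp [B', h, (hout ω h).2 n]
      rw [this]
      exact Measurable.ite hNm measurable_const (hm (d n)).measurable_mk
    obtain ⟨u, hu, hut⟩ := mem_closure_iff_seq_limit.1 ((TopologicalSpace.denseRange_denseSeq ℝ≥0) t)
    choose n hn using hu
    refine measurable_of_tendsto_metrizable (fun j => hd (n j)) (tendsto_pi_nhds.2 fun ω => ?_)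
    have := ((hB'c ω).tendsto t).comp hut
    refine this.congr fun j => ?_
    simp only [Function.comp_apply, ← hn j, d]
  · have : ∀ᵐ ω ∂P, ω ∉ N := measure_eq_zero_iff_ae_notMem.1 hN0
    filter_upwards [this] with ω hω t
    simp [B', hω]

/-- Independent Brownian motions, indexed by `ℤ`, with measurable continuous paths. -/
structure IsBrownianFamily (B : ℤ → ℝ≥0 → Ω → ℝ) (P : Measure Ω) : Prop where
  measurable : ∀ k t, Measurable (B k t)
  continuous : ∀ k ω, Continuous fun t => B k t ω
  pre : ∀ k, IsPreBrownianReal (B k) P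
  indep : iIndepFun (fun (k : ℤ) (ω : Ω) (t : ℝ≥0) => B k t ω) P

lemma IsCylindricalBrownian.exists_brownianFamily {W : ℤ → ℝ≥0 → Ω → ℂ}
    (hW : IsCylindricalBrownian W P) :
    ∃ B : ℤ → ℝ≥0 → Ω → ℝ, IsBrownianFamily B P ∧
      ∀ᵐ ω ∂P, ∀ k t, realComponent W k t ω = B k t ω := by
  choose B hm hc hae using fun k => exists_continuous_version
    (fun t => (hW.brownian k).toIsPreBrownianReal.aemeasurable t) (hW.brownian k).cont
  refine ⟨B, ⟨hm, hc, fun k => (hW.brownian k).toIsPreBrownianReal.congr fun t => ?_, ?_⟩,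
    ae_all_iff.2 hae⟩
  · filter_upwards [hae k] with ω hω using hω t
  · refine hW.indep.congr fun k => ?_
    filter_upwards [hae k] with ω hω using funext hω

variable [IsProbabilityMeasure P] {B : ℤ → ℝ≥0 → Ω → ℝ}

namespace IsBrownianFamily

lemma memLp (hB : IsBrownianFamily B P) (k : ℤ) (t : ℝ≥0) : MemLp (B k t) 2 P :=
  ((hB.pre k).hasLaw_eval t).hasGaussianLaw.memLp_two

/-- The linear span of all the values of the Brownian motions. -/
noncomputable def preGauss (hB : IsBrownianFamily B P) : Submodule ℝ (Lp ℝ 2 P) :=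
  ⨆ k, Submodule.span ℝ (range fun t => (hB.memLp k t).toLp (B k t))

lemma preGauss_gaussian (hB : IsBrownianFamily B P) {X : Lp ℝ 2 P} (hX : X ∈ hB.preGauss) :
    HasGaussianLaw X P ∧ ∫ ω, X ω ∂P = 0 := by
  classical
  obtain ⟨f, hf, rfl⟩ := (Submodule.mem_iSup_iff_exists_finsupp _ _).1 hX
  choose c hc using fun k => (Finsupp.mem_span_range_iff_exists_finsupp.1 (hf k))
  -- each component is a linear functional of one Brownian path
  let g : ℤ → (ℝ≥0 → ℝ) → ℝ := fun k b => ∑ t ∈ (c k).support, c k t * b t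
  have hg : ∀ k, (f k : Ω → ℝ) =ᵐ[P] fun ω => g k (fun t => B k t ω) := by
    intro k
    rw [← hc k, Finsupp.sum]
    have h1 : ∀ᵐ ω ∂P, ∀ t ∈ (c k).support,
        (c k t • (hB.memLp k t).toLp (B k t) : Lp ℝ 2 P) ω = c k t * B k t ω := by
      refine (ae_ball_iff (c k).support.countable_toSet).2 fun t _ => ?_
      filter_upwards [Lp.coeFn_smul (c k t) ((hB.memLp k t).toLp (B k t)),
        (hB.memLp k t).coeFn_toLp] with ω h1 h2
      rw [h1, Pi.smul_apply, h2, smul_eq_mul]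
    filter_upwards [h1, Lp.coeFn_finsetSum (c k).support
      (fun t => c k t • (hB.memLp k t).toLp (B k t))] with ω h1 h2
    rw [h2, Finset.sum_apply]
    exact Finset.sum_congr rfl h1
  have hgauss : ∀ k, HasGaussianLaw (fun ω => g k (fun t => B k t ω)) P := by
    intro k
    have h := ((hB.pre k).hasLaw (c k).support).hasGaussianLaw
    let L : ((c k).support → ℝ) →L[ℝ] ℝ :=
      ∑ t : (c k).support, c k t • ContinuousLinearMap.proj (R := ℝ) (φ := fun _ => ℝ) t
    have h2 := h.map_fun L
    refine h2.congr (ae_of_all _ fun ω => ?_)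
    simp [L, g, Finset.restrict]
    exact Finset.sum_attach (c k).support (fun t => c k t * B k t ω)
  have hcent : ∀ k, ∫ ω, g k (fun t => B k t ω) ∂P = 0 := by
    intro k
    rw [integral_finsetSum _ fun t _ => ((hB.pre k).integrable_eval t).const_mul _]
    refine Finset.sum_eq_zero fun t _ => ?_
    rw [integral_const_mul, (hB.pre k).integral_eval, mul_zero]
  have hsum : (f.sum fun _ x => x : Lp ℝ 2 P) =ᵐ[P]
      fun ω => ∑ k : f.support, g k (fun t => B k t ω) := by
    rw [Finsupp.sum]
    filter_upwards [Lp.coeFn_finsetSum f.support (fun k => f k), ae_all_iff.2 hg] with ω h1 h2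
    rw [h1, Finset.sum_apply, ← Finset.sum_coe_sort]
    exact Finset.sum_congr rfl fun k _ => h2 k
  have hind : iIndepFun (fun (k : f.support) ω => g k (fun t => B k t ω)) P := by
    have h1 := hB.indep.comp g (fun k => by fun_prop)
    exact h1.precomp (g := fun k : f.support => (k : ℤ)) Subtype.val_injective
  refine ⟨(iIndepFun.hasGaussianLaw_fun_sum (fun k : f.support => hgauss k) hind).congr hsum.symm, ?_⟩
  rw [integral_congr_ae hsum]
  refine (integral_finsetSum (f := fun (k : f.support) ω => g k (fun t => B k t ω)) Finset.univ
    fun k _ => (hgauss k).integrable).trans ?_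
  exact Finset.sum_eq_zero fun k _ => hcent k

/-- The Gaussian space generated by the Brownian motions. -/
noncomputable def gauss (hB : IsBrownianFamily B P) : Submodule ℝ (Lp ℝ 2 P) :=
  hB.preGauss.topologicalClosure

lemma isGaussianSpace (hB : IsBrownianFamily B P) : IsGaussianSpace hB.gauss :=
  isGaussianSpace_closure _ (fun _ hX => (hB.preGauss_gaussian hX).1)
    (fun _ hX => (hB.preGauss_gaussian hX).2)

lemma inSub (hB : IsBrownianFamily B P) (k : ℤ) (t : ℝ≥0) : InSub hB.gauss (B k t) :=
  ⟨hB.memLp k t, Submodule.le_topologicalClosure _ <|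
    Submodule.mem_iSup_of_mem k (Submodule.subset_span ⟨t, rfl⟩)⟩

lemma integral_mul_self (hB : IsBrownianFamily B P) (k : ℤ) (s t : ℝ≥0) :
    ∫ ω, B k s ω * B k t ω ∂P = min (s : ℝ) t := by
  have h := (hB.pre k).covariance_eval s t
  rw [covariance_eq_sub (hB.memLp k s) (hB.memLp k t), (hB.pre k).integral_eval] at h
  simpa using h

lemma integral_mul_of_ne (hB : IsBrownianFamily B P) {k m : ℤ} (hkm : k ≠ m) (s t : ℝ≥0) :
    ∫ ω, B k s ω * B m t ω ∂P = 0 := by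
  have m1 : ∀ r : ℝ≥0, Measurable (fun b : ℝ≥0 → ℝ => b r) := fun r => measurable_pi_apply r
  have h := (hB.indep.indepFun hkm).comp (m1 s) (m1 t)
  have h2 := h.integral_mul_eq_mul_integral (hB.memLp k s).1 (hB.memLp m t).1
  have h3 : ∫ ω, B k s ω ∂P = 0 := (hB.pre k).integral_eval s
  refine h2.trans ?_
  change (∫ ω, B k s ω ∂P) * _ = 0
  rw [h3, zero_mul]

end IsBrownianFamily

end Brownian

/-! ### Ornstein–Uhlenbeck processes and their covariance -/

section OU

/-- The covariance `(e^{-a|s-t|} - e^{-a(s+t)}) / (2a)` of the Ornstein–Uhlenbeck process with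
rate `a` started from `0`; it vanishes for `a = 0` since division by `0` gives `0`. -/
noncomputable def ouCov (a s t : ℝ) : ℝ :=
  (Real.exp (-a * |s - t|) - Real.exp (-a * (s + t))) / (2 * a)

lemma ouCov_comm (a s t : ℝ) : ouCov a s t = ouCov a t s := by
  rw [ouCov, ouCov, abs_sub_comm, add_comm]

lemma ouCov_nonneg {a : ℝ} (ha : 0 ≤ a) {s t : ℝ} (hs : 0 ≤ s) (ht : 0 ≤ t) :
    0 ≤ ouCov a s t := by
  refine div_nonneg (sub_nonneg.2 (Real.exp_le_exp.2 ?_)) (by positivity)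
  have : |s - t| ≤ s + t := abs_sub_le_of_nonneg_of_le hs (by linarith) ht (by linarith)
  nlinarith

lemma ouCov_le {a : ℝ} (ha : 0 ≤ a) (s t : ℝ) :
    ouCov a s t ≤ Real.exp (-a * |s - t|) / (2 * a) := by
  unfold ouCov
  gcongr
  linarith [Real.exp_pos (-a * (s + t))]

variable {Ω : Type*} {mΩ : MeasurableSpace Ω} {P : Measure Ω}

/-- The Ornstein–Uhlenbeck process `∫_0^t e^{-a(t-s)} dB_s` in integrated-by-parts form; the time
is clamped at `0`, so that the paths are continuous on the whole line. -/
noncomputable def ouReal (a : ℝ) (b : ℝ≥0 → ℝ) (t : ℝ) : ℝ :=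
  b t.toNNReal - ∫ s in (0 : ℝ)..(max t 0), a * Real.exp (-a * (max t 0 - s)) * b s.toNNReal

lemma continuous_ouReal (a : ℝ) {b : ℝ≥0 → ℝ} (hb : Continuous b) :
    Continuous (ouReal a b) := by
  have hb' : Continuous fun s : ℝ => b s.toNNReal := hb.comp continuous_real_toNNReal
  have e : ouReal a b = fun t => b t.toNNReal - a * Real.exp (-a * max t 0) *
      ∫ s in (0 : ℝ)..(max t 0), Real.exp (a * s) * b s.toNNReal := by
    ext t
    rw [ouReal, ← intervalIntegral.integral_const_mul]
    congr 1
    refine intervalIntegral.integral_congr fun s _ => ?_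
    rw [show -a * (max t 0 - s) = -a * max t 0 + a * s by ring, Real.exp_add]
    ring
  rw [e]
  have hp : Continuous fun t : ℝ => ∫ s in (0 : ℝ)..t, Real.exp (a * s) * b s.toNNReal :=
    intervalIntegral.continuous_primitive (fun _ _ => Continuous.intervalIntegrable (by fun_prop) _ _) _
  have hp' : Continuous fun t : ℝ => ∫ s in (0 : ℝ)..(max t 0), Real.exp (a * s) * b s.toNNReal :=
    hp.comp (by fun_prop)
  fun_prop

variable [IsProbabilityMeasure P] {B : ℤ → ℝ≥0 → Ω → ℝ}

namespace IsBrownianFamily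

lemma stronglyMeasurable_kernel (hB : IsBrownianFamily B P) (k : ℤ) (c : ℝ → ℝ)
    (hc : Continuous c) :
    StronglyMeasurable (Function.uncurry fun (s : ℝ) ω => c s * B k s.toNNReal ω) := by
  refine stronglyMeasurable_uncurry_of_continuous_of_stronglyMeasurable (fun ω => ?_) fun s => ?_
  · exact hc.mul ((hB.continuous k ω).comp continuous_real_toNNReal)
  · exact ((hB.measurable k _).const_mul _).stronglyMeasurable

lemma lintegral_kernel_le (hB : IsBrownianFamily B P) (k : ℤ) (c : ℝ → ℝ)
    (hc : Continuous c) (t : ℝ) :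
    ∃ M : ℝ≥0∞, M ≠ ∞ ∧ ∀ᵐ s ∂(volume.restrict (Ioc 0 t)),
      ∫⁻ ω, ‖c s * B k s.toNNReal ω‖ₑ ^ 2 ∂P ≤ M := by
  obtain ⟨K, hK⟩ := (isCompact_Icc (a := (0 : ℝ)) (b := t)).exists_bound_of_continuousOn
    hc.continuousOn
  refine ⟨ENNReal.ofReal (K ^ 2 * t), by simp, (ae_restrict_iff' measurableSet_Ioc).2
    (ae_of_all _ fun s hs => ?_)⟩
  have h1 : ∫⁻ ω, ‖c s * B k s.toNNReal ω‖ₑ ^ 2 ∂P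
      = ENNReal.ofReal (∫ ω, (c s * B k s.toNNReal ω) ^ 2 ∂P) := by
    rw [ofReal_integral_eq_lintegral_ofReal]
    · refine lintegral_congr fun ω => ?_
      rw [← ofReal_norm, ← ENNReal.ofReal_pow (norm_nonneg _), Real.norm_eq_abs, sq_abs]
    · exact (((hB.memLp k _).const_mul _)).integrable_sq
    · exact ae_of_all _ fun ω => sq_nonneg _
  rw [h1]
  refine ENNReal.ofReal_le_ofReal ?_
  have h2 : ∫ ω, (c s * B k s.toNNReal ω) ^ 2 ∂P = c s ^ 2 * s := by
    have h3 := hB.integral_mul_self k s.toNNReal s.toNNReal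
    rw [min_self, Real.coe_toNNReal s hs.1.le] at h3
    calc ∫ ω, (c s * B k s.toNNReal ω) ^ 2 ∂P
        = ∫ ω, c s ^ 2 * (B k s.toNNReal ω * B k s.toNNReal ω) ∂P :=
          integral_congr_ae (ae_of_all _ fun ω => by ring)
      _ = c s ^ 2 * s := by rw [integral_const_mul, h3]
  rw [h2]
  have h3 : |c s| ≤ K := hK s ⟨hs.1.le, hs.2⟩
  have h4 : c s ^ 2 ≤ K ^ 2 := sq_le_sq' (neg_le_of_abs_le h3) ((le_abs_self _).trans h3)
  have := hs.1.le
  gcongr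
  exact hs.2

/-- The Ornstein–Uhlenbeck process driven by the Brownian motion with index `k`. -/
noncomputable def ou (_hB : IsBrownianFamily B P) (k : ℤ) (a t : ℝ) (ω : Ω) : ℝ :=
  ouReal a (fun s => B k s ω) t

variable (hB : IsBrownianFamily B P)
include hB

lemma continuous_ou (k : ℤ) (a : ℝ) (ω : Ω) : Continuous fun t => hB.ou k a t ω :=
  continuous_ouReal a (hB.continuous k ω)

lemma continuous_kernel (a t : ℝ) : Continuous fun s : ℝ => a * Real.exp (-a * (max t 0 - s)) := by
  fun_prop

lemma ou_eq (k : ℤ) (a t : ℝ) (ω : Ω) : hB.ou k a t ω = B k t.toNNReal ω -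
    ∫ s in Ioc 0 (max t 0), a * Real.exp (-a * (max t 0 - s)) * B k s.toNNReal ω := by
  rw [ou, ouReal, intervalIntegral.integral_of_le (le_max_right _ _)]

lemma measurable_ou (k : ℤ) (a t : ℝ) : Measurable (hB.ou k a t) := by
  simp only [funext (hB.ou_eq k a t)]
  refine (hB.measurable k _).sub ?_
  have h := hB.stronglyMeasurable_kernel k _ (hB.continuous_kernel a t)
  exact (StronglyMeasurable.integral_prod_right' (ν := volume.restrict (Ioc 0 (max t 0)))
    (h.comp_measurable measurable_swap)).measurable

lemma inSub_ou (k : ℤ) (a t : ℝ) : InSub hB.gauss (hB.ou k a t) := by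
  simp only [funext (hB.ou_eq k a t)]
  refine (hB.inSub k _).sub ?_
  obtain ⟨M, hM, hM'⟩ := hB.lintegral_kernel_le k _ (hB.continuous_kernel a t) (max t 0)
  exact InSub.integral hB.isGaussianSpace.isClosed
    (hB.stronglyMeasurable_kernel k _ (hB.continuous_kernel a t)) hM hM'
    (ae_of_all _ fun s => (hB.inSub k _).const_mul _)

/-- The correlation of the Ornstein–Uhlenbeck process with a square integrable variable, in terms of
the correlations of the Brownian motion with this variable. -/
lemma integral_ou_mul (k : ℤ) (a t : ℝ) {Y : Ω → ℝ} (hY : MemLp Y 2 P) :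
    ∫ ω, hB.ou k a t ω * Y ω ∂P = ∫ ω, B k t.toNNReal ω * Y ω ∂P -
      ∫ s in (0 : ℝ)..(max t 0), a * Real.exp (-a * (max t 0 - s)) *
        ∫ ω, B k s.toNNReal ω * Y ω ∂P := by
  obtain ⟨M, hM, hM'⟩ := hB.lintegral_kernel_le k _ (hB.continuous_kernel a t) (max t 0)
  have hs := hB.stronglyMeasurable_kernel k _ (hB.continuous_kernel a t)
  have h1 := integral_integral_mul hs hM hM' hY
  have hmem := memLp_integral (P := P) hs hM hM'
  have i1 : Integrable (fun ω => B k t.toNNReal ω * Y ω) P := (hB.memLp k _).integrable_mul hY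
  have i2 : Integrable (fun ω => (∫ s in Ioc 0 (max t 0),
      a * Real.exp (-a * (max t 0 - s)) * B k s.toNNReal ω) * Y ω) P := hmem.integrable_mul hY
  simp only [hB.ou_eq, sub_mul]
  rw [integral_sub i1 i2, h1, intervalIntegral.integral_of_le (le_max_right _ _)]
  congr 1
  refine integral_congr_ae (ae_of_all _ fun s => ?_)
  simp only [mul_assoc, integral_const_mul]

lemma integral_ou_mul_of_ne {k m : ℤ} (hkm : k ≠ m) (a a' s t : ℝ) :
    ∫ ω, hB.ou k a s ω * hB.ou m a' t ω ∂P = 0 := by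
  have h1 : ∀ (r : ℝ≥0), ∫ ω, B k r ω * hB.ou m a' t ω ∂P = 0 := by
    intro r
    simp only [mul_comm (B k r _)]
    rw [hB.integral_ou_mul m a' t (hB.memLp k r)]
    simp [hB.integral_mul_of_ne hkm.symm]
  rw [hB.integral_ou_mul k a s (hB.inSub_ou m a' t).memLp]
  simp [h1]

lemma integral_brownian_mul_ou (k : ℤ) {a r t : ℝ} (ha : a ≠ 0) (hr : 0 ≤ r) (hrt : r ≤ t) :
    ∫ ω, B k r.toNNReal ω * hB.ou k a t ω ∂P
      = (Real.exp (-a * (t - r)) - Real.exp (-a * t)) / a := by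
  have ht : 0 ≤ t := hr.trans hrt
  simp only [mul_comm (B k r.toNNReal _)]
  rw [hB.integral_ou_mul k a t (hB.memLp k _), max_eq_left ht]
  simp only [hB.integral_mul_self, Real.coe_toNNReal _ ht, Real.coe_toNNReal _ hr]
  rw [min_eq_right hrt]
  have hcont : Continuous fun s : ℝ => a * Real.exp (-a * (t - s)) * min ((s.toNNReal : ℝ)) r := by
    fun_prop
  rw [← intervalIntegral.integral_add_adjacent_intervals (b := r)
    (hcont.intervalIntegrable _ _) (hcont.intervalIntegrable _ _)]
  have e : ∀ s : ℝ, HasDerivAt (fun s => Real.exp (-a * (t - s)))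
      (a * Real.exp (-a * (t - s))) s := by
    intro s
    have := (((hasDerivAt_id s).const_sub t).const_mul (-a)).exp
    simpa [mul_comm] using this
  have h1 : ∫ s in (0 : ℝ)..r, a * Real.exp (-a * (t - s)) * min ((s.toNNReal : ℝ)) r
      = ∫ s in (0 : ℝ)..r, a * Real.exp (-a * (t - s)) * s := by
    refine intervalIntegral.integral_congr fun s hs => ?_
    rw [uIcc_of_le hr] at hs
    simp only [Real.coe_toNNReal _ hs.1, min_eq_left hs.2]
  have h2 : ∫ s in r..t, a * Real.exp (-a * (t - s)) * min ((s.toNNReal : ℝ)) r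
      = ∫ s in r..t, a * Real.exp (-a * (t - s)) * r := by
    refine intervalIntegral.integral_congr fun s hs => ?_
    rw [uIcc_of_le hrt] at hs
    simp only [Real.coe_toNNReal _ (hr.trans hs.1), min_eq_right hs.1]
  have h3 : ∫ s in (0 : ℝ)..r, a * Real.exp (-a * (t - s)) * s =
      Real.exp (-a * (t - r)) * (r - 1 / a) - Real.exp (-a * (t - 0)) * (0 - 1 / a) := by
    refine intervalIntegral.integral_eq_sub_of_hasDerivAt
      (f := fun s => Real.exp (-a * (t - s)) * (s - 1 / a)) (fun s _ => ?_)
      (Continuous.intervalIntegrable (by fun_prop) _ _)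
    have := (e s).mul ((hasDerivAt_id s).sub_const (1 / a))
    refine this.congr_deriv ?_
    simp only [id]
    field_simp
    ring
  have h4 : ∫ s in r..t, a * Real.exp (-a * (t - s)) * r =
      Real.exp (-a * (t - t)) * r - Real.exp (-a * (t - r)) * r := by
    refine intervalIntegral.integral_eq_sub_of_hasDerivAt
      (f := fun s => Real.exp (-a * (t - s)) * r) (fun s _ => (e s).mul_const r)
      (Continuous.intervalIntegrable (by fun_prop) _ _)
  rw [h1, h2, h3, h4]
  simp only [sub_self, mul_zero, Real.exp_zero, sub_zero]
  field_simp
  ring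

/-- The covariance of the Ornstein–Uhlenbeck process. -/
lemma integral_ou_mul_self (k : ℤ) {a s t : ℝ} (ha : a ≠ 0) (hs : 0 ≤ s) (ht : 0 ≤ t) :
    ∫ ω, hB.ou k a s ω * hB.ou k a t ω ∂P = ouCov a s t := by
  wlog hst : s ≤ t generalizing s t
  · rw [ouCov_comm, ← this ht hs (le_of_not_ge hst)]
    simp only [mul_comm]
  rw [hB.integral_ou_mul k a s (hB.inSub_ou k a t).memLp, max_eq_left hs,
    hB.integral_brownian_mul_ou k ha hs hst]
  have h1 : ∫ u in (0 : ℝ)..s, a * Real.exp (-a * (s - u)) *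
        ∫ ω, B k u.toNNReal ω * hB.ou k a t ω ∂P
      = ∫ u in (0 : ℝ)..s, (Real.exp (-a * (s + t - 2 * u)) -
          Real.exp (-a * (s + t)) * Real.exp (a * u)) := by
    refine intervalIntegral.integral_congr fun u hu => ?_
    rw [uIcc_of_le hs] at hu
    rw [hB.integral_brownian_mul_ou k ha hu.1 (hu.2.trans hst)]
    rw [show -a * (s + t - 2 * u) = -a * (s - u) + -a * (t - u) by ring, Real.exp_add,
      show Real.exp (-a * (s + t)) * Real.exp (a * u) = Real.exp (-a * (s - u)) * Real.exp (-a * t) by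
        rw [← Real.exp_add, ← Real.exp_add]; ring_nf]
    field_simp
  have h2 : ∫ u in (0 : ℝ)..s, (Real.exp (-a * (s + t - 2 * u)) -
          Real.exp (-a * (s + t)) * Real.exp (a * u))
      = (Real.exp (-a * (s + t - 2 * s)) / (2 * a) - Real.exp (-a * (s + t)) * (Real.exp (a * s) / a))
        - (Real.exp (-a * (s + t - 2 * 0)) / (2 * a) -
          Real.exp (-a * (s + t)) * (Real.exp (a * 0) / a)) := by
    refine intervalIntegral.integral_eq_sub_of_hasDerivAt
      (f := fun u => Real.exp (-a * (s + t - 2 * u)) / (2 * a) -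
        Real.exp (-a * (s + t)) * (Real.exp (a * u) / a)) (fun u _ => ?_)
      (Continuous.intervalIntegrable (by fun_prop) _ _)
    have d1 := (((((hasDerivAt_id u).const_mul 2).const_sub (s + t)).const_mul (-a)).exp).div_const
      (2 * a)
    have d2 := ((((hasDerivAt_id u).const_mul a).exp).div_const a).const_mul
      (Real.exp (-a * (s + t)))
    refine (d1.sub d2).congr_deriv ?_
    simp only [id]
    field_simp
  rw [h1, h2, ouCov, abs_of_nonpos (by linarith)]
  have e1 : Real.exp (-a * (s + t)) * (Real.exp (a * s) / a) = Real.exp (-a * t) / a := by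
    rw [← mul_div_assoc, ← Real.exp_add]; ring_nf
  rw [e1, show s + t - 2 * s = t - s by ring, show -(s - t) = t - s by ring]
  simp only [mul_zero, sub_zero, Real.exp_zero]
  field_simp
  ring

end IsBrownianFamily

end OU

/-! ### The complex Ornstein–Uhlenbeck modes -/

section Modes

variable {Ω : Type*} {mΩ : MeasurableSpace Ω} {P : Measure Ω} [IsProbabilityMeasure P]

/-- Normalised complex Ornstein–Uhlenbeck modes `∫_0^t e^{-k²(t-s)} dW_s(k)`: jointly Gaussian with
continuous paths, `w_{-k} = conj w_k`, and `E[w_k(s) w_m(t)] = 0` unless `m = -k`.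
The index `k = 0` plays no role, and `w_0 = 0`. -/
structure IsOUFamily (H : Submodule ℝ (Lp ℝ 2 P)) (w : ℤ → ℝ → Ω → ℂ) : Prop where
  isGaussianSpace : IsGaussianSpace H
  measurable : ∀ k t, Measurable (w k t)
  continuous : ∀ k ω, Continuous fun t => w k t ω
  inGauss : ∀ k t, InGauss H (w k t)
  conj_eq : ∀ k t ω, conj (w k t ω) = w (-k) t ω
  cov : ∀ k m, ∀ s, 0 ≤ s → ∀ t, 0 ≤ t →
    ∫ ω, w k s ω * w m t ω ∂P = if m = -k then ((ouCov ((k : ℝ) ^ 2) s t : ℝ) : ℂ) else 0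

variable {B : ℤ → ℝ≥0 → Ω → ℝ}

/-- The complex modes built from real Brownian motions. -/
noncomputable def ouMode (hB : IsBrownianFamily B P) (k : ℤ) (t : ℝ) (ω : Ω) : ℂ :=
  if k = 0 then 0 else
    ((√2 / 2 * hB.ou |k| ((k : ℝ) ^ 2) t ω : ℝ) : ℂ) +
      ((√2 / 2 * ((SignType.sign k : ℤ) : ℝ) * hB.ou (-|k|) ((k : ℝ) ^ 2) t ω : ℝ) : ℂ) * Complex.I

lemma integral_complex_mul {X Y X' Y' : Ω → ℝ} (hX : MemLp X 2 P) (hY : MemLp Y 2 P)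
    (hX' : MemLp X' 2 P) (hY' : MemLp Y' 2 P) :
    ∫ ω, ((X ω : ℂ) + Y ω * Complex.I) * ((X' ω : ℂ) + Y' ω * Complex.I) ∂P =
      ((∫ ω, X ω * X' ω ∂P - ∫ ω, Y ω * Y' ω ∂P : ℝ) : ℂ) +
        ((∫ ω, X ω * Y' ω ∂P + ∫ ω, Y ω * X' ω ∂P : ℝ) : ℂ) * Complex.I := by
  have e : ∀ ω, ((X ω : ℂ) + Y ω * Complex.I) * ((X' ω : ℂ) + Y' ω * Complex.I) =
      ((X ω * X' ω - Y ω * Y' ω : ℝ) : ℂ) + ((X ω * Y' ω + Y ω * X' ω : ℝ) : ℂ) * Complex.I := by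
    intro ω
    push_cast
    linear_combination (Y ω * Y' ω : ℂ) * Complex.I_sq
  have i1 := hX.integrable_mul hX'
  have i2 := hY.integrable_mul hY'
  have i3 := hX.integrable_mul hY'
  have i4 := hY.integrable_mul hX'
  have j1 : Integrable (fun ω => X ω * X' ω - Y ω * Y' ω) P := i1.sub i2
  have j2 : Integrable (fun ω => X ω * Y' ω + Y ω * X' ω) P := i3.add i4
  simp only [e]
  rw [integral_add j1.ofReal (j2.ofReal.mul_const _), integral_mul_const]
  congr 1
  · rw [integral_complex_ofReal]; congr 1; exact integral_sub i1 i2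
  · congr 1; rw [integral_complex_ofReal]; congr 1; exact integral_add i3 i4

lemma isOUFamily_ouMode (hB : IsBrownianFamily B P) :
    IsOUFamily hB.gauss (ouMode hB) where
  isGaussianSpace := hB.isGaussianSpace
  measurable k t := by
    unfold ouMode
    split_ifs
    · exact measurable_const
    · have h1 := hB.measurable_ou |k| ((k : ℝ) ^ 2) t
      have h2 := hB.measurable_ou (-|k|) ((k : ℝ) ^ 2) t
      fun_prop
  continuous k ω := by
    unfold ouMode
    split_ifs
    · exact continuous_const
    · have h1 := hB.continuous_ou |k| ((k : ℝ) ^ 2) ω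
      have h2 := hB.continuous_ou (-|k|) ((k : ℝ) ^ 2) ω
      fun_prop
  inGauss k t := by
    unfold ouMode
    split_ifs with hk
    · exact ⟨by simpa using InSub.zero, by simpa using InSub.zero⟩
    · constructor
      · refine ((hB.inSub_ou |k| ((k : ℝ) ^ 2) t).const_mul (√2 / 2)).congr (ae_of_all _ fun ω => ?_)
        simp
      · refine ((hB.inSub_ou (-|k|) ((k : ℝ) ^ 2) t).const_mul
          (√2 / 2 * ((SignType.sign k : ℤ) : ℝ))).congr (ae_of_all _ fun ω => ?_)
        simp
  conj_eq k t ω := by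
    unfold ouMode
    by_cases hk : k = 0
    · simp [hk]
    · have hk' : -k ≠ 0 := by simpa using hk
      simp only [hk, hk', if_false, abs_neg, Int.cast_neg, neg_sq, map_add, map_mul,
        Complex.conj_ofReal, Complex.conj_I, Left.sign_neg]
      simp
  cov k m s hs t ht := by
    unfold ouMode
    by_cases hk : k = 0
    · subst hk
      simp [ouCov]
    by_cases hm : m = 0
    · subst hm
      have : (0 : ℤ) ≠ -k := fun h => hk (by omega)
      simp [this]
    simp only [hk, hm, if_false]
    have hk2 : ((k : ℝ) ^ 2) ≠ 0 := by positivity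
    rw [integral_complex_mul ((hB.inSub_ou _ _ _).memLp.const_mul _)
      ((hB.inSub_ou _ _ _).memLp.const_mul _) ((hB.inSub_ou _ _ _).memLp.const_mul _)
      ((hB.inSub_ou _ _ _).memLp.const_mul _)]
    have e : ∀ (c d : ℝ) (X Y : Ω → ℝ), ∫ ω, c * X ω * (d * Y ω) ∂P = c * d * ∫ ω, X ω * Y ω ∂P := by
      intro c d X Y
      rw [← integral_const_mul]
      congr 1; ext ω; ring
    simp only [e]
    have hk0 : 0 < |k| := abs_pos.2 hk
    have hm0 : 0 < |m| := abs_pos.2 hm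
    rw [hB.integral_ou_mul_of_ne (by omega : |k| ≠ -|m|),
      hB.integral_ou_mul_of_ne (by omega : -|k| ≠ |m|)]
    by_cases hkm : |k| = |m|
    · have hsq : (m : ℝ) ^ 2 = (k : ℝ) ^ 2 := by
        have : m ^ 2 = k ^ 2 := by rw [← sq_abs m, ← sq_abs k, hkm]
        exact_mod_cast this
      rw [← hkm, hsq, hB.integral_ou_mul_self _ hk2 hs ht, hB.integral_ou_mul_self _ hk2 hs ht]
      have h2 : (√2 : ℝ) ^ 2 = 2 := Real.sq_sqrt (by norm_num)
      rcases abs_eq_abs.1 hkm with rfl | rfl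
      · have : k ≠ -k := by omega
        rw [if_neg this]
        rcases lt_or_gt_of_ne hk with h | h
        · simp [sign_neg h]
        · simp [sign_pos h]
      · rw [neg_neg, if_pos rfl]
        have hre : √2 / 2 * (√2 / 2) * ouCov (((-m : ℤ) : ℝ) ^ 2) s t -
            √2 / 2 * ((SignType.sign (-m) : ℤ) : ℝ) * (√2 / 2 * ((SignType.sign m : ℤ) : ℝ)) *
              ouCov (((-m : ℤ) : ℝ) ^ 2) s t = ouCov (((-m : ℤ) : ℝ) ^ 2) s t := by
          rcases lt_or_gt_of_ne hm with h | h
          · rw [sign_neg h, sign_pos (by omega : 0 < -m)]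
            simp
            linear_combination (ouCov ((m : ℝ) ^ 2) s t / 2) * h2
          · rw [sign_pos h, sign_neg (by omega : -m < 0)]
            simp
            linear_combination (ouCov ((m : ℝ) ^ 2) s t / 2) * h2
        rw [hre]
        simp
    · rw [hB.integral_ou_mul_of_ne hkm, hB.integral_ou_mul_of_ne (by omega : -|k| ≠ -|m|)]
      have : m ≠ -k := fun h => hkm (by rw [h, abs_neg])
      simp [this]

/-- Almost surely, the Wiener integrals along `W` are the modes `ouMode`. -/
lemma IsCylindricalBrownian.wienerIntegral_eq {W : ℤ → ℝ≥0 → Ω → ℂ}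
    (hW : IsCylindricalBrownian W P) (hB : IsBrownianFamily B P)
    (hWB : ∀ᵐ ω ∂P, ∀ k t, realComponent W k t ω = B k t ω) :
    ∀ᵐ ω ∂P, ∀ k : ℤ, k ≠ 0 → ∀ t : ℝ, 0 ≤ t →
      wienerIntegral (fun s => Real.exp (-(k : ℝ) ^ 2 * (t - s))) (fun s => W k s ω) t
        = ouMode hB k t ω := by
  have h0 : ∀ᵐ ω ∂P, ∀ k, B k 0 ω = 0 := ae_all_iff.2 fun k => (hB.pre k).eval_zero_ae_eq_zero
  filter_upwards [hWB, h0, ae_all_iff.2 hW.conj_symm] with ω hω h0 hconj k hk t ht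
  have hs2 : (√2 : ℝ) ^ 2 = 2 := Real.sq_sqrt (by norm_num)
  have hpos : ∀ m : ℤ, 0 < m → ∀ s, W m s ω =
      ((√2 / 2 * B m s ω : ℝ) : ℂ) + ((√2 / 2 * B (-m) s ω : ℝ) : ℂ) * Complex.I := by
    intro m hm s
    have h1 := hω m s
    have h2 := hω (-m) s
    have hm' : ¬ (0 < -m) := by omega
    simp only [realComponent, hm.ne', hm, if_false, if_true] at h1
    simp only [realComponent, neg_eq_zero, hm.ne', hm', if_false, neg_neg] at h2
    apply Complex.ext
    · simp [← h1]; linear_combination -(W m s ω).re / 2 * hs2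
    · simp [← h2]; linear_combination -(W m s ω).im / 2 * hs2
  have hrep : ∀ s, W k s ω = ((√2 / 2 * B |k| s ω : ℝ) : ℂ) +
      ((√2 / 2 * ((SignType.sign k : ℤ) : ℝ) * B (-|k|) s ω : ℝ) : ℂ) * Complex.I := by
    intro s
    rcases lt_or_gt_of_ne hk with h | h
    · have h1 := hconj (-k) s
      rw [neg_neg, hpos (-k) (by omega)] at h1
      rw [h1, abs_of_neg h, sign_neg h, map_add, map_mul, Complex.conj_ofReal,
        Complex.conj_ofReal, Complex.conj_I]
      simp
    · rw [hpos k h, abs_of_pos h, sign_pos h]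
      simp
  have hder : ∀ s, deriv (fun s => Real.exp (-(k : ℝ) ^ 2 * (t - s))) s =
      (k : ℝ) ^ 2 * Real.exp (-(k : ℝ) ^ 2 * (t - s)) := by
    intro s
    have := (((hasDerivAt_id s).const_sub t).const_mul (-(k : ℝ) ^ 2)).exp
    rw [HasDerivAt.deriv (by simpa using this)]
    simp [mul_comm]
  have hBc : ∀ m, Continuous fun s : ℝ => B m s.toNNReal ω := fun m =>
    (hB.continuous m ω).comp continuous_real_toNNReal
  have hker : Continuous fun s : ℝ => (k : ℝ) ^ 2 * Real.exp (-(k : ℝ) ^ 2 * (t - s)) := by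
    fun_prop
  have hBc1 := hBc |k|
  have hBc2 := hBc (-|k|)
  simp only [wienerIntegral, hder, ouMode, hk, if_false, IsBrownianFamily.ou, ouReal,
    max_eq_left ht, hrep, h0]
  have hint : ∫ s in (0 : ℝ)..t, (((k : ℝ) ^ 2 * Real.exp (-(k : ℝ) ^ 2 * (t - s)) : ℝ) : ℂ) *
      (((√2 / 2 * B |k| s.toNNReal ω : ℝ) : ℂ) +
      ((√2 / 2 * ((SignType.sign k : ℤ) : ℝ) * B (-|k|) s.toNNReal ω : ℝ) : ℂ) * Complex.I) =
      ((√2 / 2 * ∫ s in (0 : ℝ)..t, (k : ℝ) ^ 2 * Real.exp (-(k : ℝ) ^ 2 * (t - s)) *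
        B |k| s.toNNReal ω : ℝ) : ℂ) +
      ((√2 / 2 * ((SignType.sign k : ℤ) : ℝ) * ∫ s in (0 : ℝ)..t,
        (k : ℝ) ^ 2 * Real.exp (-(k : ℝ) ^ 2 * (t - s)) * B (-|k|) s.toNNReal ω : ℝ) : ℂ) *
          Complex.I := by
    rw [← intervalIntegral.integral_const_mul, ← intervalIntegral.integral_const_mul,
      ← intervalIntegral.integral_ofReal, ← intervalIntegral.integral_ofReal,
      ← intervalIntegral.integral_mul_const, ← intervalIntegral.integral_add]
    · refine intervalIntegral.integral_congr fun s _ => ?_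
      push_cast
      ring
    · exact (Complex.continuous_ofReal.comp
        (continuous_const.mul (hker.mul hBc1))).intervalIntegrable _ _
    · exact ((Complex.continuous_ofReal.comp
        (continuous_const.mul (hker.mul hBc2))).mul_const _).intervalIntegrable _ _
  rw [hint]
  simp only [sub_self, mul_zero, Real.exp_zero, sub_zero]
  push_cast
  ring

/-- A cylindrical Brownian motion produces an Ornstein–Uhlenbeck family. -/
theorem IsCylindricalBrownian.exists_ouFamily {W : ℤ → ℝ≥0 → Ω → ℂ}
    (hW : IsCylindricalBrownian W P) :
    ∃ (H : Submodule ℝ (Lp ℝ 2 P)) (w : ℤ → ℝ → Ω → ℂ), IsOUFamily H w ∧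
      ∀ᵐ ω ∂P, ∀ k : ℤ, k ≠ 0 → ∀ t : ℝ, 0 ≤ t →
        wienerIntegral (fun s => Real.exp (-(k : ℝ) ^ 2 * (t - s))) (fun s => W k s ω) t
          = w k t ω := by
  obtain ⟨B, hB, hWB⟩ := hW.exists_brownianFamily
  exact ⟨hB.gauss, ouMode hB, isOUFamily_ouMode hB, hW.wienerIntegral_eq hB hWB⟩

end Modes

/-! ### Second moments of the quadratic modes and of their time integrals -/

section Quadratic

variable {Ω : Type*} {mΩ : MeasurableSpace Ω} {P : Measure Ω} [IsProbabilityMeasure P]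
  {H : Submodule ℝ (Lp ℝ 2 P)} {w : ℤ → ℝ → Ω → ℂ} {q : ℤ → ℂ} {F : Finset ℤ} {a : ℤ → ℤ → ℝ}

/-- A symmetric symbol `a(l, m)` supported in `F × F`. -/
structure IsSymbol (F : Finset ℤ) (a : ℤ → ℤ → ℝ) : Prop where
  symm : ∀ l m, a l m = a m l
  supp : ∀ l m, l ∉ F → a l m = 0

lemma IsSymbol.sub {b : ℤ → ℤ → ℝ} (ha : IsSymbol F a) (hb : IsSymbol F b) :
    IsSymbol F (fun l m => a l m - b l m) :=
  ⟨fun l m => by rw [ha.symm, hb.symm], fun l m h => by rw [ha.supp l m h, hb.supp l m h, sub_zero]⟩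

/-- The Fourier mode `∑_{l + m = k} a(l, m) z(l) z(m)` at time `s`, with `z(l) = q_l w_l`. -/
noncomputable def quadMode (q : ℤ → ℂ) (w : ℤ → ℝ → Ω → ℂ) (F : Finset ℤ) (a : ℤ → ℤ → ℝ)
    (s : ℝ) (ω : Ω) (k : ℤ) : ℂ :=
  ∑ l ∈ F, (a l (k - l) : ℂ) * (q l * q (k - l)) * (w l s ω * w (k - l) s ω)

/-- The Fourier modes of `∫_0^t e^{-(t-s)A} ∂_x (·) ds` applied to `quadMode`. -/
noncomputable def quadJ (q : ℤ → ℂ) (w : ℤ → ℝ → Ω → ℂ) (F : Finset ℤ) (a : ℤ → ℤ → ℝ)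
    (t : ℝ) (ω : Ω) (k : ℤ) : ℂ :=
  ∫ s in (0 : ℝ)..t, heat (t - s) (derivX (quadMode q w F a s ω)) k

/-- The stationary variance `|q_l|² / (2l²)` of the mode `z(l)`. -/
noncomputable def modeVar (q : ℤ → ℂ) (l : ℤ) : ℝ := ‖q l‖ ^ 2 / (2 * (l : ℝ) ^ 2)

lemma modeVar_nonneg (q : ℤ → ℂ) (l : ℤ) : 0 ≤ modeVar q l := by unfold modeVar; positivity

/-- The bound for the variance of `quadJ` at frequency `k`. -/
noncomputable def quadEnergy (q : ℤ → ℂ) (F : Finset ℤ) (a : ℤ → ℤ → ℝ) (k : ℤ) : ℝ :=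
  ∑ l ∈ F, 2 * (a l (k - l) ^ 2 * (modeVar q l * modeVar q (k - l))) *
    (2 / ((l : ℝ) ^ 2 + ((k - l : ℤ) : ℝ) ^ 2))

lemma quadEnergy_nonneg (q : ℤ → ℂ) (F : Finset ℤ) (a : ℤ → ℤ → ℝ) (k : ℤ) :
    0 ≤ quadEnergy q F a k := by
  refine Finset.sum_nonneg fun l _ => ?_
  have := modeVar_nonneg q l
  have := modeVar_nonneg q (k - l)
  positivity

/-- The covariance of `quadMode` at frequency `k`. -/
noncomputable def quadCov (q : ℤ → ℂ) (F : Finset ℤ) (a : ℤ → ℤ → ℝ) (k : ℤ) (s r : ℝ) : ℝ :=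
  ∑ l ∈ F, 2 * (a l (k - l) ^ 2 * ((‖q l‖ ^ 2 * ouCov ((l : ℝ) ^ 2) s r) *
    (‖q (k - l)‖ ^ 2 * ouCov (((k - l : ℤ) : ℝ) ^ 2) s r)))

lemma quadCov_nonneg (q : ℤ → ℂ) (F : Finset ℤ) (a : ℤ → ℤ → ℝ) (k : ℤ) {s r : ℝ}
    (hs : 0 ≤ s) (hr : 0 ≤ r) : 0 ≤ quadCov q F a k s r := by
  refine Finset.sum_nonneg fun l _ => ?_
  have := ouCov_nonneg (sq_nonneg (l : ℝ)) hs hr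
  have := ouCov_nonneg (sq_nonneg ((k - l : ℤ) : ℝ)) hs hr
  positivity

lemma quadCov_le (q : ℤ → ℂ) (F : Finset ℤ) (a : ℤ → ℤ → ℝ) (k : ℤ) {s r : ℝ}
    (hs : 0 ≤ s) (hr : 0 ≤ r) : quadCov q F a k s r ≤
      ∑ l ∈ F, 2 * (a l (k - l) ^ 2 * (modeVar q l * modeVar q (k - l))) *
        Real.exp (-((l : ℝ) ^ 2 + ((k - l : ℤ) : ℝ) ^ 2) * |s - r|) := by
  refine Finset.sum_le_sum fun l _ => ?_
  have key : ∀ m : ℤ, ‖q m‖ ^ 2 * ouCov ((m : ℝ) ^ 2) s r ≤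
      modeVar q m * Real.exp (-(m : ℝ) ^ 2 * |s - r|) := by
    intro m
    calc _ ≤ ‖q m‖ ^ 2 * (Real.exp (-(m : ℝ) ^ 2 * |s - r|) / (2 * (m : ℝ) ^ 2)) := by
          gcongr; exact ouCov_le (sq_nonneg _) _ _
      _ = _ := by unfold modeVar; ring
  have h1 := ouCov_nonneg (sq_nonneg (l : ℝ)) hs hr
  have h2 := ouCov_nonneg (sq_nonneg ((k - l : ℤ) : ℝ)) hs hr
  have h3 := modeVar_nonneg q l
  calc _ ≤ 2 * (a l (k - l) ^ 2 * ((modeVar q l * Real.exp (-(l : ℝ) ^ 2 * |s - r|)) *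
        (modeVar q (k - l) * Real.exp (-((k - l : ℤ) : ℝ) ^ 2 * |s - r|)))) := by
        have := mul_le_mul (key l) (key (k - l)) (by positivity) (by positivity)
        gcongr
    _ = _ := by
        rw [show -((l : ℝ) ^ 2 + ((k - l : ℤ) : ℝ) ^ 2) * |s - r| =
          -(l : ℝ) ^ 2 * |s - r| + -((k - l : ℤ) : ℝ) ^ 2 * |s - r| by ring, Real.exp_add]
        ring

namespace IsOUFamily

variable (hw : IsOUFamily H w)
include hw

lemma memLp_mul (l m : ℤ) (s : ℝ) : MemLp (fun ω => w l s ω * w m s ω) 2 P :=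
  (hw.inGauss l s).memLp_mul hw.isGaussianSpace (hw.inGauss m s)

lemma integral_mul_mul {k k' l l' : ℤ} (hk : k ≠ 0) {s r : ℝ}
    (hs : 0 ≤ s) (hr : 0 ≤ r) :
    ∫ ω, (w l s ω * w (k - l) s ω) * (w (-l') r ω * w (-(k' - l')) r ω) ∂P =
      if k = k' then ((if l' = l then 1 else 0) + (if l' = k - l then 1 else 0)) *
        ((ouCov ((l : ℝ) ^ 2) s r * ouCov (((k - l : ℤ) : ℝ) ^ 2) s r : ℝ) : ℂ) else 0 := by
  rw [InGauss.integral_mul_four hw.isGaussianSpace (hw.inGauss _ _) (hw.inGauss _ _)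
    (hw.inGauss _ _) (hw.inGauss _ _), hw.cov _ _ s hs s hs, hw.cov _ _ s hs r hr,
    hw.cov _ _ s hs r hr, hw.cov _ _ s hs r hr, hw.cov _ _ s hs r hr]
  have h0 : ¬ (k - l = -l) := fun h => hk (by omega)
  rw [if_neg h0, zero_mul, zero_add]
  by_cases hkk : k = k'
  · subst hkk
    rw [if_pos rfl]
    by_cases h1 : l' = l
    · subst h1
      by_cases h2 : l' = k - l'
      · rw [if_pos rfl, if_pos rfl, if_pos (by omega), if_pos (by omega), if_pos rfl, if_pos h2]
        push_cast; ring
      · rw [if_pos rfl, if_pos rfl, if_neg (by omega), if_pos rfl, if_neg h2]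
        push_cast; ring
    · by_cases h2 : l' = k - l
      · rw [if_neg (by omega : ¬ (-l' = -l)), if_pos (by omega : -(k - l') = -l),
          if_pos (by omega : -l' = -(k - l)), if_neg h1, if_pos h2]
        push_cast; ring
      · rw [if_neg (by omega : ¬ (-l' = -l)), if_neg (by omega : ¬ (-(k - l') = -l)), if_neg h1,
          if_neg h2]
        push_cast; ring
  · rw [if_neg hkk]
    by_cases h1 : l' = l
    · rw [if_neg (by omega : ¬ (-(k' - l') = -(k - l)))]
      by_cases h2 : l' = k - l
      · rw [if_neg (by omega : ¬ (-(k' - l') = -l))]; ring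
      · rw [if_neg (by omega : ¬ (-l' = -(k - l)))]; ring
    · rw [if_neg (by omega : ¬ (-l' = -l))]
      by_cases h2 : l' = k - l
      · rw [if_neg (by omega : ¬ (-(k' - l') = -l))]; ring
      · rw [if_neg (by omega : ¬ (-l' = -(k - l)))]; ring

lemma conj_quadMode (s : ℝ) (ω : Ω) (k : ℤ) : conj (quadMode q w F a s ω k) =
    ∑ l ∈ F, (a l (k - l) : ℂ) * conj (q l * q (k - l)) * (w (-l) s ω * w (-(k - l)) s ω) := by
  rw [quadMode, map_sum]
  refine Finset.sum_congr rfl fun l _ => ?_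
  rw [map_mul, map_mul, Complex.conj_ofReal, map_mul (starRingEnd ℂ) (w _ _ _), hw.conj_eq,
    hw.conj_eq]

/-- Distinct modes are uncorrelated, and the covariance of each mode is `quadCov`. -/
lemma integral_quadMode_mul_conj (ha : IsSymbol F a) {k k' : ℤ} (hk : k ≠ 0) {s r : ℝ}
    (hs : 0 ≤ s) (hr : 0 ≤ r) :
    ∫ ω, quadMode q w F a s ω k * conj (quadMode q w F a r ω k') ∂P =
      if k = k' then ((quadCov q F a k s r : ℝ) : ℂ) else 0 := by
  have hint : ∀ l l' : ℤ, Integrable (fun ω =>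
      (w l s ω * w (k - l) s ω) * (w (-l') r ω * w (-(k' - l')) r ω)) P := fun l l' =>
    (hw.memLp_mul l (k - l) s).integrable_mul (hw.memLp_mul (-l') (-(k' - l')) r)
  have e : ∀ ω, quadMode q w F a s ω k * conj (quadMode q w F a r ω k') =
      ∑ l ∈ F, ∑ l' ∈ F, ((a l (k - l) : ℂ) * (q l * q (k - l)) *
        ((a l' (k' - l') : ℂ) * conj (q l' * q (k' - l')))) *
        ((w l s ω * w (k - l) s ω) * (w (-l') r ω * w (-(k' - l')) r ω)) := by
    intro ω
    rw [hw.conj_quadMode, quadMode, Finset.sum_mul_sum]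
    refine Finset.sum_congr rfl fun l _ => Finset.sum_congr rfl fun l' _ => ?_
    ring
  simp only [e]
  rw [integral_finsetSum _ fun l _ => integrable_finsetSum _ fun l' _ => (hint l l').const_mul _]
  have e2 : ∀ l, ∫ ω, ∑ l' ∈ F, ((a l (k - l) : ℂ) * (q l * q (k - l)) *
        ((a l' (k' - l') : ℂ) * conj (q l' * q (k' - l')))) *
        ((w l s ω * w (k - l) s ω) * (w (-l') r ω * w (-(k' - l')) r ω)) ∂P =
      ∑ l' ∈ F, ((a l (k - l) : ℂ) * (q l * q (k - l)) *
        ((a l' (k' - l') : ℂ) * conj (q l' * q (k' - l')))) * (if k = k' then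
        ((if l' = l then 1 else 0) + (if l' = k - l then 1 else 0)) *
        ((ouCov ((l : ℝ) ^ 2) s r * ouCov (((k - l : ℤ) : ℝ) ^ 2) s r : ℝ) : ℂ) else 0) := by
    intro l
    rw [integral_finsetSum _ fun l' _ => (hint l l').const_mul _]
    refine Finset.sum_congr rfl fun l' _ => ?_
    rw [integral_const_mul, hw.integral_mul_mul hk hs hr]
  simp only [e2]
  by_cases hkk : k = k'
  · subst hkk
    simp only [if_true]
    rw [quadCov, Complex.ofReal_sum]
    refine Finset.sum_congr rfl fun l hl => ?_
    have hn : ∀ m : ℤ, q m * conj (q m) = ((‖q m‖ ^ 2 : ℝ) : ℂ) := by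
      intro m; rw [Complex.mul_conj, Complex.normSq_eq_norm_sq]
    have e3 : ∀ l' ∈ F, ((a l (k - l) : ℂ) * (q l * q (k - l)) *
        ((a l' (k - l') : ℂ) * conj (q l' * q (k - l')))) *
        (((if l' = l then 1 else 0) + (if l' = k - l then 1 else 0)) *
        ((ouCov ((l : ℝ) ^ 2) s r * ouCov (((k - l : ℤ) : ℝ) ^ 2) s r : ℝ) : ℂ)) =
        (if l' = l then ((a l (k - l) ^ 2 * ((‖q l‖ ^ 2 * ouCov ((l : ℝ) ^ 2) s r) *
          (‖q (k - l)‖ ^ 2 * ouCov (((k - l : ℤ) : ℝ) ^ 2) s r)) : ℝ) : ℂ) else 0) +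
        (if l' = k - l then ((a l (k - l) ^ 2 * ((‖q l‖ ^ 2 * ouCov ((l : ℝ) ^ 2) s r) *
          (‖q (k - l)‖ ^ 2 * ouCov (((k - l : ℤ) : ℝ) ^ 2) s r)) : ℝ) : ℂ) else 0) := by
      intro l' _
      rw [add_mul, mul_add]
      congr 1
      · by_cases h : l' = l
        · subst h
          simp only [if_true, one_mul, map_mul]
          have h1 := hn l'
          have h2 := hn (k - l')
          push_cast at h1 h2 ⊢
          rw [← h1, ← h2]; ring
        · simp [h]
      · by_cases h : l' = k - l
        · subst h
          simp only [if_true, one_mul, map_mul, sub_sub_cancel, ha.symm (k - l) l]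
          have h1 := hn l
          have h2 := hn (k - l)
          push_cast at h1 h2 ⊢
          rw [← h1, ← h2]; ring
        · simp [h]
    rw [Finset.sum_congr rfl e3, Finset.sum_add_distrib, Finset.sum_ite_eq' , if_pos hl,
      Finset.sum_ite_eq']
    by_cases h : k - l ∈ F
    · rw [if_pos h]; push_cast; ring
    · rw [if_neg h, ha.symm, ha.supp _ _ h]; simp
  · simp [hkk]

lemma inSub_quadMode {k : ℤ} (hk : k ≠ 0) {s : ℝ} (hs : 0 ≤ s) :
    InSub (chaos H) (fun ω => quadMode q w F a s ω k) := by
  refine InSub.sum F fun l _ => ?_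
  refine InSub.const_mul ?_ _
  refine (inSub_chaos_mul hw.isGaussianSpace (hw.inGauss l s) (hw.inGauss (k - l) s)).congr
    (ae_of_all _ fun ω => ?_)
  have h0 : ¬ (k - l = -l) := fun h => hk (by omega)
  simp only [hw.cov _ _ s hs s hs, if_neg h0, sub_zero]

end IsOUFamily

lemma integral_norm_sq_eq {X : Ω → ℂ} :
    ((∫ ω, ‖X ω‖ ^ 2 ∂P : ℝ) : ℂ) = ∫ ω, X ω * conj (X ω) ∂P := by
  rw [← integral_complex_ofReal]
  congr 1; ext ω
  rw [Complex.mul_conj, Complex.normSq_eq_norm_sq]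

lemma lintegral_enorm_sq_eq {X : Ω → ℂ} (hX : MemLp X 2 P) :
    ∫⁻ ω, ‖X ω‖ₑ ^ 2 ∂P = ENNReal.ofReal (∫ ω, ‖X ω‖ ^ 2 ∂P) := by
  rw [ofReal_integral_eq_lintegral_ofReal hX.norm.integrable_sq (ae_of_all _ fun ω => sq_nonneg _)]
  refine lintegral_congr fun ω => ?_
  rw [← ofReal_norm, ENNReal.ofReal_pow (norm_nonneg _)]

/-- `∫_u^t e^{-λ|r-s|} dr ≤ 2/λ`. -/
lemma integral_exp_neg_abs_le {c : ℝ} (hc : 0 < c) {u t s : ℝ} (hs : s ∈ Icc u t) :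
    ∫ r in u..t, Real.exp (-c * |r - s|) ≤ 2 / c := by
  have hcont : Continuous fun r : ℝ => Real.exp (-c * |r - s|) := by fun_prop
  rw [← intervalIntegral.integral_add_adjacent_intervals (b := s)
    (hcont.intervalIntegrable _ _) (hcont.intervalIntegrable _ _)]
  have h1 : ∫ r in u..s, Real.exp (-c * |r - s|) =
      Real.exp (-c * (s - s)) / c - Real.exp (-c * (s - u)) / c := by
    rw [← intervalIntegral.integral_eq_sub_of_hasDerivAt (f := fun r => Real.exp (-c * (s - r)) / c)
      (f' := fun r => Real.exp (-c * (s - r))) (fun r _ => ?_)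
      (Continuous.intervalIntegrable (by fun_prop) _ _)]
    · refine intervalIntegral.integral_congr fun r hr => ?_
      rw [uIcc_of_le hs.1] at hr
      simp only [abs_of_nonpos (sub_nonpos.2 hr.2), neg_sub]
    · have := (((((hasDerivAt_id r).const_sub s).const_mul (-c)).exp).div_const c)
      refine this.congr_deriv ?_
      simp only [id]; field_simp
  have h2 : ∫ r in s..t, Real.exp (-c * |r - s|) =
      -Real.exp (-c * (t - s)) / c - -Real.exp (-c * (s - s)) / c := by
    rw [← intervalIntegral.integral_eq_sub_of_hasDerivAt
      (f := fun r => -Real.exp (-c * (r - s)) / c)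
      (f' := fun r => Real.exp (-c * (r - s))) (fun r _ => ?_)
      (Continuous.intervalIntegrable (by fun_prop) _ _)]
    · refine intervalIntegral.integral_congr fun r hr => ?_
      rw [uIcc_of_le hs.2] at hr
      simp only [abs_of_nonneg (sub_nonneg.2 hr.1)]
    · have := (((((hasDerivAt_id r).sub_const s).const_mul (-c)).exp).neg.div_const c)
      refine this.congr_deriv ?_
      simp only [id]; field_simp
  rw [h1, h2]
  simp only [sub_self, mul_zero, Real.exp_zero]
  have e1 := Real.exp_pos (-c * (s - u))
  have e2 := Real.exp_pos (-c * (t - s))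
  have : 2 / c - (1 / c - Real.exp (-c * (s - u)) / c + (-Real.exp (-c * (t - s)) / c - -1 / c)) =
      (Real.exp (-c * (s - u)) + Real.exp (-c * (t - s))) / c := by ring
  have h3 : 0 ≤ (Real.exp (-c * (s - u)) + Real.exp (-c * (t - s))) / c := by positivity
  linarith

/-- The integral `∫_u^t e^{-k²(t-s)} G_s ds` of a quadratic mode. -/
noncomputable def quadInt (q : ℤ → ℂ) (w : ℤ → ℝ → Ω → ℂ) (F : Finset ℤ) (a : ℤ → ℤ → ℝ)
    (u t : ℝ) (ω : Ω) (k : ℤ) : ℂ :=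
  ∫ s in u..t, (Real.exp (-(k : ℝ) ^ 2 * (t - s)) : ℂ) * quadMode q w F a s ω k

lemma quadJ_eq (t : ℝ) (ω : Ω) (k : ℤ) :
    quadJ q w F a t ω k = Complex.I * k * quadInt q w F a 0 t ω k := by
  rw [quadJ, quadInt, ← intervalIntegral.integral_const_mul]
  refine intervalIntegral.integral_congr fun s _ => ?_
  simp only [heat, derivX]
  ring

namespace IsOUFamily

variable (hw : IsOUFamily H w)
include hw

lemma continuous_quadMode (ω : Ω) (k : ℤ) : Continuous fun s => quadMode q w F a s ω k := by
  unfold quadMode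
  refine continuous_finsetSum _ fun l _ => ?_
  exact continuous_const.mul ((hw.continuous l ω).mul (hw.continuous (k - l) ω))

lemma measurable_quadMode (s : ℝ) (k : ℤ) : Measurable fun ω => quadMode q w F a s ω k := by
  unfold quadMode
  refine Finset.measurable_fun_sum _ fun l _ => ?_
  exact ((hw.measurable l s).mul (hw.measurable (k - l) s)).const_mul _

lemma stronglyMeasurable_quadMode (t : ℝ) (k : ℤ) : StronglyMeasurable (Function.uncurry
    fun (s : ℝ) ω => (Real.exp (-(k : ℝ) ^ 2 * (t - s)) : ℂ) * quadMode q w F a s ω k) := by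
  refine stronglyMeasurable_uncurry_of_continuous_of_stronglyMeasurable (fun ω => ?_) fun s => ?_
  · have h : Continuous fun s : ℝ => Real.exp (-(k : ℝ) ^ 2 * (t - s)) := by fun_prop
    exact (Complex.continuous_ofReal.comp h).mul (hw.continuous_quadMode ω k)
  · exact ((hw.measurable_quadMode s k).const_mul _).stronglyMeasurable

lemma measurable_quadInt {u t : ℝ} (hut : u ≤ t) (k : ℤ) :
    Measurable fun ω => quadInt q w F a u t ω k := by
  simp only [quadInt, intervalIntegral.integral_of_le hut]
  exact (StronglyMeasurable.integral_prod_right' (ν := volume.restrict (Ioc u t))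
    ((hw.stronglyMeasurable_quadMode t k).comp_measurable measurable_swap)).measurable

lemma integral_norm_sq_quadMode (ha : IsSymbol F a) {k : ℤ} (hk : k ≠ 0) {s : ℝ} (hs : 0 ≤ s) :
    ∫ ω, ‖quadMode q w F a s ω k‖ ^ 2 ∂P = quadCov q F a k s s := by
  have h := hw.integral_quadMode_mul_conj (q := q) ha (k' := k) hk hs hs
  rw [← integral_norm_sq_eq, if_pos rfl] at h
  exact_mod_cast h

lemma lintegral_quadMode_le (ha : IsSymbol F a) {k : ℤ} (hk : k ≠ 0) {u : ℝ} (hu : 0 ≤ u) (t : ℝ) :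
    ∃ M : ℝ≥0∞, M ≠ ∞ ∧ ∀ᵐ s ∂(volume.restrict (Ioc u t)), ∫⁻ ω,
      ‖(Real.exp (-(k : ℝ) ^ 2 * (t - s)) : ℂ) * quadMode q w F a s ω k‖ₑ ^ 2 ∂P ≤ M := by
  refine ⟨ENNReal.ofReal (∑ l ∈ F, 2 * (a l (k - l) ^ 2 * (modeVar q l * modeVar q (k - l)))),
    by simp, (ae_restrict_iff' measurableSet_Ioc).2 (ae_of_all _ fun s hs => ?_)⟩
  have hs0 : 0 ≤ s := hu.trans hs.1.le
  have h1 : ∫⁻ ω, ‖quadMode q w F a s ω k‖ₑ ^ 2 ∂P ≤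
      ENNReal.ofReal (∑ l ∈ F, 2 * (a l (k - l) ^ 2 * (modeVar q l * modeVar q (k - l)))) := by
    rw [lintegral_enorm_sq_eq (hw.inSub_quadMode hk hs0).memLp,
      hw.integral_norm_sq_quadMode ha hk hs0]
    refine ENNReal.ofReal_le_ofReal ((quadCov_le q F a k hs0 hs0).trans_eq ?_)
    simp
  refine le_trans (lintegral_mono fun ω => ?_) h1
  gcongr
  rw [enorm_mul]
  refine mul_le_of_le_one_left' ?_
  rw [← ofReal_norm, Complex.norm_real, Real.norm_eq_abs, abs_of_pos (Real.exp_pos _),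
    ENNReal.ofReal_le_one, Real.exp_le_one_iff]
  nlinarith [sq_nonneg (k : ℝ), hs.2]

lemma inSub_quadInt (ha : IsSymbol F a) {k : ℤ} (hk : k ≠ 0) {u t : ℝ} (hu : 0 ≤ u) (hut : u ≤ t) :
    InSub (chaos H) (fun ω => quadInt q w F a u t ω k) := by
  simp only [quadInt, intervalIntegral.integral_of_le hut]
  obtain ⟨M, hM, hM'⟩ := hw.lintegral_quadMode_le (q := q) ha hk hu t
  refine InSub.integral isClosed_chaos (hw.stronglyMeasurable_quadMode t k) hM hM' ?_
  refine (ae_restrict_iff' measurableSet_Ioc).2 (ae_of_all _ fun s hs => ?_)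
  exact (hw.inSub_quadMode hk (hu.trans hs.1.le)).const_mul _

/-- Expectation and time integral may be exchanged for the integrated modes. -/
lemma integral_quadInt_mul (ha : IsSymbol F a) {k : ℤ} (hk : k ≠ 0) {u t : ℝ} (hu : 0 ≤ u)
    (hut : u ≤ t) {Y : Ω → ℂ} (hY : MemLp Y 2 P) :
    ∫ ω, quadInt q w F a u t ω k * Y ω ∂P = ∫ s in u..t,
      (Real.exp (-(k : ℝ) ^ 2 * (t - s)) : ℂ) * ∫ ω, quadMode q w F a s ω k * Y ω ∂P := by
  obtain ⟨M, hM, hM'⟩ := hw.lintegral_quadMode_le (q := q) ha hk hu t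
  simp only [quadInt, intervalIntegral.integral_of_le hut]
  rw [integral_integral_mul (hw.stronglyMeasurable_quadMode t k) hM hM' hY]
  refine integral_congr_ae (ae_of_all _ fun s => ?_)
  simp only [mul_assoc, integral_const_mul]

lemma integral_quadInt_mul_conj (ha : IsSymbol F a) {k : ℤ} (hk : k ≠ 0) {u t : ℝ} (hu : 0 ≤ u)
    (hut : u ≤ t) {Y : Ω → ℂ} (hY : MemLp Y 2 P) :
    ∫ ω, quadInt q w F a u t ω k * conj (Y ω) ∂P = ∫ s in u..t,
      (Real.exp (-(k : ℝ) ^ 2 * (t - s)) : ℂ) * ∫ ω, quadMode q w F a s ω k * conj (Y ω) ∂P :=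
  hw.integral_quadInt_mul ha hk hu hut hY.star

lemma integral_conj_comm {X Y : Ω → ℂ} :
    ∫ ω, X ω * conj (Y ω) ∂P = conj (∫ ω, Y ω * conj (X ω) ∂P) := by
  rw [← integral_conj]
  congr 1; ext ω
  rw [map_mul, Complex.conj_conj, mul_comm]

/-- The integrated modes at distinct frequencies are uncorrelated. -/
lemma integral_quadInt_mul_conj_of_ne (ha : IsSymbol F a) {k k' : ℤ} (hk : k ≠ 0) (hk' : k' ≠ 0)
    (hkk : k ≠ k') {u t u' t' : ℝ} (hu : 0 ≤ u) (hut : u ≤ t) (hu' : 0 ≤ u') (hut' : u' ≤ t') :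
    ∫ ω, quadInt q w F a u t ω k * conj (quadInt q w F a u' t' ω k') ∂P = 0 := by
  have hY := (hw.inSub_quadInt (q := q) ha hk' hu' hut').memLp
  rw [hw.integral_quadInt_mul_conj ha hk hu hut hY]
  have h : ∀ s ∈ uIcc u t, (Real.exp (-(k : ℝ) ^ 2 * (t - s)) : ℂ) *
      ∫ ω, quadMode q w F a s ω k * conj (quadInt q w F a u' t' ω k') ∂P = 0 := by
    intro s hs
    rw [uIcc_of_le hut] at hs
    have hs0 : 0 ≤ s := hu.trans hs.1
    rw [hw.integral_conj_comm, hw.integral_quadInt_mul_conj ha hk' hu' hut'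
      (hw.inSub_quadMode hk hs0).memLp]
    have h2 : ∀ r ∈ uIcc u' t', (Real.exp (-(k' : ℝ) ^ 2 * (t' - r)) : ℂ) *
        ∫ ω, quadMode q w F a r ω k' * conj (quadMode q w F a s ω k) ∂P = 0 := by
      intro r hr
      rw [uIcc_of_le hut'] at hr
      rw [hw.integral_quadMode_mul_conj ha hk' (hu'.trans hr.1) hs0, if_neg (Ne.symm hkk), mul_zero]
    have h3 : ∫ r in u'..t', (Real.exp (-(k' : ℝ) ^ 2 * (t' - r)) : ℂ) *
        ∫ ω, quadMode q w F a r ω k' * conj (quadMode q w F a s ω k) ∂P = 0 := by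
      rw [intervalIntegral.integral_congr h2]; simp
    exact (congrArg (fun z => _ * conj z) h3).trans (by simp)
  exact (intervalIntegral.integral_congr h).trans (by simp)

/-- The variance of the integrated mode. The factor `2/λ` in `quadEnergy` comes from the decay of
the covariance of the quadratic modes in time. -/
lemma integral_norm_sq_quadInt_le (ha : IsSymbol F a) {k : ℤ} (hk : k ≠ 0) {u t : ℝ} (hu : 0 ≤ u)
    (hut : u ≤ t) : ∫ ω, ‖quadInt q w F a u t ω k‖ ^ 2 ∂P ≤
      (∫ s in u..t, Real.exp (-(k : ℝ) ^ 2 * (t - s))) * quadEnergy q F a k := by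
  have hexp : ∀ s ∈ Ioc u t, Real.exp (-(k : ℝ) ^ 2 * (t - s)) ≤ 1 := by
    intro s hs
    rw [Real.exp_le_one_iff]
    nlinarith [sq_nonneg (k : ℝ), hs.2]
  have hY := (hw.inSub_quadInt (q := q) ha hk hu hut).memLp
  have hin : ∀ s ∈ Ioc u t,
      ‖∫ ω, quadMode q w F a s ω k * conj (quadInt q w F a u t ω k) ∂P‖ ≤ quadEnergy q F a k := by
    intro s hs
    have hs0 : 0 ≤ s := hu.trans hs.1.le
    rw [hw.integral_conj_comm, RCLike.norm_conj,
      hw.integral_quadInt_mul_conj ha hk hu hut (hw.inSub_quadMode hk hs0).memLp]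
    set g : ℝ → ℝ := fun r => ∑ l ∈ F, 2 * (a l (k - l) ^ 2 * (modeVar q l * modeVar q (k - l))) *
        Real.exp (-((l : ℝ) ^ 2 + ((k - l : ℤ) : ℝ) ^ 2) * |r - s|) with hg
    have hgc : Continuous g := by
      refine continuous_finsetSum _ fun l _ => ?_
      fun_prop
    have hb : ‖∫ r in u..t, (Real.exp (-(k : ℝ) ^ 2 * (t - r)) : ℂ) *
        ∫ ω, quadMode q w F a r ω k * conj (quadMode q w F a s ω k) ∂P‖ ≤ ∫ r in u..t, g r := by
      refine intervalIntegral.norm_integral_le_of_norm_le hut (ae_of_all _ fun r hr => ?_)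
        (hgc.intervalIntegrable _ _)
      have hr0 : 0 ≤ r := hu.trans hr.1.le
      rw [hw.integral_quadMode_mul_conj ha hk hr0 hs0, if_pos rfl, norm_mul, Complex.norm_real,
        Complex.norm_real, Real.norm_eq_abs, Real.norm_eq_abs, abs_of_pos (Real.exp_pos _),
        abs_of_nonneg (quadCov_nonneg q F a k hr0 hs0)]
      calc _ ≤ 1 * quadCov q F a k r s := by
            have := quadCov_nonneg q F a k hr0 hs0
            have := hexp r hr
            gcongr
        _ ≤ g r := by rw [one_mul]; exact quadCov_le q F a k hr0 hs0
    refine hb.trans ?_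
    rw [hg, intervalIntegral.integral_finsetSum
      (fun l _ => Continuous.intervalIntegrable (by fun_prop) _ _)]
    refine Finset.sum_le_sum fun l _ => ?_
    rw [intervalIntegral.integral_const_mul]
    have h3 := modeVar_nonneg q l
    have h4 := modeVar_nonneg q (k - l)
    refine mul_le_mul_of_nonneg_left (integral_exp_neg_abs_le ?_ ⟨hs.1.le, hs.2⟩) (by positivity)
    -- `l` and `k - l` do not vanish simultaneously
    rcases eq_or_ne l 0 with rfl | hl
    · have : (0 : ℝ) < (k : ℝ) ^ 2 := by positivity
      simpa using this
    · have : (0 : ℝ) < (l : ℝ) ^ 2 := by positivity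
      positivity
  have h1 : ((∫ ω, ‖quadInt q w F a u t ω k‖ ^ 2 ∂P : ℝ) : ℂ) = ∫ s in u..t,
      (Real.exp (-(k : ℝ) ^ 2 * (t - s)) : ℂ) *
        ∫ ω, quadMode q w F a s ω k * conj (quadInt q w F a u t ω k) ∂P := by
    rw [integral_norm_sq_eq]
    exact hw.integral_quadInt_mul_conj ha hk hu hut hY
  have h2 : ‖((∫ ω, ‖quadInt q w F a u t ω k‖ ^ 2 ∂P : ℝ) : ℂ)‖ ≤
      ∫ s in u..t, Real.exp (-(k : ℝ) ^ 2 * (t - s)) * quadEnergy q F a k := by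
    rw [h1]
    refine intervalIntegral.norm_integral_le_of_norm_le hut (ae_of_all _ fun s hs => ?_)
      (Continuous.intervalIntegrable (by fun_prop) _ _)
    rw [norm_mul, Complex.norm_real, Real.norm_eq_abs, abs_of_pos (Real.exp_pos _)]
    gcongr
    exact hin s hs
  rw [Complex.norm_real, intervalIntegral.integral_mul_const] at h2
  exact (le_abs_self _).trans h2

end IsOUFamily

end Quadratic

/-! ### Moments of the Duhamel integral -/

section Duhamel

variable {Ω : Type*} {mΩ : MeasurableSpace Ω} {P : Measure Ω} [IsProbabilityMeasure P]
  {H : Submodule ℝ (Lp ℝ 2 P)} {w : ℤ → ℝ → Ω → ℂ} {q : ℤ → ℂ} {F : Finset ℤ} {a : ℤ → ℤ → ℝ}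

lemma quadJ_freq_zero (t : ℝ) (ω : Ω) : quadJ q w F a t ω 0 = 0 := by
  rw [quadJ_eq]; simp

lemma quadJ_time_zero (ω : Ω) (k : ℤ) : quadJ q w F a 0 ω k = 0 := by
  simp [quadJ]

lemma integral_exp_neg_mul {c : ℝ} (hc : 0 < c) (u t : ℝ) :
    ∫ s in u..t, Real.exp (-c * (t - s)) = (1 - Real.exp (-c * (t - u))) / c := by
  have h : ∀ r ∈ uIcc u t, HasDerivAt (fun r => Real.exp (-c * (t - r)) / c)
      (Real.exp (-c * (t - r))) r := fun r _ => by
    have := (((((hasDerivAt_id r).const_sub t).const_mul (-c)).exp).div_const c)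
    refine this.congr_deriv ?_
    simp only [id]; field_simp
  rw [intervalIntegral.integral_eq_sub_of_hasDerivAt h
      (Continuous.intervalIntegrable (by fun_prop) _ _), sub_self, mul_zero, Real.exp_zero,
    sub_div]

namespace IsOUFamily

variable (hw : IsOUFamily H w)
include hw

lemma intervalIntegrable_quadInt (ω : Ω) (k : ℤ) (t u v : ℝ) :
    IntervalIntegrable (fun s => (Real.exp (-(k : ℝ) ^ 2 * (t - s)) : ℂ) * quadMode q w F a s ω k)
      volume u v := by
  have h : Continuous fun s : ℝ => Real.exp (-(k : ℝ) ^ 2 * (t - s)) := by fun_prop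
  exact ((Complex.continuous_ofReal.comp h).mul (hw.continuous_quadMode ω k)).intervalIntegrable _ _

/-- The semigroup property: the integral up to `t` is the decayed integral up to `u` plus the integral
over `[u, t]`. -/
lemma quadInt_add (ω : Ω) (k : ℤ) (u t : ℝ) :
    quadInt q w F a 0 t ω k =
      (Real.exp (-(k : ℝ) ^ 2 * (t - u)) : ℂ) * quadInt q w F a 0 u ω k + quadInt q w F a u t ω k := by
  unfold quadInt
  rw [← intervalIntegral.integral_add_adjacent_intervals (b := u)
    (hw.intervalIntegrable_quadInt ω k t _ _) (hw.intervalIntegrable_quadInt ω k t _ _),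
    ← intervalIntegral.integral_const_mul]
  congr 1
  refine intervalIntegral.integral_congr fun s _ => ?_
  rw [← mul_assoc, ← Complex.ofReal_mul, ← Real.exp_add]
  ring_nf

lemma continuous_quadJ (ω : Ω) (k : ℤ) : Continuous fun t => quadJ q w F a t ω k := by
  have e : (fun t => quadJ q w F a t ω k) = fun t : ℝ => Complex.I * k *
      ((Real.exp (-(k : ℝ) ^ 2 * t) : ℂ) *
        ∫ s in (0 : ℝ)..t, (Real.exp ((k : ℝ) ^ 2 * s) : ℂ) * quadMode q w F a s ω k) := by
    ext t
    rw [quadJ_eq]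
    congr 1
    rw [quadInt, ← intervalIntegral.integral_const_mul]
    refine intervalIntegral.integral_congr fun s _ => ?_
    rw [← mul_assoc, ← Complex.ofReal_mul, ← Real.exp_add]
    ring_nf
  rw [e]
  have h : Continuous fun s : ℝ => Real.exp (-(k : ℝ) ^ 2 * s) := by fun_prop
  have h' : Continuous fun s : ℝ => Real.exp ((k : ℝ) ^ 2 * s) := by fun_prop
  have h2 : Continuous fun s : ℝ => (Real.exp ((k : ℝ) ^ 2 * s) : ℂ) * quadMode q w F a s ω k :=
    (Complex.continuous_ofReal.comp h').mul (hw.continuous_quadMode ω k)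
  exact continuous_const.mul ((Complex.continuous_ofReal.comp h).mul
    (intervalIntegral.continuous_primitive (fun _ _ => h2.intervalIntegrable _ _) 0))

lemma quadJ_sub (ω : Ω) (k : ℤ) (b : ℤ → ℤ → ℝ) (t : ℝ) :
    quadJ q w F (fun l m => a l m - b l m) t ω k = quadJ q w F a t ω k - quadJ q w F b t ω k := by
  rw [quadJ_eq, quadJ_eq, quadJ_eq, ← mul_sub]
  unfold quadInt
  rw [← intervalIntegral.integral_sub (hw.intervalIntegrable_quadInt ω k t _ _)
    (hw.intervalIntegrable_quadInt ω k t _ _)]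
  congr 1
  refine intervalIntegral.integral_congr fun s _ => ?_
  rw [← mul_sub]
  congr 1
  unfold quadMode
  rw [← Finset.sum_sub_distrib]
  refine Finset.sum_congr rfl fun l _ => ?_
  push_cast; ring

lemma measurable_quadJ {t : ℝ} (ht : 0 ≤ t) (k : ℤ) :
    Measurable fun ω => quadJ q w F a t ω k := by
  simp only [quadJ_eq]
  exact (hw.measurable_quadInt ht k).const_mul _

lemma inSub_quadJ (ha : IsSymbol F a) (k : ℤ) {t : ℝ} (ht : 0 ≤ t) :
    InSub (chaos H) (fun ω => quadJ q w F a t ω k) := by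
  rcases eq_or_ne k 0 with rfl | hk
  · simp only [quadJ_freq_zero]
    exact InSub.zero
  · simp only [quadJ_eq]
    exact (hw.inSub_quadInt ha hk le_rfl ht).const_mul _

lemma integral_quadJ_mul_conj_of_ne (ha : IsSymbol F a) {k k' : ℤ} (hkk : k ≠ k') {t u : ℝ}
    (ht : 0 ≤ t) (hu : 0 ≤ u) :
    ∫ ω, quadJ q w F a t ω k * conj (quadJ q w F a u ω k') ∂P = 0 := by
  rcases eq_or_ne k 0 with rfl | hk
  · simp [quadJ_freq_zero]
  rcases eq_or_ne k' 0 with rfl | hk'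
  · simp [quadJ_freq_zero]
  have e : ∀ ω, quadJ q w F a t ω k * conj (quadJ q w F a u ω k') =
      (Complex.I * k * conj (Complex.I * k')) *
      (quadInt q w F a 0 t ω k * conj (quadInt q w F a 0 u ω k')) := by
    intro ω
    rw [quadJ_eq, quadJ_eq, map_mul (starRingEnd ℂ) (Complex.I * k')]
    ring
  simp only [e]
  rw [integral_const_mul, hw.integral_quadInt_mul_conj_of_ne ha hk hk' hkk le_rfl ht le_rfl hu,
    mul_zero]

/-- The variance of the Duhamel integral: the prefactor `k²` of the squared derivative is compensated
by the time integral of `e^{-k²(t-s)}`. -/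
lemma integral_norm_sq_quadJ_le (ha : IsSymbol F a) {k : ℤ} (hk : k ≠ 0) {t : ℝ} (ht : 0 ≤ t) :
    ∫ ω, ‖quadJ q w F a t ω k‖ ^ 2 ∂P ≤ quadEnergy q F a k := by
  have hk2 : (0 : ℝ) < (k : ℝ) ^ 2 := by positivity
  have e : ∀ ω, ‖quadJ q w F a t ω k‖ ^ 2 = (k : ℝ) ^ 2 * ‖quadInt q w F a 0 t ω k‖ ^ 2 := by
    intro ω
    rw [quadJ_eq, norm_mul, norm_mul, Complex.norm_I, one_mul, mul_pow, Complex.norm_intCast,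
      sq_abs]
  simp only [e]
  rw [integral_const_mul]
  have h := hw.integral_norm_sq_quadInt_le (q := q) ha hk le_rfl ht
  rw [integral_exp_neg_mul hk2] at h
  have h1 := Real.exp_pos (-(k : ℝ) ^ 2 * (t - 0))
  calc _ ≤ (k : ℝ) ^ 2 * ((1 / (k : ℝ) ^ 2) * quadEnergy q F a k) := by
        refine mul_le_mul_of_nonneg_left (h.trans ?_) hk2.le
        refine mul_le_mul_of_nonneg_right ?_ (quadEnergy_nonneg _ _ _ _)
        gcongr
        linarith
    _ = _ := by field_simp

/-- The time increments: the semigroup part and the new integral each contribute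
`min(1, k²|t-u|)` times the energy. -/
lemma integral_norm_sq_quadJ_sub_le (ha : IsSymbol F a) {k : ℤ} (hk : k ≠ 0) {u t : ℝ}
    (hu : 0 ≤ u) (ht : 0 ≤ t) {h : ℝ} (h0 : 0 ≤ h) (h1 : h ≤ 1) :
    ∫ ω, ‖quadJ q w F a t ω k - quadJ q w F a u ω k‖ ^ 2 ∂P ≤
      4 * ((k : ℝ) ^ 2 * |t - u|) ^ h * quadEnergy q F a k := by
  wlog hut : u ≤ t generalizing u t
  · have := this ht hu (not_le.1 hut).le
    simpa only [norm_sub_rev, abs_sub_comm] using this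
  have hk2 : (0 : ℝ) < (k : ℝ) ^ 2 := by positivity
  have hE := quadEnergy_nonneg q F a k
  set r : ℝ := 1 - Real.exp (-(k : ℝ) ^ 2 * (t - u)) with hr
  set x : ℝ := (k : ℝ) ^ 2 * |t - u| with hx
  have hx0 : 0 ≤ x := by positivity
  have hex : Real.exp (-(k : ℝ) ^ 2 * (t - u)) = Real.exp (-x) := by
    rw [hx, abs_of_nonneg (sub_nonneg.2 hut)]; ring_nf
  have hr0 : 0 ≤ r := by
    rw [hr, hex, sub_nonneg, Real.exp_le_one_iff]; linarith
  have hr1 : r ≤ 1 := by rw [hr]; linarith [Real.exp_pos (-(k : ℝ) ^ 2 * (t - u))]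
  -- `1 - e^{-x} ≤ x ^ h`, according to whether `x ≤ 1`
  have hrh : r ≤ x ^ h := by
    rcases le_total x 1 with hx1 | hx1
    · calc r ≤ x := by rw [hr, hex]; linarith [Real.add_one_le_exp (-x)]
        _ = x ^ (1 : ℝ) := (Real.rpow_one x).symm
        _ ≤ x ^ h := by
          rcases hx0.eq_or_lt with h00 | h00
          · rw [← h00, Real.zero_rpow one_ne_zero]; positivity
          · exact Real.rpow_le_rpow_of_exponent_ge h00 hx1 h1
    · exact hr1.trans (Real.one_le_rpow hx1 h0)
  have e : ∀ ω, quadJ q w F a t ω k - quadJ q w F a u ω k =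
      (-r : ℂ) * quadJ q w F a u ω k + Complex.I * k * quadInt q w F a u t ω k := by
    intro ω
    rw [quadJ_eq, quadJ_eq, hw.quadInt_add ω k u t, hr]
    push_cast; ring
  have hb : ∀ ω, ‖quadJ q w F a t ω k - quadJ q w F a u ω k‖ ^ 2 ≤
      2 * (r ^ 2 * ‖quadJ q w F a u ω k‖ ^ 2) + 2 * ((k : ℝ) ^ 2 * ‖quadInt q w F a u t ω k‖ ^ 2) := by
    intro ω
    rw [e]
    have h1 : ‖(-r : ℂ) * quadJ q w F a u ω k‖ = r * ‖quadJ q w F a u ω k‖ := by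
      rw [norm_mul, norm_neg, Complex.norm_real, Real.norm_eq_abs, abs_of_nonneg hr0]
    have h2 : ‖Complex.I * k * quadInt q w F a u t ω k‖ = |(k : ℝ)| * ‖quadInt q w F a u t ω k‖ := by
      rw [norm_mul, norm_mul, Complex.norm_I, one_mul, Complex.norm_intCast]
    calc _ ≤ (r * ‖quadJ q w F a u ω k‖ + |(k : ℝ)| * ‖quadInt q w F a u t ω k‖) ^ 2 := by
          rw [← h1, ← h2]; gcongr; exact norm_add_le _ _
      _ ≤ 2 * ((r * ‖quadJ q w F a u ω k‖) ^ 2 + (|(k : ℝ)| * ‖quadInt q w F a u t ω k‖) ^ 2) :=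
          add_sq_le
      _ = _ := by rw [mul_pow, mul_pow, sq_abs]; ring
  have hI1 : Integrable (fun ω => 2 * (r ^ 2 * ‖quadJ q w F a u ω k‖ ^ 2)) P :=
    (((hw.inSub_quadJ ha k hu).memLp.norm.integrable_sq).const_mul _).const_mul _
  have hI2 : Integrable (fun ω => 2 * ((k : ℝ) ^ 2 * ‖quadInt q w F a u t ω k‖ ^ 2)) P :=
    (((hw.inSub_quadInt ha hk hu hut).memLp.norm.integrable_sq).const_mul _).const_mul _
  have hq1 := hw.integral_norm_sq_quadJ_le (q := q) ha hk hu
  have hq2 := hw.integral_norm_sq_quadInt_le (q := q) ha hk hu hut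
  rw [integral_exp_neg_mul hk2, ← hr] at hq2
  calc _ ≤ ∫ ω, (2 * (r ^ 2 * ‖quadJ q w F a u ω k‖ ^ 2) +
        2 * ((k : ℝ) ^ 2 * ‖quadInt q w F a u t ω k‖ ^ 2)) ∂P := by
        refine integral_mono_of_nonneg (ae_of_all _ fun ω => sq_nonneg _) (hI1.add hI2)
          (ae_of_all _ hb)
    _ = 2 * (r ^ 2 * ∫ ω, ‖quadJ q w F a u ω k‖ ^ 2 ∂P) +
        2 * ((k : ℝ) ^ 2 * ∫ ω, ‖quadInt q w F a u t ω k‖ ^ 2 ∂P) := by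
        rw [integral_add hI1 hI2, integral_const_mul, integral_const_mul, integral_const_mul,
          integral_const_mul]
    _ ≤ 2 * (r * quadEnergy q F a k) + 2 * ((k : ℝ) ^ 2 * (r / (k : ℝ) ^ 2 * quadEnergy q F a k)) := by
        have : r ^ 2 ≤ r := by nlinarith
        gcongr
    _ = 4 * r * quadEnergy q F a k := by field_simp; ring
    _ ≤ _ := by gcongr

end IsOUFamily

end Duhamel

/-! ### Summation of the energies -/

lemma rpow_sub_one_le_sub {s : ℝ} (hs : 0 < s) (hs1 : s ≤ 1) (j : ℕ) :
    ((j + 1 : ℕ) : ℝ) ^ (s - 1) ≤ (((j + 1 : ℕ) : ℝ) ^ s - (j : ℝ) ^ s) / s := by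
  have hj : (0 : ℝ) < ((j + 1 : ℕ) : ℝ) := by positivity
  rw [le_div_iff₀ hs]
  -- Bernoulli's inequality for `(1 - 1 / (j + 1)) ^ s`
  have h := rpow_one_add_le_one_add_mul_self (s := -1 / ((j + 1 : ℕ) : ℝ)) (p := s) (by
    rw [le_div_iff₀ hj]; push_cast; nlinarith [Nat.cast_nonneg (α := ℝ) j]) hs.le hs1
  have e : (j : ℝ) = ((j + 1 : ℕ) : ℝ) * (1 + -1 / ((j + 1 : ℕ) : ℝ)) := by
    field_simp; push_cast; ring
  have e2 : (j : ℝ) ^ s = ((j + 1 : ℕ) : ℝ) ^ s * (1 + -1 / ((j + 1 : ℕ) : ℝ)) ^ s := by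
    conv_lhs => rw [e]
    refine Real.mul_rpow hj.le ?_
    have : 1 + -1 / ((j + 1 : ℕ) : ℝ) = j / ((j + 1 : ℕ) : ℝ) := by field_simp; push_cast; ring
    rw [this]; positivity
  rw [e2, Real.rpow_sub_one hj.ne']
  have := mul_le_mul_of_nonneg_left h (Real.rpow_nonneg hj.le s)
  calc _ = ((j + 1 : ℕ) : ℝ) ^ s - ((j + 1 : ℕ) : ℝ) ^ s * (1 + s * (-1 / ((j + 1 : ℕ) : ℝ))) := by
        ring
    _ ≤ _ := by linarith

lemma sum_rpow_sub_one_le {s : ℝ} (hs : 0 < s) (hs1 : s ≤ 1) (n : ℕ) :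
    ∑ j ∈ Finset.range n, ((j + 1 : ℕ) : ℝ) ^ (s - 1) ≤ (n : ℝ) ^ s / s := by
  refine (Finset.sum_le_sum fun j _ => rpow_sub_one_le_sub hs hs1 j).trans ?_
  rw [← Finset.sum_div, Finset.sum_range_sub (fun j : ℕ => (j : ℝ) ^ s)]
  simp [Real.zero_rpow hs.ne']

lemma sum_inv_sq_le {n : ℕ} (hn : n ≠ 0) (N : ℕ) :
    ∑ j ∈ Finset.range N, ((((n + j + 1 : ℕ) : ℝ)) ^ 2)⁻¹ ≤ 1 / n := by
  have hn' : (0 : ℝ) < n := by positivity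
  have h : ∀ j ∈ Finset.range N, ((((n + j + 1 : ℕ) : ℝ)) ^ 2)⁻¹ ≤
      1 / ((n + j : ℕ) : ℝ) - 1 / ((n + (j + 1) : ℕ) : ℝ) := by
    intro j _
    have hx : (0 : ℝ) < ((n + j : ℕ) : ℝ) := by positivity
    have e : ((n + j + 1 : ℕ) : ℝ) = ((n + j : ℕ) : ℝ) + 1 := by push_cast; ring
    rw [← add_assoc, e]
    set x := ((n + j : ℕ) : ℝ)
    have : 1 / x - 1 / (x + 1) = (x * (x + 1))⁻¹ := by field_simp; ring
    rw [this]
    gcongr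
    nlinarith
  refine (Finset.sum_le_sum h).trans ?_
  rw [Finset.sum_range_sub' (fun j : ℕ => 1 / ((n + j : ℕ) : ℝ))]
  simp only [add_zero]
  have : (0 : ℝ) ≤ 1 / ((n + N : ℕ) : ℝ) := by positivity
  linarith

/-- The majorant of the summand of `quadEnergy` at distance `j` from the smaller frequency. -/
noncomputable def energyKernel (γ κ : ℝ) (n j : ℕ) : ℝ :=
  (j : ℝ) ^ (2 * γ - 2) * (max (j : ℝ) (n / 2)) ^ (2 * γ - 4 + κ)

lemma energyKernel_nonneg (γ κ : ℝ) (n j : ℕ) : 0 ≤ energyKernel γ κ n j := by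
  unfold energyKernel; positivity

lemma energyKernel_zero {γ : ℝ} (hγ' : γ < 1) (κ : ℝ) (n : ℕ) : energyKernel γ κ n 0 = 0 := by
  rw [energyKernel, Nat.cast_zero, Real.zero_rpow (by linarith), zero_mul]

/-- Up to `n` the first factor is summed as a power, the second being at most its value at `n / 2`;
beyond `n` the summand is controlled by a multiple of `j⁻²`. -/
lemma sum_energyKernel_range_le {γ κ θ : ℝ} (hγ : 1 / 2 ≤ γ) (hθ : 0 ≤ θ)
    (hθ1 : 0 < 2 * γ - 1 + θ) (hθ2 : θ ≤ 2 - 2 * γ) (hκ1 : 4 * γ - 4 + κ ≤ 0)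
    {n : ℕ} (hn : n ≠ 0) (N : ℕ) :
    ∑ j ∈ Finset.range N, energyKernel γ κ n (j + 1) ≤
      ((1 / 2 : ℝ) ^ (2 * γ - 4 + κ) / (2 * γ - 1 + θ) + 1) * (n : ℝ) ^ (4 * γ - 5 + κ + θ) := by
  have hn' : (0 : ℝ) < n := by positivity
  have hn1 : (1 : ℝ) ≤ n := by exact_mod_cast Nat.one_le_iff_ne_zero.2 hn
  have hmono : ∑ j ∈ Finset.range N, energyKernel γ κ n (j + 1) ≤
      ∑ j ∈ Finset.range (n + N), energyKernel γ κ n (j + 1) :=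
    Finset.sum_le_sum_of_subset_of_nonneg (Finset.range_mono (by omega))
      fun j _ _ => energyKernel_nonneg _ _ _ _
  refine hmono.trans ?_
  rw [Finset.sum_range_add, add_mul, one_mul]
  refine add_le_add ?_ ?_
  · have h : ∀ j ∈ Finset.range n, energyKernel γ κ n (j + 1) ≤
        ((j + 1 : ℕ) : ℝ) ^ (2 * γ - 1 + θ - 1) * ((n : ℝ) / 2) ^ (2 * γ - 4 + κ) := by
      intro j _
      unfold energyKernel
      have hj : (1 : ℝ) ≤ ((j + 1 : ℕ) : ℝ) := by push_cast; linarith [Nat.cast_nonneg (α := ℝ) j]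
      refine mul_le_mul (Real.rpow_le_rpow_of_exponent_le hj (by linarith))
        (Real.rpow_le_rpow_of_nonpos (by positivity) (le_max_right _ _) (by linarith))
        (by positivity) (by positivity)
    refine (Finset.sum_le_sum h).trans ?_
    rw [← Finset.sum_mul]
    refine (mul_le_mul_of_nonneg_right (sum_rpow_sub_one_le hθ1 (by linarith) n)
      (by positivity)).trans_eq ?_
    rw [div_eq_mul_one_div (n : ℝ) 2, Real.mul_rpow hn'.le (by norm_num),
      show 4 * γ - 5 + κ + θ = (2 * γ - 1 + θ) + (2 * γ - 4 + κ) by ring,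
      Real.rpow_add hn' (2 * γ - 1 + θ)]
    ring
  · have h : ∀ j ∈ Finset.range N, energyKernel γ κ n (n + j + 1) ≤
        (n : ℝ) ^ (4 * γ - 4 + κ) * ((((n + j + 1 : ℕ) : ℝ)) ^ 2)⁻¹ := by
      intro j _
      unfold energyKernel
      have hx : (0 : ℝ) < ((n + j + 1 : ℕ) : ℝ) := by positivity
      have hxn : (n : ℝ) ≤ ((n + j + 1 : ℕ) : ℝ) := by exact_mod_cast (by omega)
      rw [max_eq_left (by linarith), ← Real.rpow_add hx,
        show 2 * γ - 2 + (2 * γ - 4 + κ) = (4 * γ - 4 + κ) - (2 : ℕ) by push_cast; ring,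
        Real.rpow_sub_natCast hx.ne', div_eq_mul_inv]
      gcongr ?_ * _
      exact Real.rpow_le_rpow_of_nonpos hn' hxn hκ1
    refine (Finset.sum_le_sum h).trans ?_
    rw [← Finset.mul_sum]
    refine (mul_le_mul_of_nonneg_left (sum_inv_sq_le hn N) (by positivity)).trans ?_
    rw [mul_one_div, ← Real.rpow_sub_one hn'.ne']
    exact Real.rpow_le_rpow_of_exponent_le hn1 (by linarith)

/-- The constant in the summation bounds. -/
noncomputable def kernelConst (γ κ θ : ℝ) : ℝ :=
  (1 / 2 : ℝ) ^ (2 * γ - 4 + κ) / (2 * γ - 1 + θ) + 1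

lemma sum_natAbs_le {G : ℕ → ℝ} (hG : ∀ j, 0 ≤ G j) (hG0 : G 0 = 0) {M : ℝ}
    (hM : ∀ N, ∑ j ∈ Finset.range N, G (j + 1) ≤ M) (F : Finset ℤ) :
    ∑ l ∈ F, G l.natAbs ≤ 2 * M := by
  have hS : ∀ S : Finset ℕ, ∑ j ∈ S, G j ≤ M := by
    intro S
    obtain ⟨N, hN⟩ : ∃ N, S ⊆ Finset.range (N + 1) :=
      ⟨S.sup id, fun j hj => Finset.mem_range_succ_iff.2 (Finset.le_sup (f := id) hj)⟩
    refine (Finset.sum_le_sum_of_subset_of_nonneg hN fun j _ _ => hG j).trans ?_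
    rw [Finset.sum_range_succ', hG0, add_zero]
    exact hM N
  have hinj : ∀ F' : Finset ℤ, Set.InjOn Int.natAbs (F' : Set ℤ) →
      ∑ l ∈ F', G l.natAbs ≤ M := by
    intro F' h
    rw [← Finset.sum_image (f := G) h]
    exact hS _
  rw [← Finset.sum_filter_add_sum_filter_not F (fun l => 0 ≤ l)]
  have h1 := hinj (F.filter fun l => 0 ≤ l) (by
    intro x hx y hy hxy
    simp only [Finset.coe_filter, mem_ofPred_eq] at hx hy
    omega)
  have h2 := hinj (F.filter fun l => ¬ 0 ≤ l) (by
    intro x hx y hy hxy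
    simp only [Finset.coe_filter, mem_ofPred_eq] at hx hy
    omega)
  linarith

lemma modeVar_le {q : ℤ → ℂ} {γ c₂ : ℝ}
    (hq : ∀ k : ℤ, ‖q k‖ ≤ c₂ * |(k : ℝ)| ^ γ) (l : ℤ) :
    modeVar q l ≤ c₂ ^ 2 / 2 * |(l : ℝ)| ^ (2 * γ - 2) := by
  unfold modeVar
  rcases eq_or_ne l 0 with rfl | hl
  · simp only [Int.cast_zero, ne_eq, OfNat.ofNat_ne_zero, not_false_eq_true, zero_pow, mul_zero,
      div_zero]
    positivity
  · have hl' : 0 < |(l : ℝ)| := by positivity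
    rw [show 2 * γ - 2 = γ * (2 : ℕ) - (2 : ℕ) by push_cast; ring, Real.rpow_sub_natCast hl'.ne',
      Real.rpow_mul_natCast hl'.le, sq_abs]
    have : ‖q l‖ ^ 2 ≤ (c₂ * |(l : ℝ)| ^ γ) ^ 2 := by gcongr; exact hq l
    calc _ ≤ (c₂ * |(l : ℝ)| ^ γ) ^ 2 / (2 * (l : ℝ) ^ 2) := by gcongr
      _ = _ := by rw [mul_pow]; field_simp

/-- The pointwise bound: the larger of the two frequencies is at least `|k| / 2`. -/
lemma energy_summand_le {γ κ : ℝ} (hγ : 1 / 2 ≤ γ) (hγ' : γ < 1) (hκ1 : 4 * γ - 4 + κ ≤ 0)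
    (l m : ℤ) (hlm : l + m ≠ 0) :
    |(l : ℝ)| ^ (2 * γ - 2) * |(m : ℝ)| ^ (2 * γ - 2) *
      (max |(l : ℝ)| |(m : ℝ)|) ^ κ * (2 / ((l : ℝ) ^ 2 + (m : ℝ) ^ 2)) ≤
      2 * (energyKernel γ κ (l + m).natAbs l.natAbs + energyKernel γ κ (l + m).natAbs m.natAbs) := by
  wlog h : |(l : ℝ)| ≤ |(m : ℝ)| generalizing l m
  · have := this m l (by rwa [add_comm]) (not_le.1 h).le
    rw [add_comm m l, max_comm, add_comm ((m : ℝ) ^ 2)] at this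
    linarith
  have hm : 0 < |(m : ℝ)| := by
    rw [abs_pos]
    rintro h0
    rw [h0, abs_zero, abs_nonpos_iff] at h
    exact hlm (by exact_mod_cast (by rw [h, h0, add_zero] : (l : ℝ) + m = 0))
  have hk : (((l + m).natAbs : ℕ) : ℝ) = |(l : ℝ) + m| := by
    rw [Nat.cast_natAbs, Int.cast_abs]; push_cast; rfl
  have hl : ((l.natAbs : ℕ) : ℝ) = |(l : ℝ)| := by rw [Nat.cast_natAbs, Int.cast_abs]
  have h2 := energyKernel_nonneg γ κ (l + m).natAbs m.natAbs
  suffices |(l : ℝ)| ^ (2 * γ - 2) * |(m : ℝ)| ^ (2 * γ - 2) *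
      (max |(l : ℝ)| |(m : ℝ)|) ^ κ * (2 / ((l : ℝ) ^ 2 + (m : ℝ) ^ 2)) ≤
      2 * energyKernel γ κ (l + m).natAbs l.natAbs by linarith
  have hk0 : 0 < |(l : ℝ) + m| := by
    rw [abs_pos]; exact_mod_cast hlm
  rw [max_eq_right h, energyKernel, hk, hl]
  calc _ ≤ |(l : ℝ)| ^ (2 * γ - 2) * |(m : ℝ)| ^ (2 * γ - 2) * |(m : ℝ)| ^ κ *
        (2 / |(m : ℝ)| ^ 2) := by
        refine mul_le_mul_of_nonneg_left ?_ (by positivity)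
        refine div_le_div_of_nonneg_left (by norm_num) (by positivity) ?_
        rw [sq_abs]; linarith [sq_nonneg (l : ℝ)]
    _ = 2 * (|(l : ℝ)| ^ (2 * γ - 2) * |(m : ℝ)| ^ (2 * γ - 4 + κ)) := by
        rw [show 2 * γ - 4 + κ = (2 * γ - 2) + κ - (2 : ℕ) by push_cast; ring,
          Real.rpow_sub_natCast hm.ne', Real.rpow_add hm]
        ring
    _ ≤ _ := by
        refine mul_le_mul_of_nonneg_left (mul_le_mul_of_nonneg_left ?_ (by positivity)) zero_le_two
        refine Real.rpow_le_rpow_of_nonpos (by positivity) (max_le h ?_) (by linarith)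
        have := abs_add_le (l : ℝ) m
        linarith

/-- If `a(l, m)² ≤ K max(|l|, |m|)^κ`, the energy at frequency `k` is of order
`K |k|^{4γ - 5 + κ + θ}`; the loss `θ > 0` is needed only for `γ = 1/2`. -/
lemma quadEnergy_le {q : ℤ → ℂ} {γ c₂ κ θ : ℝ} (hγ : 1 / 2 ≤ γ) (hγ' : γ < 1)
    (hq : ∀ k : ℤ, ‖q k‖ ≤ c₂ * |(k : ℝ)| ^ γ) (hθ : 0 ≤ θ)
    (hθ1 : 0 < 2 * γ - 1 + θ) (hθ2 : θ ≤ 2 - 2 * γ) (hκ1 : 4 * γ - 4 + κ ≤ 0)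
    {F : Finset ℤ} {a : ℤ → ℤ → ℝ} {K : ℝ} (hK : 0 ≤ K)
    (ha : ∀ l m, l ≠ 0 → m ≠ 0 → a l m ^ 2 ≤ K * (max |(l : ℝ)| |(m : ℝ)|) ^ κ) {k : ℤ} (hk : k ≠ 0) :
    quadEnergy q F a k ≤
      4 * c₂ ^ 4 * kernelConst γ κ θ * K * |(k : ℝ)| ^ (4 * γ - 5 + κ + θ) := by
  set n := k.natAbs with hn
  have hn0 : n ≠ 0 := by omega
  have hkn : (n : ℝ) = |(k : ℝ)| := by rw [hn, Nat.cast_natAbs, Int.cast_abs]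
  have hG : ∀ F' : Finset ℤ, ∑ l ∈ F', energyKernel γ κ n l.natAbs ≤
      2 * (kernelConst γ κ θ * (n : ℝ) ^ (4 * γ - 5 + κ + θ)) := fun F' =>
    sum_natAbs_le (energyKernel_nonneg γ κ n) (energyKernel_zero hγ' κ n)
      (sum_energyKernel_range_le hγ hθ hθ1 hθ2 hκ1 hn0) F'
  have hterm : ∀ l ∈ F, 2 * (a l (k - l) ^ 2 * (modeVar q l * modeVar q (k - l))) *
      (2 / ((l : ℝ) ^ 2 + ((k - l : ℤ) : ℝ) ^ 2)) ≤
      c₂ ^ 4 * K * (energyKernel γ κ n l.natAbs + energyKernel γ κ n (k - l).natAbs) := by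
    intro l _
    have hpos : 0 ≤ c₂ ^ 4 * K *
        (energyKernel γ κ n l.natAbs + energyKernel γ κ n (k - l).natAbs) := by
      have := energyKernel_nonneg γ κ n l.natAbs
      have := energyKernel_nonneg γ κ n (k - l).natAbs
      positivity
    -- the zero modes do not contribute
    rcases eq_or_ne l 0 with rfl | hl0
    · simpa [modeVar] using hpos
    rcases eq_or_ne (k - l) 0 with hm0 | hm0
    · rw [hm0] at hpos ⊢
      simpa [modeVar] using hpos
    have h := energy_summand_le hγ hγ' hκ1 l (k - l) (by rwa [add_sub_cancel])
    rw [add_sub_cancel, ← hn] at h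
    have h1 := modeVar_le hq l
    have h2 := modeVar_le hq (k - l)
    have h3 := modeVar_nonneg q (k - l)
    have h4 := modeVar_nonneg q l
    calc _ ≤ 2 * ((K * (max |(l : ℝ)| |((k - l : ℤ) : ℝ)|) ^ κ) *
          ((c₂ ^ 2 / 2 * |(l : ℝ)| ^ (2 * γ - 2)) *
            (c₂ ^ 2 / 2 * |((k - l : ℤ) : ℝ)| ^ (2 * γ - 2)))) *
          (2 / ((l : ℝ) ^ 2 + ((k - l : ℤ) : ℝ) ^ 2)) := by
          have h5 := mul_le_mul (ha l (k - l) hl0 hm0) (mul_le_mul h1 h2 h3 (by positivity))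
            (by positivity) (by positivity)
          gcongr
      _ = c₂ ^ 4 * K / 2 * (|(l : ℝ)| ^ (2 * γ - 2) * |((k - l : ℤ) : ℝ)| ^ (2 * γ - 2) *
          (max |(l : ℝ)| |((k - l : ℤ) : ℝ)|) ^ κ *
          (2 / ((l : ℝ) ^ 2 + ((k - l : ℤ) : ℝ) ^ 2))) := by ring
      _ ≤ c₂ ^ 4 * K / 2 * _ := mul_le_mul_of_nonneg_left h (by positivity)
      _ = _ := by ring
  refine (Finset.sum_le_sum hterm).trans ?_
  rw [← Finset.mul_sum, Finset.sum_add_distrib]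
  have e : ∑ l ∈ F, energyKernel γ κ n (k - l).natAbs =
      ∑ l ∈ F.image (fun l => k - l), energyKernel γ κ n l.natAbs := by
    rw [Finset.sum_image fun x _ y _ h => by simpa using h]
  rw [e]
  have := add_le_add (hG F) (hG (F.image fun l => k - l))
  have h5 : 0 ≤ c₂ ^ 4 * K := by positivity
  calc _ ≤ c₂ ^ 4 * K * _ := mul_le_mul_of_nonneg_left this h5
    _ = _ := by rw [hkn]; ring

lemma kernelConst_pos {γ κ θ : ℝ} (hθ1 : 0 < 2 * γ - 1 + θ) : 0 < kernelConst γ κ θ := by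
  unfold kernelConst; positivity

/-! ### Chaining on dyadic grids -/

/-- The sum of the `n`-th powers of the increments of `f` between the points of the dyadic grid of
mesh `2^{-(m+1)}` in `[0, 1)²` and their parents in the grid of mesh `2^{-m}`. -/
noncomputable def gridSum (f : ℝ → ℝ → ℂ) (n m : ℕ) : ℝ≥0∞ :=
  ∑ i ∈ Finset.range (2 ^ (m + 1)), ∑ j ∈ Finset.range (2 ^ (m + 1)),
    ‖f ((i : ℝ) / 2 ^ (m + 1)) ((j : ℝ) / 2 ^ (m + 1)) -
      f (((i / 2 : ℕ) : ℝ) / 2 ^ m) (((j / 2 : ℕ) : ℝ) / 2 ^ m)‖ₑ ^ n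

/-- The weighted sum of all increments along the dyadic grids. The weight `(4/3)^m` makes the
increments at level `m` decay geometrically, and is still compensated by their moments. -/
noncomputable def chainSum (f : ℝ → ℝ → ℂ) (n : ℕ) : ℝ≥0∞ :=
  ∑' m : ℕ, (4 / 3 : ℝ≥0∞) ^ m * gridSum f n m

/-- The constant in the chaining bound. -/
noncomputable def chainConst (n : ℕ) : ℝ≥0∞ := (1 - (3 / 4 : ℝ≥0∞) ^ (1 / (n : ℝ)))⁻¹

lemma three_div_four_lt_one : (3 / 4 : ℝ≥0∞) < 1 := by
  rw [ENNReal.div_lt_iff (by simp) (by simp)]; norm_num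

lemma three_div_four_mul : (3 / 4 : ℝ≥0∞) * (4 / 3) = 1 := by
  rw [← ENNReal.mul_div_mul_comm (by simp) (by simp), mul_comm]
  exact ENNReal.div_self (by simp) (by finiteness)

lemma chainConst_ne_top {n : ℕ} (hn : n ≠ 0) : chainConst n ≠ ∞ := by
  unfold chainConst
  rw [ENNReal.inv_ne_top]
  have h : (3 / 4 : ℝ≥0∞) ^ (1 / (n : ℝ)) < 1 :=
    ENNReal.rpow_lt_one three_div_four_lt_one (by positivity)
  exact (tsub_pos_of_lt h).ne'

/-- Telescoping along the parents of a grid point, with Hölder's inequality against the weights. -/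
lemma enorm_grid_le {f : ℝ → ℝ → ℂ} (h0 : f 0 0 = 0) {n : ℕ} (hn : n ≠ 0) (m : ℕ) :
    ∀ i : ℕ, i < 2 ^ m → ∀ j : ℕ, j < 2 ^ m → ‖f ((i : ℝ) / 2 ^ m) ((j : ℝ) / 2 ^ m)‖ₑ ≤
      ∑ k ∈ Finset.range m, ((3 / 4 : ℝ≥0∞) ^ (1 / (n : ℝ))) ^ k * chainSum f n ^ (1 / (n : ℝ)) := by
  have hn' : (0 : ℝ) < n := by positivity
  induction m with
  | zero =>
    intro i hi j hj
    simp only [pow_zero, Nat.lt_one_iff] at hi hj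
    simp [hi, hj, h0]
  | succ m ih =>
    intro i hi j hj
    rw [Finset.sum_range_succ]
    have hp := ih (i / 2) (by rw [pow_succ] at hi; omega) (j / 2) (by rw [pow_succ] at hj; omega)
    have hinc : ‖f ((i : ℝ) / 2 ^ (m + 1)) ((j : ℝ) / 2 ^ (m + 1)) -
        f (((i / 2 : ℕ) : ℝ) / 2 ^ m) (((j / 2 : ℕ) : ℝ) / 2 ^ m)‖ₑ ^ n ≤
        (3 / 4 : ℝ≥0∞) ^ m * chainSum f n := by
      have h1 : (4 / 3 : ℝ≥0∞) ^ m * gridSum f n m ≤ chainSum f n := ENNReal.le_tsum m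
      calc _ ≤ gridSum f n m := by
            unfold gridSum
            refine le_trans ?_ (Finset.single_le_sum (fun _ _ => zero_le)
              (Finset.mem_range.2 hi))
            exact Finset.single_le_sum (f := fun j : ℕ =>
              ‖f ((i : ℝ) / 2 ^ (m + 1)) ((j : ℝ) / 2 ^ (m + 1)) -
                f (((i / 2 : ℕ) : ℝ) / 2 ^ m) (((j / 2 : ℕ) : ℝ) / 2 ^ m)‖ₑ ^ n)
              (fun _ _ => zero_le) (Finset.mem_range.2 hj)
        _ = (3 / 4 : ℝ≥0∞) ^ m * ((4 / 3 : ℝ≥0∞) ^ m * gridSum f n m) := by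
            rw [← mul_assoc, ← mul_pow, three_div_four_mul, one_pow, one_mul]
        _ ≤ _ := by gcongr
    have hroot : ‖f ((i : ℝ) / 2 ^ (m + 1)) ((j : ℝ) / 2 ^ (m + 1)) -
        f (((i / 2 : ℕ) : ℝ) / 2 ^ m) (((j / 2 : ℕ) : ℝ) / 2 ^ m)‖ₑ ≤
        ((3 / 4 : ℝ≥0∞) ^ (1 / (n : ℝ))) ^ m * chainSum f n ^ (1 / (n : ℝ)) := by
      have := ENNReal.rpow_le_rpow hinc (z := 1 / (n : ℝ)) (by positivity)
      rw [← ENNReal.rpow_natCast, ← ENNReal.rpow_mul, mul_one_div_cancel hn'.ne',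
        ENNReal.rpow_one, ENNReal.mul_rpow_of_nonneg _ _ (by positivity)] at this
      refine this.trans_eq ?_
      congr 1
      rw [← ENNReal.rpow_natCast, ← ENNReal.rpow_natCast, ← ENNReal.rpow_mul, ← ENNReal.rpow_mul,
        mul_comm]
    calc _ = ‖f (((i / 2 : ℕ) : ℝ) / 2 ^ m) (((j / 2 : ℕ) : ℝ) / 2 ^ m) +
          (f ((i : ℝ) / 2 ^ (m + 1)) ((j : ℝ) / 2 ^ (m + 1)) -
            f (((i / 2 : ℕ) : ℝ) / 2 ^ m) (((j / 2 : ℕ) : ℝ) / 2 ^ m))‖ₑ := by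
          rw [add_sub_cancel]
      _ ≤ _ := enorm_add_le _ _
      _ ≤ _ := add_le_add hp hroot

lemma tendsto_floor_div_two_pow {x : ℝ} (hx : 0 ≤ x) :
    Tendsto (fun m : ℕ => (⌊x * 2 ^ m⌋₊ : ℝ) / 2 ^ m) atTop (𝓝 x) :=
  (tendsto_nat_floor_mul_div_atTop hx).comp (tendsto_pow_atTop_atTop_of_one_lt one_lt_two)

/-- The chaining bound: a continuous function vanishing at the origin is controlled on `[0, 1)²` by
its increments along the dyadic grids. -/
lemma enorm_pow_le_chainSum {f : ℝ → ℝ → ℂ} (hf : Continuous (Function.uncurry f))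
    (h0 : f 0 0 = 0) {n : ℕ} (hn : n ≠ 0) {s x : ℝ} (hs : s ∈ Ico (0 : ℝ) 1)
    (hx : x ∈ Ico (0 : ℝ) 1) :
    ‖f s x‖ₑ ^ n ≤ chainConst n ^ n * chainSum f n := by
  have hn' : (0 : ℝ) < n := by positivity
  have hlim : Tendsto (fun m : ℕ => ‖f ((⌊s * 2 ^ m⌋₊ : ℝ) / 2 ^ m) ((⌊x * 2 ^ m⌋₊ : ℝ) / 2 ^ m)‖ₑ)
      atTop (𝓝 ‖f s x‖ₑ) := by
    have h1 := (tendsto_floor_div_two_pow hs.1).prodMk_nhds (tendsto_floor_div_two_pow hx.1)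
    exact ((continuous_enorm.comp hf).tendsto (s, x)).comp h1
  have hfl : ∀ {y : ℝ}, y ∈ Ico (0 : ℝ) 1 → ∀ m : ℕ, ⌊y * 2 ^ m⌋₊ < 2 ^ m := by
    intro y hy m
    have h2 : (0 : ℝ) < 2 ^ m := by positivity
    rw [Nat.floor_lt (by have := hy.1; positivity)]
    push_cast
    nlinarith [hy.2]
  have hb : ‖f s x‖ₑ ≤ chainConst n * chainSum f n ^ (1 / (n : ℝ)) := by
    refine le_of_tendsto hlim (Eventually.of_forall fun m => ?_)
    refine (enorm_grid_le h0 hn m _ (hfl hs m) _ (hfl hx m)).trans ?_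
    rw [← Finset.sum_mul]
    gcongr
    rw [chainConst, ← ENNReal.tsum_geometric]
    exact ENNReal.sum_le_tsum _
  calc _ ≤ (chainConst n * chainSum f n ^ (1 / (n : ℝ))) ^ n := by gcongr
    _ = _ := by
      rw [mul_pow, ← ENNReal.rpow_natCast (chainSum f n ^ _), ← ENNReal.rpow_mul,
        one_div_mul_cancel hn'.ne', ENNReal.rpow_one]

section

variable {Ω : Type*} {mΩ : MeasurableSpace Ω} {P : Measure Ω}

lemma measurable_chainSum {f : Ω → ℝ → ℝ → ℂ} (n : ℕ)
    (hm : ∀ s x, 0 ≤ s → Measurable fun ω => f ω s x) : Measurable fun ω => chainSum (f ω) n := by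
  unfold chainSum gridSum
  refine Measurable.tsum fun m => Measurable.const_mul ?_ _
  refine Finset.measurable_fun_sum _ fun i _ => Finset.measurable_fun_sum _ fun j _ => ?_
  exact (((hm _ _ (by positivity)).sub (hm _ _ (by positivity))).enorm).pow_const n

lemma abs_grid_sub_le (i m : ℕ) :
    |(i : ℝ) / 2 ^ (m + 1) - ((i / 2 : ℕ) : ℝ) / 2 ^ m| ≤ 1 / 2 ^ (m + 1) := by
  have e : (i : ℝ) = 2 * ((i / 2 : ℕ) : ℝ) + ((i % 2 : ℕ) : ℝ) := by
    exact_mod_cast (Nat.div_add_mod i 2).symm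
  have h2 : ((i % 2 : ℕ) : ℝ) ≤ 1 := by exact_mod_cast (by omega : i % 2 ≤ 1)
  have e2 : (i : ℝ) / 2 ^ (m + 1) - ((i / 2 : ℕ) : ℝ) / 2 ^ m = ((i % 2 : ℕ) : ℝ) / 2 ^ (m + 1) := by
    rw [e, pow_succ]; field_simp; ring
  rw [e2, abs_of_nonneg (by positivity)]
  gcongr

/-- If the `n`-th moments of the increments are of order `δ³`, the chaining sum is integrable:
`4^m` increments of order `8^{-m}` at level `m`. -/
lemma lintegral_chainSum_le {f : Ω → ℝ → ℝ → ℂ} {n : ℕ} {M : ℝ≥0∞}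
    (hm : ∀ s x, 0 ≤ s → Measurable fun ω => f ω s x)
    (hinc : ∀ s t x y δ : ℝ, 0 ≤ s → 0 ≤ t → |s - t| ≤ δ → |x - y| ≤ δ →
      ∫⁻ ω, ‖f ω s x - f ω t y‖ₑ ^ n ∂P ≤ M * ENNReal.ofReal δ ^ 3) :
    ∫⁻ ω, chainSum (f ω) n ∂P ≤ 2 * M := by
  have hterm : ∀ i j m : ℕ, Measurable fun ω =>
      ‖f ω ((i : ℝ) / 2 ^ (m + 1)) ((j : ℝ) / 2 ^ (m + 1)) -
      f ω (((i / 2 : ℕ) : ℝ) / 2 ^ m) (((j / 2 : ℕ) : ℝ) / 2 ^ m)‖ₑ ^ n := fun i j m =>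
    (((hm _ _ (by positivity)).sub (hm _ _ (by positivity))).enorm).pow_const n
  have hgm : ∀ m : ℕ, Measurable fun ω => gridSum (f ω) n m := fun m => by
    unfold gridSum
    exact Finset.measurable_fun_sum _ fun i _ => Finset.measurable_fun_sum _ fun j _ => hterm i j m
  have hg : ∀ m : ℕ, ∫⁻ ω, gridSum (f ω) n m ∂P ≤ M * (1 / 2) ^ (m + 1) := by
    intro m
    unfold gridSum
    rw [lintegral_finsetSum _ fun i _ => Finset.measurable_fun_sum _ fun j _ => hterm i j m]
    have h1 : ∀ i ∈ Finset.range (2 ^ (m + 1)), ∫⁻ ω, ∑ j ∈ Finset.range (2 ^ (m + 1)),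
        ‖f ω ((i : ℝ) / 2 ^ (m + 1)) ((j : ℝ) / 2 ^ (m + 1)) -
        f ω (((i / 2 : ℕ) : ℝ) / 2 ^ m) (((j / 2 : ℕ) : ℝ) / 2 ^ m)‖ₑ ^ n ∂P ≤
        2 ^ (m + 1) * (M * ENNReal.ofReal (1 / 2 ^ (m + 1)) ^ 3) := by
      intro i _
      rw [lintegral_finsetSum _ fun j _ => hterm i j m]
      refine (Finset.sum_le_card_nsmul _ _ _ fun j _ => hinc _ _ _ _ _ (by positivity)
        (by positivity) (abs_grid_sub_le i m) (abs_grid_sub_le j m)).trans_eq ?_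
      rw [Finset.card_range, nsmul_eq_mul]; push_cast; ring
    refine (Finset.sum_le_card_nsmul _ _ _ h1).trans_eq ?_
    have e : ENNReal.ofReal (1 / 2 ^ (m + 1)) = (1 / 2) ^ (m + 1) := by
      rw [← one_div_pow, ENNReal.ofReal_pow (by positivity), ENNReal.ofReal_div_of_pos two_pos]
      simp
    have e2 : (2 : ℝ≥0∞) ^ (m + 1) * (1 / 2) ^ (m + 1) = 1 := by
      rw [← mul_pow, one_div, ENNReal.mul_inv_cancel (by simp) (by simp), one_pow]
    rw [Finset.card_range, nsmul_eq_mul, e]; push_cast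
    calc _ = M * (1 / 2) ^ (m + 1) * ((2 : ℝ≥0∞) ^ (m + 1) * (1 / 2) ^ (m + 1)) *
          ((2 : ℝ≥0∞) ^ (m + 1) * (1 / 2) ^ (m + 1)) := by ring
      _ = _ := by rw [e2]; ring
  unfold chainSum
  rw [lintegral_tsum fun m => ((hgm m).const_mul _).aemeasurable]
  have e3 : (4 / 3 : ℝ≥0∞) * (1 / 2) = 2 / 3 := by
    rw [← ENNReal.mul_div_mul_comm (by simp) (by simp)]
    rw [show (4 * 1 : ℝ≥0∞) = 2 * 2 by norm_num]
    exact ENNReal.mul_div_mul_right _ _ (by simp) (by simp)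
  calc _ ≤ ∑' m : ℕ, (M / 2) * (2 / 3 : ℝ≥0∞) ^ m := by
        refine ENNReal.tsum_le_tsum fun m => ?_
        rw [lintegral_const_mul _ (hgm m)]
        calc _ ≤ (4 / 3 : ℝ≥0∞) ^ m * (M * (1 / 2) ^ (m + 1)) := by gcongr; exact hg m
          _ = (M * (1 / 2)) * ((4 / 3 : ℝ≥0∞) * (1 / 2)) ^ m := by rw [mul_pow, pow_succ]; ring
          _ = _ := by rw [e3, mul_one_div]
    _ = (M / 2) * (1 - 2 / 3)⁻¹ := by rw [ENNReal.tsum_mul_left, ENNReal.tsum_geometric]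
    _ ≤ (M / 2) * 4 := by
        gcongr
        have e4 : (1 - 2 / 3 : ℝ≥0∞) = 1 / 3 := by
          refine ENNReal.sub_eq_of_eq_add (ENNReal.div_ne_top (by simp) (by simp)) ?_
          rw [ENNReal.div_add_div_same, show (1 + 2 : ℝ≥0∞) = 3 by norm_num]
          exact (ENNReal.div_self (by simp) (by simp)).symm
        rw [e4, one_div, inv_inv]
        norm_num
    _ = 2 * M := by
        rw [div_eq_mul_inv, mul_assoc, show (2 : ℝ≥0∞)⁻¹ * 4 = 2 by
          rw [show (4 : ℝ≥0∞) = 2 * 2 by norm_num, ← mul_assoc,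
            ENNReal.inv_mul_cancel (by simp) (by simp), one_mul], mul_comm]

end

/-! ### Littlewood–Paley blocks -/

section Blocks

variable {χ φ : ℝ → ℝ}

/-- The symbols of the blocks with index `n` are supported, away from the zero frequency, in the
annulus `ρ 2^n ≤ |k| ≤ R 2^n`. -/
structure HasAnnuli (χ φ : ℝ → ℝ) (ρ R : ℝ) : Prop where
  pos : 0 < ρ
  one_le : 1 ≤ R
  le_abs : ∀ (n : ℕ) (k : ℤ), k ≠ 0 → lpSymbol χ φ n k ≠ 0 → ρ * 2 ^ n ≤ |(k : ℝ)|
  abs_le : ∀ (n : ℕ) (k : ℤ), lpSymbol χ φ n k ≠ 0 → |(k : ℝ)| ≤ R * 2 ^ n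

lemma IsDyadicPartition.exists_hasAnnuli (h : IsDyadicPartition χ φ) :
    ∃ ρ R, HasAnnuli χ φ ρ R := by
  obtain ⟨R₁, hR₁, h₁⟩ := h.supp_chi
  obtain ⟨r, hr, R₂, hR₂, h₂⟩ := h.supp_phi
  refine ⟨min 1 (r / 2), max 1 (max R₁ R₂), by positivity, le_max_left _ _, ?_, ?_⟩
  · rintro (_ | n) k hk hs
    · have : (1 : ℝ) ≤ |(k : ℝ)| := by exact_mod_cast Int.one_le_abs hk
      simpa using Or.inl this
    · have h3 := (h₂ (subset_tsupport _ hs)).1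
      rw [abs_div, abs_of_pos (by positivity : (0 : ℝ) < 2 ^ n), le_div_iff₀ (by positivity)] at h3
      calc _ ≤ r / 2 * 2 ^ (n + 1) := by gcongr; exact min_le_right _ _
        _ = r * 2 ^ n := by rw [pow_succ]; ring
        _ ≤ _ := h3
  · rintro (_ | n) k hs
    · have h3 : |(k : ℝ)| ≤ R₁ := h₁ (subset_tsupport _ hs)
      rw [pow_zero, mul_one]
      exact h3.trans ((le_max_left _ _).trans (le_max_right _ _))
    · have h3 := (h₂ (subset_tsupport _ hs)).2
      rw [abs_div, abs_of_pos (by positivity : (0 : ℝ) < 2 ^ n), div_le_iff₀ (by positivity)] at h3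
      refine h3.trans ?_
      have h4 : R₂ ≤ max 1 (max R₁ R₂) := (le_max_right _ _).trans (le_max_right _ _)
      have h5 : (0 : ℝ) ≤ max 1 (max R₁ R₂) := zero_le_one.trans (le_max_left _ _)
      gcongr
      · exact one_le_two
      · omega

lemma IsDyadicPartition.lpSymbol_mem (h : IsDyadicPartition χ φ) (n : ℕ) (ξ : ℝ) :
    lpSymbol χ φ n ξ ∈ Icc (0 : ℝ) 1 := by
  cases n with
  | zero => exact h.chi_mem ξ
  | succ n => exact h.phi_mem _

lemma IsDyadicPartition.exists_lpSymbol_ne_zero (h : IsDyadicPartition χ φ) (ξ : ℝ) :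
    ∃ n, lpSymbol χ φ n ξ ≠ 0 := by
  by_contra! hn
  have h1 := h.sum_eq_one ξ
  have h0 : χ ξ = 0 := hn 0
  have h2 : (fun j : ℕ => φ (ξ / 2 ^ j)) = fun _ => 0 := funext fun j => hn (j + 1)
  rw [h2, h0] at h1
  simpa using h1.unique hasSum_zero

/-- A finite set of frequencies that contains the support of the block with index `n`. -/
noncomputable def lpFreq (R : ℝ) (n : ℕ) : Finset ℤ := Finset.Icc (-⌊R * 2 ^ n⌋) ⌊R * 2 ^ n⌋

lemma card_lpFreq_le {R : ℝ} (hR : 1 ≤ R) (n : ℕ) : ((lpFreq R n).card : ℝ) ≤ 3 * R * 2 ^ n := by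
  have h1 : (1 : ℝ) ≤ R * 2 ^ n := one_le_mul_of_one_le_of_one_le hR (one_le_pow₀ one_le_two)
  have h0 : 0 ≤ ⌊R * 2 ^ n⌋ := Int.floor_nonneg.2 (by linarith)
  have h2 := Int.floor_le (R * 2 ^ n)
  rw [lpFreq, Int.card_Icc]
  have : (((⌊R * 2 ^ n⌋ + 1 - -⌊R * 2 ^ n⌋).toNat : ℤ) : ℝ) = 2 * ⌊R * 2 ^ n⌋ + 1 := by
    rw [Int.toNat_of_nonneg (by omega)]; push_cast; ring
  rw [← Int.cast_natCast, this]
  linarith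

lemma HasAnnuli.lpBlock_eq {ρ R : ℝ} (h : HasAnnuli χ φ ρ R) (n : ℕ) (u : ℤ → ℂ) (x : ℝ) :
    lpBlock χ φ n u x = ∑ k ∈ lpFreq R n, (lpSymbol χ φ n (k : ℝ) : ℂ) * u k * expMode k x := by
  unfold lpBlock
  refine tsum_eq_sum fun k hk => ?_
  have : lpSymbol χ φ n (k : ℝ) = 0 := by
    by_contra hne
    have h1 := _root_.abs_le.1 (h.abs_le n k hne)
    refine hk (Finset.mem_Icc.2 ⟨?_, Int.le_floor.2 h1.2⟩)
    have : -k ≤ ⌊R * 2 ^ n⌋ := Int.le_floor.2 (by push_cast; linarith)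
    omega
  rw [this]; simp

lemma norm_expMode (k : ℤ) (x : ℝ) : ‖expMode k x‖ = 1 := by
  rw [expMode, show Complex.I * k * x = Complex.I * ((k * x : ℝ) : ℂ) by push_cast; ring]
  exact Complex.norm_exp_I_mul_ofReal _

lemma continuous_expMode (k : ℤ) : Continuous (expMode k) := by
  unfold expMode; fun_prop

lemma expMode_add_two_pi (k : ℤ) : Function.Periodic (expMode k) (2 * Real.pi) := by
  intro x
  rw [expMode, expMode, Complex.exp_eq_exp_iff_exists_int]
  exact ⟨k, by push_cast; ring⟩

lemma norm_sq_expMode_sub_le {k : ℤ} (hk : k ≠ 0) (x y : ℝ) {h : ℝ} (h0 : 0 ≤ h) (h1 : h ≤ 1) :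
    ‖expMode k x - expMode k y‖ ^ 2 ≤ 4 * ((k : ℝ) ^ 2 * |x - y|) ^ h := by
  have hk1 : (1 : ℝ) ≤ |(k : ℝ)| := by exact_mod_cast Int.one_le_abs hk
  have hk2 : |(k : ℝ)| ≤ (k : ℝ) ^ 2 := by rw [← sq_abs]; nlinarith
  set z := |(k : ℝ)| * |x - y| with hz
  have hz0 : 0 ≤ z := by positivity
  have b2 : ‖expMode k x - expMode k y‖ ≤ 2 := by
    refine (norm_sub_le _ _).trans ?_
    rw [norm_expMode, norm_expMode]; norm_num
  have bz : ‖expMode k x - expMode k y‖ ≤ z := by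
    have e : expMode k x - expMode k y =
        expMode k y * (Complex.exp (Complex.I * ((k * (x - y) : ℝ) : ℂ)) - 1) := by
      rw [mul_sub, expMode, expMode, ← Complex.exp_add, mul_one]
      congr 2; push_cast; ring
    rw [e, norm_mul, norm_expMode, one_mul]
    refine (Real.norm_exp_I_mul_ofReal_sub_one_le).trans_eq ?_
    rw [Real.norm_eq_abs, abs_mul]
  have hzh : min 1 z ≤ z ^ h := by
    rcases le_total z 1 with hz1 | hz1
    · rw [min_eq_right hz1]
      rcases hz0.eq_or_lt with h00 | h00
      · rw [← h00]; positivity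
      · calc z = z ^ (1 : ℝ) := (Real.rpow_one z).symm
          _ ≤ _ := Real.rpow_le_rpow_of_exponent_ge h00 hz1 h1
    · rw [min_eq_left hz1]; exact Real.one_le_rpow hz1 h0
  have hn := norm_nonneg (expMode k x - expMode k y)
  calc _ ≤ 4 * min 1 z := by
        rcases le_total z 1 with hz1 | hz1
        · rw [min_eq_right hz1]; nlinarith
        · rw [min_eq_left hz1]; nlinarith
    _ ≤ 4 * z ^ h := by gcongr
    _ ≤ _ := by rw [hz]; gcongr

lemma HasAnnuli.periodic_lpBlock {ρ R : ℝ} (h : HasAnnuli χ φ ρ R) (n : ℕ) (u : ℤ → ℂ) :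
    Function.Periodic (lpBlock χ φ n u) (2 * Real.pi) := by
  intro x
  rw [h.lpBlock_eq, h.lpBlock_eq]
  refine Finset.sum_congr rfl fun k _ => ?_
  rw [expMode_add_two_pi]

end Blocks

/-! ### Moments of the blocks of the Duhamel integral -/

section BlockMoments

variable {Ω : Type*} {mΩ : MeasurableSpace Ω} {P : Measure Ω} [IsProbabilityMeasure P]

/-- Pythagoras' theorem. -/
lemma integral_norm_sq_sum_of_orthogonal {X : ℤ → Ω → ℂ} (D : Finset ℤ)
    (hX : ∀ k, MemLp (X k) 2 P) (h : ∀ k k', k ≠ k' → ∫ ω, X k ω * conj (X k' ω) ∂P = 0) :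
    ∫ ω, ‖∑ k ∈ D, X k ω‖ ^ 2 ∂P = ∑ k ∈ D, ∫ ω, ‖X k ω‖ ^ 2 ∂P := by
  have hstar : ∀ k, MemLp (fun ω => conj (X k ω)) 2 P := fun k => (hX k).star
  have hint : ∀ k k', Integrable (fun ω => X k ω * conj (X k' ω)) P := fun k k' =>
    (hX k).integrable_mul (hstar k')
  have e : ((∫ ω, ‖∑ k ∈ D, X k ω‖ ^ 2 ∂P : ℝ) : ℂ) = ((∑ k ∈ D, ∫ ω, ‖X k ω‖ ^ 2 ∂P : ℝ) : ℂ) := by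
    rw [integral_norm_sq_eq]
    push_cast
    simp only [map_sum, Finset.sum_mul_sum]
    rw [integral_finsetSum _ fun k _ => integrable_finsetSum _ fun k' _ => hint k k']
    refine Finset.sum_congr rfl fun k hk => ?_
    rw [integral_finsetSum _ fun k' _ => hint k k',
      Finset.sum_eq_single_of_mem k hk fun k' _ hne => h k k' hne.symm]
    exact (integral_norm_sq_eq (X := X k)).symm
  exact_mod_cast e

variable {H : Submodule ℝ (Lp ℝ 2 P)} {w : ℤ → ℝ → Ω → ℂ} {q : ℤ → ℂ} {F : Finset ℤ} {a : ℤ → ℤ → ℝ}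

/-- The second moment of space-time increments of a trigonometric polynomial in the modes of the
Duhamel integral: distinct modes are uncorrelated, so that only the energies add up. -/
lemma IsOUFamily.integral_norm_sq_block_sub_le (hw : IsOUFamily H w) (ha : IsSymbol F a)
    (D : Finset ℤ) (σ : ℤ → ℝ) {t u x y δ h : ℝ} (ht : 0 ≤ t) (hu : 0 ≤ u) (htu : |t - u| ≤ δ)
    (hxy : |x - y| ≤ δ) (h0 : 0 ≤ h) (h1 : h ≤ 1) :
    ∫ ω, ‖∑ k ∈ D, (σ k : ℂ) * quadJ q w F a t ω k * expMode k x -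
      ∑ k ∈ D, (σ k : ℂ) * quadJ q w F a u ω k * expMode k y‖ ^ 2 ∂P ≤
    ∑ k ∈ D, if k = 0 then 0 else σ k ^ 2 * (16 * ((k : ℝ) ^ 2 * δ) ^ h * quadEnergy q F a k) := by
  set X : ℤ → Ω → ℂ := fun k ω => (σ k : ℂ) * quadJ q w F a t ω k * expMode k x -
    (σ k : ℂ) * quadJ q w F a u ω k * expMode k y with hXdef
  have hJ : ∀ k {s : ℝ}, 0 ≤ s → MemLp (fun ω => quadJ q w F a s ω k) 2 P := fun k s hs =>
    (hw.inSub_quadJ ha k hs).memLp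
  have hJs : ∀ k {s : ℝ}, 0 ≤ s → MemLp (fun ω => conj (quadJ q w F a s ω k)) 2 P := fun k s hs =>
    (hJ k hs).star
  have hXm : ∀ k, MemLp (X k) 2 P := fun k =>
    (((hJ k ht).const_mul _).mul_const _).sub (((hJ k hu).const_mul _).mul_const _)
  have horth : ∀ k k', k ≠ k' → ∫ ω, X k ω * conj (X k' ω) ∂P = 0 := by
    intro k k' hkk
    have e : ∀ ω, X k ω * conj (X k' ω) =
        (σ k * expMode k x * (σ k' * conj (expMode k' x))) *
          (quadJ q w F a t ω k * conj (quadJ q w F a t ω k')) -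
        (σ k * expMode k x * (σ k' * conj (expMode k' y))) *
          (quadJ q w F a t ω k * conj (quadJ q w F a u ω k')) -
        ((σ k * expMode k y * (σ k' * conj (expMode k' x))) *
          (quadJ q w F a u ω k * conj (quadJ q w F a t ω k')) -
        (σ k * expMode k y * (σ k' * conj (expMode k' y))) *
          (quadJ q w F a u ω k * conj (quadJ q w F a u ω k'))) := by
      intro ω
      simp only [hXdef, map_sub, map_mul, Complex.conj_ofReal]
      ring
    have hi : ∀ {s r : ℝ}, 0 ≤ s → 0 ≤ r → ∀ c : ℂ, Integrable (fun ω =>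
        c * (quadJ q w F a s ω k * conj (quadJ q w F a r ω k'))) P := fun hs hr c =>
      ((hJ k hs).integrable_mul (hJs k' hr)).const_mul c
    have hz : ∀ {s r : ℝ}, 0 ≤ s → 0 ≤ r → ∀ c : ℂ, ∫ ω,
        c * (quadJ q w F a s ω k * conj (quadJ q w F a r ω k')) ∂P = 0 := fun hs hr c => by
      rw [integral_const_mul, hw.integral_quadJ_mul_conj_of_ne ha hkk hs hr, mul_zero]
    have hsub : ∀ f g : Ω → ℂ, Integrable f P ∧ ∫ ω, f ω ∂P = 0 → Integrable g P ∧ ∫ ω, g ω ∂P = 0 →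
        Integrable (fun ω => f ω - g ω) P ∧ ∫ ω, (f ω - g ω) ∂P = 0 := fun f g hf hg =>
      ⟨hf.1.sub hg.1, by rw [integral_sub hf.1 hg.1, hf.2, hg.2, sub_zero]⟩
    simp only [e]
    exact (hsub _ _ (hsub _ _ ⟨hi ht ht _, hz ht ht _⟩ ⟨hi ht hu _, hz ht hu _⟩)
      (hsub _ _ ⟨hi hu ht _, hz hu ht _⟩ ⟨hi hu hu _, hz hu hu _⟩)).2
  have e0 : ∀ ω, ∑ k ∈ D, (σ k : ℂ) * quadJ q w F a t ω k * expMode k x -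
      ∑ k ∈ D, (σ k : ℂ) * quadJ q w F a u ω k * expMode k y = ∑ k ∈ D, X k ω := fun ω => by
    rw [← Finset.sum_sub_distrib]
  simp only [e0]
  rw [integral_norm_sq_sum_of_orthogonal D hXm horth]
  refine Finset.sum_le_sum fun k _ => ?_
  split_ifs with hk
  · subst hk
    simp [hXdef, quadJ_freq_zero]
  have hδ : 0 ≤ δ := (abs_nonneg _).trans htu
  have hE := quadEnergy_nonneg q F a k
  have hb : ∀ ω, ‖X k ω‖ ^ 2 ≤ σ k ^ 2 * (2 * ‖quadJ q w F a t ω k - quadJ q w F a u ω k‖ ^ 2 +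
      2 * (‖expMode k x - expMode k y‖ ^ 2 * ‖quadJ q w F a u ω k‖ ^ 2)) := by
    intro ω
    have e : X k ω = (σ k : ℂ) * ((quadJ q w F a t ω k - quadJ q w F a u ω k) * expMode k x +
        (expMode k x - expMode k y) * quadJ q w F a u ω k) := by
      simp only [hXdef]; ring
    rw [e, norm_mul, mul_pow, Complex.norm_real, Real.norm_eq_abs, sq_abs]
    refine mul_le_mul_of_nonneg_left ?_ (sq_nonneg _)
    have h2 : ‖(quadJ q w F a t ω k - quadJ q w F a u ω k) * expMode k x‖ =
        ‖quadJ q w F a t ω k - quadJ q w F a u ω k‖ := by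
      rw [norm_mul, norm_expMode, mul_one]
    calc _ ≤ (‖quadJ q w F a t ω k - quadJ q w F a u ω k‖ +
          ‖expMode k x - expMode k y‖ * ‖quadJ q w F a u ω k‖) ^ 2 := by
          rw [← h2, ← norm_mul]; gcongr; exact norm_add_le _ _
      _ ≤ _ := add_sq_le
      _ = _ := by rw [mul_pow]; ring
  have hI1 : Integrable (fun ω => 2 * ‖quadJ q w F a t ω k - quadJ q w F a u ω k‖ ^ 2) P :=
    (((hJ k ht).sub (hJ k hu)).norm.integrable_sq).const_mul _
  have hI2 : Integrable (fun ω => 2 * (‖expMode k x - expMode k y‖ ^ 2 *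
      ‖quadJ q w F a u ω k‖ ^ 2)) P :=
    (((hJ k hu).norm.integrable_sq).const_mul _).const_mul _
  calc _ ≤ ∫ ω, σ k ^ 2 * (2 * ‖quadJ q w F a t ω k - quadJ q w F a u ω k‖ ^ 2 +
      2 * (‖expMode k x - expMode k y‖ ^ 2 * ‖quadJ q w F a u ω k‖ ^ 2)) ∂P :=
        integral_mono_of_nonneg (ae_of_all _ fun ω => sq_nonneg _)
          ((hI1.add hI2).const_mul _) (ae_of_all _ hb)
    _ = σ k ^ 2 * (2 * ∫ ω, ‖quadJ q w F a t ω k - quadJ q w F a u ω k‖ ^ 2 ∂P +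
        2 * (‖expMode k x - expMode k y‖ ^ 2 * ∫ ω, ‖quadJ q w F a u ω k‖ ^ 2 ∂P)) := by
        rw [integral_const_mul, integral_add hI1 hI2, integral_const_mul, integral_const_mul,
          integral_const_mul]
    _ ≤ σ k ^ 2 * (2 * (4 * ((k : ℝ) ^ 2 * δ) ^ h * quadEnergy q F a k) +
        2 * (4 * ((k : ℝ) ^ 2 * δ) ^ h * quadEnergy q F a k)) := by
        have b1 := hw.integral_norm_sq_quadJ_sub_le (q := q) ha hk hu ht h0 h1
        have b2 := hw.integral_norm_sq_quadJ_le (q := q) ha hk hu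
        have b3 := norm_sq_expMode_sub_le hk x y h0 h1
        have b4 : ((k : ℝ) ^ 2 * |t - u|) ^ h ≤ ((k : ℝ) ^ 2 * δ) ^ h := by gcongr
        have b5 : ((k : ℝ) ^ 2 * |x - y|) ^ h ≤ ((k : ℝ) ^ 2 * δ) ^ h := by gcongr
        have b6 : 0 ≤ ∫ ω, ‖quadJ q w F a u ω k‖ ^ 2 ∂P := integral_nonneg fun ω => sq_nonneg _
        refine mul_le_mul_of_nonneg_left (add_le_add ?_ ?_) (sq_nonneg _)
        · refine mul_le_mul_of_nonneg_left (b1.trans ?_) zero_le_two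
          gcongr
        · refine mul_le_mul_of_nonneg_left (mul_le_mul (b3.trans ?_) b2 b6 (by positivity))
            zero_le_two
          gcongr
    _ = _ := by ring

end BlockMoments

/-! ### The path norm of the Duhamel integral -/

section PathNorm

variable {Ω : Type*} {mΩ : MeasurableSpace Ω} {P : Measure Ω} [IsProbabilityMeasure P]
  {H : Submodule ℝ (Lp ℝ 2 P)} {w : ℤ → ℝ → Ω → ℂ} {q : ℤ → ℂ} {F : Finset ℤ} {a : ℤ → ℤ → ℝ}
  {χ φ : ℝ → ℝ} {ρ R : ℝ}

lemma rpow_le_of_mem_annulus (hρ : 0 < ρ) {x y : ℝ} (hy : 0 < y) (h1 : ρ * y ≤ x)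
    (h2 : x ≤ R * y) (e : ℝ) : x ^ e ≤ (ρ ^ e + R ^ e) * y ^ e := by
  have hx : 0 < x := (by positivity : 0 < ρ * y).trans_le h1
  have hR : 0 < R := by
    by_contra hR
    nlinarith
  rcases le_total 0 e with he | he
  · calc x ^ e ≤ (R * y) ^ e := Real.rpow_le_rpow hx.le h2 he
      _ = R ^ e * y ^ e := Real.mul_rpow hR.le hy.le
      _ ≤ _ := by gcongr; linarith [Real.rpow_pos_of_pos hρ e]
  · calc x ^ e ≤ (ρ * y) ^ e := Real.rpow_le_rpow_of_nonpos (by positivity) h1 he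
      _ = ρ ^ e * y ^ e := Real.mul_rpow hρ.le hy.le
      _ ≤ _ := by gcongr; linarith [Real.rpow_pos_of_pos hR e]

/-- The constant in the second moment bound for the increments of the blocks. -/
noncomputable def blockConst (ρ R e : ℝ) : ℝ := 48 * R * (ρ ^ e + R ^ e)

/-- On the block with index `n` there are about `2^n` frequencies, each of size `2^n`; this gives the
exponent `e₀ + 2h + 1`. -/
lemma IsOUFamily.integral_norm_sq_lpBlock_sub_le (hw : IsOUFamily H w) (ha : IsSymbol F a)
    (hχφ : IsDyadicPartition χ φ) (hann : HasAnnuli χ φ ρ R) {A e₀ : ℝ} (hA : 0 ≤ A)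
    (hE : ∀ k : ℤ, k ≠ 0 → quadEnergy q F a k ≤ A * |(k : ℝ)| ^ e₀) (n : ℕ)
    {t u x y δ h : ℝ} (ht : 0 ≤ t) (hu : 0 ≤ u) (htu : |t - u| ≤ δ)
    (hxy : |x - y| ≤ δ) (h0 : 0 ≤ h) (h1 : h ≤ 1) :
    ∫ ω, ‖lpBlock χ φ n (quadJ q w F a t ω) x - lpBlock χ φ n (quadJ q w F a u ω) y‖ ^ 2 ∂P ≤
      blockConst ρ R (e₀ + 2 * h) * A * ((2 : ℝ) ^ n) ^ (e₀ + 2 * h + 1) * δ ^ h := by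
  have hδ : 0 ≤ δ := (abs_nonneg _).trans htu
  have hρ := hann.pos
  have hR := hann.one_le
  have hy : (0 : ℝ) < 2 ^ n := by positivity
  simp only [hann.lpBlock_eq]
  refine (hw.integral_norm_sq_block_sub_le ha (lpFreq R n) (fun k => lpSymbol χ φ n (k : ℝ))
    ht hu htu hxy h0 h1).trans ?_
  have hterm : ∀ k ∈ lpFreq R n, (if k = 0 then 0 else lpSymbol χ φ n (k : ℝ) ^ 2 *
      (16 * ((k : ℝ) ^ 2 * δ) ^ h * quadEnergy q F a k)) ≤
      16 * δ ^ h * A * ((ρ ^ (e₀ + 2 * h) + R ^ (e₀ + 2 * h)) * ((2 : ℝ) ^ n) ^ (e₀ + 2 * h)) := by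
    intro k _
    have hpos : 0 ≤ 16 * δ ^ h * A *
        ((ρ ^ (e₀ + 2 * h) + R ^ (e₀ + 2 * h)) * ((2 : ℝ) ^ n) ^ (e₀ + 2 * h)) := by positivity
    split_ifs with hk
    · exact hpos
    by_cases hs : lpSymbol χ φ n (k : ℝ) = 0
    · rw [hs]; simpa using hpos
    have hk0 : 0 < |(k : ℝ)| := by positivity
    have hb := rpow_le_of_mem_annulus hρ hy (hann.le_abs n k hk hs) (hann.abs_le n k hs)
      (e₀ + 2 * h)
    have hm := hχφ.lpSymbol_mem n (k : ℝ)
    have hEn := quadEnergy_nonneg q F a k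
    calc _ ≤ 1 * (16 * ((k : ℝ) ^ 2 * δ) ^ h * (A * |(k : ℝ)| ^ e₀)) := by
          gcongr
          · exact pow_le_one₀ hm.1 hm.2
          · exact hE k hk
      _ = 16 * δ ^ h * A * |(k : ℝ)| ^ (e₀ + 2 * h) := by
          rw [Real.mul_rpow (sq_nonneg _) hδ, Real.rpow_add hk0, ← sq_abs, Real.rpow_mul hk0.le]
          norm_num
          ring
      _ ≤ _ := by gcongr
  refine (Finset.sum_le_card_nsmul _ _ _ hterm).trans ?_
  rw [nsmul_eq_mul]
  calc _ ≤ (3 * R * 2 ^ n) * (16 * δ ^ h * A *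
        ((ρ ^ (e₀ + 2 * h) + R ^ (e₀ + 2 * h)) * ((2 : ℝ) ^ n) ^ (e₀ + 2 * h))) := by
        gcongr
        exact card_lpFreq_le hR n
    _ = _ := by rw [Real.rpow_add hy _ 1, Real.rpow_one, blockConst]; ring

lemma HasAnnuli.inSub_lpBlock (hann : HasAnnuli χ φ ρ R) (hw : IsOUFamily H w)
    (ha : IsSymbol F a) (n : ℕ) {t : ℝ} (ht : 0 ≤ t) (x : ℝ) :
    InSub (chaos H) (fun ω => lpBlock χ φ n (quadJ q w F a t ω) x) := by
  simp only [hann.lpBlock_eq]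
  refine InSub.sum _ fun k _ => ?_
  refine (((hw.inSub_quadJ (q := q) ha k ht).const_mul (lpSymbol χ φ n (k : ℝ) : ℂ)).const_mul
    (expMode k x)).congr (ae_of_all _ fun ω => ?_)
  simp only; ring

lemma HasAnnuli.measurable_lpBlock (hann : HasAnnuli χ φ ρ R) (hw : IsOUFamily H w)
    (n : ℕ) {t : ℝ} (ht : 0 ≤ t) (x : ℝ) :
    Measurable fun ω => lpBlock χ φ n (quadJ q w F a t ω) x := by
  simp only [hann.lpBlock_eq]
  exact Finset.measurable_fun_sum _ fun k _ =>
    ((hw.measurable_quadJ ht k).const_mul _).mul_const _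

lemma HasAnnuli.continuous_lpBlock (hann : HasAnnuli χ φ ρ R) (hw : IsOUFamily H w)
    (n : ℕ) (ω : Ω) :
    Continuous fun p : ℝ × ℝ => lpBlock χ φ n (quadJ q w F a p.1 ω) p.2 := by
  simp only [hann.lpBlock_eq]
  refine continuous_finsetSum _ fun k _ => ?_
  exact (continuous_const.mul ((hw.continuous_quadJ ω k).comp continuous_fst)).mul
    ((continuous_expMode k).comp continuous_snd)

/-- By hypercontractivity, the second moment bound upgrades to all even moments; for `h = 3 / N`
the `2N`-th moment of an increment is of order `δ³`, as chaining in dimension two requires. -/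
lemma IsOUFamily.lintegral_lpBlock_sub_le (hw : IsOUFamily H w) (ha : IsSymbol F a)
    (hχφ : IsDyadicPartition χ φ) (hann : HasAnnuli χ φ ρ R) {A e₀ : ℝ} (hA : 0 ≤ A)
    (hE : ∀ k : ℤ, k ≠ 0 → quadEnergy q F a k ≤ A * |(k : ℝ)| ^ e₀) (n : ℕ)
    {t u x y δ : ℝ} (ht : 0 ≤ t) (hu : 0 ≤ u) (htu : |t - u| ≤ δ)
    (hxy : |x - y| ≤ δ) {N : ℕ} (hN : 3 ≤ N) :
    ∫⁻ ω, ‖lpBlock χ φ n (quadJ q w F a t ω) x -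
      lpBlock χ φ n (quadJ q w F a u ω) y‖ₑ ^ (2 * N) ∂P ≤
      hyperConst N * ENNReal.ofReal (blockConst ρ R (e₀ + 2 * (3 / N)) * A *
        ((2 : ℝ) ^ n) ^ (e₀ + 2 * (3 / N) + 1)) ^ N * ENNReal.ofReal δ ^ 3 := by
  have hδ : 0 ≤ δ := (abs_nonneg _).trans htu
  have hN3 : (3 : ℝ) ≤ N := by exact_mod_cast hN
  have hN0 : (0 : ℝ) < N := by linarith
  have hρ := hann.pos
  have hR := hann.one_le
  have hS : InSub (chaos H) (fun ω => lpBlock χ φ n (quadJ q w F a t ω) x -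
      lpBlock χ φ n (quadJ q w F a u ω) y) :=
    (hann.inSub_lpBlock hw ha n ht x).sub (hann.inSub_lpBlock hw ha n hu y)
  refine (hypercontractivity hw.isGaussianSpace hS N).trans ?_
  rw [mul_assoc]
  gcongr
  have h2 := hw.integral_norm_sq_lpBlock_sub_le (q := q) ha hχφ hann hA hE n ht hu htu hxy
    (h := 3 / N) (by positivity) (by rw [div_le_one hN0]; exact hN3)
  rw [lintegral_enorm_sq_eq hS.memLp]
  calc _ ≤ ENNReal.ofReal (blockConst ρ R (e₀ + 2 * (3 / N)) * A *
        ((2 : ℝ) ^ n) ^ (e₀ + 2 * (3 / N) + 1) * δ ^ (3 / N : ℝ)) ^ N := by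
        gcongr
    _ = _ := by
        have hB : 0 ≤ blockConst ρ R (e₀ + 2 * (3 / N)) := by unfold blockConst; positivity
        rw [ENNReal.ofReal_mul (by positivity), mul_pow, ← ENNReal.ofReal_pow (p := δ ^ (3 / N : ℝ))
          (by positivity), ← Real.rpow_mul_natCast hδ, div_mul_cancel₀ _ hN0.ne',
          ← ENNReal.ofReal_pow hδ]
        norm_num

/-- A random variable that dominates `‖Δ_n J_t(x)‖^{2N}` for `t ∈ [0, T]` and all `x`. -/
noncomputable def blockSup (χ φ : ℝ → ℝ) (T : ℝ) (q : ℤ → ℂ) (w : ℤ → ℝ → Ω → ℂ) (F : Finset ℤ)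
    (a : ℤ → ℤ → ℝ) (N n : ℕ) (ω : Ω) : ℝ≥0∞ :=
  chainConst (2 * N) ^ (2 * N) * chainSum (fun s x =>
    lpBlock χ φ n (quadJ q w F a ((T + 1) * s) ω) (2 * Real.pi * x)) (2 * N)

/-- After rescaling time and space to the unit square, the chaining bound applies to the block. -/
lemma HasAnnuli.enorm_pow_lpBlock_le (hann : HasAnnuli χ φ ρ R) (hw : IsOUFamily H w)
    {T : ℝ} {N : ℕ} (hN : N ≠ 0) (n : ℕ) (ω : Ω) {t : ℝ} (ht : t ∈ Icc 0 T) (x : ℝ) :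
    ‖lpBlock χ φ n (quadJ q w F a t ω) x‖ₑ ^ (2 * N) ≤ blockSup χ φ T q w F a N n ω := by
  have hT : 0 < T + 1 := by linarith [ht.1.trans ht.2]
  obtain ⟨y, hy, hxy⟩ := (hann.periodic_lpBlock n (quadJ q w F a t ω)).exists_mem_Ico₀
    Real.two_pi_pos x
  set f : ℝ → ℝ → ℂ := fun s x =>
    lpBlock χ φ n (quadJ q w F a ((T + 1) * s) ω) (2 * Real.pi * x) with hf
  have hcont : Continuous (Function.uncurry f) :=
    (hann.continuous_lpBlock (q := q) (F := F) (a := a) hw n ω).comp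
      (f := fun p : ℝ × ℝ => ((T + 1) * p.1, 2 * Real.pi * p.2)) (by fun_prop)
  have hf0 : f 0 0 = 0 := by
    simp only [hf, mul_zero, hann.lpBlock_eq, quadJ_time_zero]
    simp
  have h := enorm_pow_le_chainSum hcont hf0 (n := 2 * N) (by omega) (s := t / (T + 1))
    (x := y / (2 * Real.pi))
    ⟨div_nonneg ht.1 hT.le, by rw [div_lt_one hT]; linarith [ht.2]⟩
    ⟨div_nonneg hy.1 Real.two_pi_pos.le, by rw [div_lt_one Real.two_pi_pos]; exact hy.2⟩
  simp only [hf] at h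
  rw [mul_div_cancel₀ _ hT.ne', mul_div_cancel₀ _ Real.two_pi_pos.ne'] at h
  rw [hxy]
  exact h

lemma HasAnnuli.measurable_blockSup (hann : HasAnnuli χ φ ρ R) (hw : IsOUFamily H w)
    {T : ℝ} (hT : 0 ≤ T) (N n : ℕ) : Measurable fun ω => blockSup χ φ T q w F a N n ω :=
  (measurable_chainSum _ fun s _ hs =>
    hann.measurable_lpBlock hw n (mul_nonneg (by linarith) hs) _).const_mul _

lemma IsOUFamily.lintegral_blockSup_le (hw : IsOUFamily H w) (ha : IsSymbol F a)
    (hχφ : IsDyadicPartition χ φ) (hann : HasAnnuli χ φ ρ R) {A e₀ : ℝ} (hA : 0 ≤ A)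
    (hE : ∀ k : ℤ, k ≠ 0 → quadEnergy q F a k ≤ A * |(k : ℝ)| ^ e₀) {T : ℝ} (hT : 0 ≤ T) (n : ℕ)
    {N : ℕ} (hN : 3 ≤ N) :
    ∫⁻ ω, blockSup χ φ T q w F a N n ω ∂P ≤ chainConst (2 * N) ^ (2 * N) * (2 *
      (hyperConst N * ENNReal.ofReal (blockConst ρ R (e₀ + 2 * (3 / N)) * A *
        ((2 : ℝ) ^ n) ^ (e₀ + 2 * (3 / N) + 1)) ^ N *
        ENNReal.ofReal (T + 1 + 2 * Real.pi) ^ 3)) := by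
  have hm : ∀ s x : ℝ, 0 ≤ s → Measurable fun ω =>
      lpBlock χ φ n (quadJ q w F a ((T + 1) * s) ω) (2 * Real.pi * x) := fun s x hs =>
    hann.measurable_lpBlock hw n (mul_nonneg (by linarith) hs) _
  unfold blockSup
  rw [lintegral_const_mul _ (measurable_chainSum _ hm)]
  refine mul_le_mul_of_nonneg_left ?_ zero_le
  refine lintegral_chainSum_le hm fun s t x y δ hs ht hst hxy => ?_
  have hπ := Real.two_pi_pos
  have hδ : 0 ≤ δ := (abs_nonneg _).trans hst
  refine (hw.lintegral_lpBlock_sub_le ha hχφ hann hA hE n (δ := (T + 1 + 2 * Real.pi) * δ)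
    (mul_nonneg (by linarith) hs) (mul_nonneg (by linarith) ht) ?_ ?_ hN).trans_eq ?_
  · rw [← mul_sub, abs_mul, abs_of_pos (by linarith : 0 < T + 1)]
    exact mul_le_mul (by linarith) hst (abs_nonneg _) (by linarith)
  · rw [← mul_sub, abs_mul, abs_of_pos hπ]
    exact mul_le_mul (by linarith) hxy (abs_nonneg _) (by linarith)
  · rw [ENNReal.ofReal_mul (p := T + 1 + 2 * Real.pi) (by linarith), mul_pow _ (ENNReal.ofReal δ),
      ← mul_assoc]

lemma two_rpow_ofReal (x : ℝ) : ENNReal.ofReal ((2 : ℝ) ^ x) = (2 : ℝ≥0∞) ^ x := by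
  rw [← ENNReal.ofReal_rpow_of_pos two_pos]; norm_num

/-- A random variable that dominates the `2N`-th power of the path norm. -/
noncomputable def pathSup (χ φ : ℝ → ℝ) (T β : ℝ) (q : ℤ → ℂ) (w : ℤ → ℝ → Ω → ℂ) (F : Finset ℤ)
    (a : ℤ → ℤ → ℝ) (N : ℕ) (ω : Ω) : ℝ≥0∞ :=
  ∑' n : ℕ, ((2 : ℝ≥0∞) ^ (((n : ℝ) - 1) * β)) ^ (2 * N) * blockSup χ φ T q w F a N n ω

lemma HasAnnuli.measurable_pathSup (hann : HasAnnuli χ φ ρ R) (hw : IsOUFamily H w)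
    {T : ℝ} (hT : 0 ≤ T) (β : ℝ) (N : ℕ) : Measurable fun ω => pathSup χ φ T β q w F a N ω :=
  Measurable.tsum fun n => (hann.measurable_blockSup hw hT N n).const_mul _

lemma HasAnnuli.pathNorm_pow_le (hann : HasAnnuli χ φ ρ R) (hw : IsOUFamily H w)
    {T : ℝ} (β : ℝ) {N : ℕ} (hN : N ≠ 0) (ω : Ω) :
    pathNorm χ φ T β (fun t => quadJ q w F a t ω) ^ (2 * N) ≤ pathSup χ φ T β q w F a N ω := by
  have hN' : (0 : ℝ) < ((2 * N : ℕ) : ℝ) := by positivity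
  have key : ∀ x : ℝ≥0∞, x ^ (2 * N) ≤ pathSup χ φ T β q w F a N ω ↔
      x ≤ pathSup χ φ T β q w F a N ω ^ (1 / ((2 * N : ℕ) : ℝ)) := by
    intro x
    rw [one_div, ENNReal.le_rpow_inv_iff hN', ENNReal.rpow_natCast]
  rw [key]
  refine iSup₂_le fun t ht => iSup_le fun n => ?_
  rw [ENNReal.mul_iSup]
  refine iSup_le fun x => ?_
  rw [← key, mul_pow]
  refine le_trans ?_ (ENNReal.le_tsum n)
  gcongr
  exact hann.enorm_pow_lpBlock_le hw hN n ω ht x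

/-- Moments of the path norm: the exponents add up to a geometric series precisely when
`β` is below the regularity given by the energy bound. -/
lemma IsDyadicPartition.exists_lintegral_pathSup_le (hχφ : IsDyadicPartition χ φ)
    (T β e₀ : ℝ) {N : ℕ} (hN : 3 ≤ N) (hT : 0 ≤ T)
    (hβ : 2 * β + (e₀ + 2 * (3 / N) + 1) < 0) :
    ∃ C : ℝ≥0∞, C ≠ ∞ ∧ ∀ (A : ℝ) (F : Finset ℤ) (a : ℤ → ℤ → ℝ), 0 ≤ A → IsOUFamily H w →
      IsSymbol F a → (∀ k : ℤ, k ≠ 0 → quadEnergy q F a k ≤ A * |(k : ℝ)| ^ e₀) →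
      ∫⁻ ω, pathSup χ φ T β q w F a N ω ∂P ≤ C * ENNReal.ofReal A ^ N := by
  obtain ⟨ρ, R, hann⟩ := hχφ.exists_hasAnnuli
  have hρ := hann.pos
  have hR := hann.one_le
  have hN0 : (0 : ℝ) < N := by positivity
  set e : ℝ := e₀ + 2 * (3 / N) + 1 with he
  have hB : 0 ≤ blockConst ρ R (e₀ + 2 * (3 / N)) := by unfold blockConst; positivity
  set r : ℝ≥0∞ := (2 : ℝ≥0∞) ^ (N * (2 * β + e)) with hr
  have hr1 : r < 1 := ENNReal.rpow_lt_one_of_one_lt_of_neg ENNReal.one_lt_two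
    (mul_neg_of_pos_of_neg hN0 hβ)
  set C₀ : ℝ≥0∞ := chainConst (2 * N) ^ (2 * N) * (2 * (hyperConst N *
    ENNReal.ofReal (blockConst ρ R (e₀ + 2 * (3 / N))) ^ N *
    ENNReal.ofReal (T + 1 + 2 * Real.pi) ^ 3)) * (2 : ℝ≥0∞) ^ (-(β * (2 * N))) with hC₀
  refine ⟨C₀ * (1 - r)⁻¹, ?_, ?_⟩
  · have h1 : chainConst (2 * N) ≠ ∞ := chainConst_ne_top (by omega)
    have h2 := hyperConst_ne_top N
    have h3 : (1 - r)⁻¹ ≠ ∞ := by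
      rw [ENNReal.inv_ne_top]; exact (tsub_pos_of_lt hr1).ne'
    have h4 : (2 : ℝ≥0∞) ^ (-(β * (2 * N))) ≠ ∞ :=
      ENNReal.rpow_ne_top_of_ne_zero (by simp) (by simp)
    finiteness
  · intro A F a hA hw ha hE
    unfold pathSup
    rw [lintegral_tsum fun n => ((hann.measurable_blockSup hw hT N n).const_mul _).aemeasurable]
    rw [← ENNReal.tsum_geometric, ← ENNReal.tsum_mul_left, ← ENNReal.tsum_mul_right]
    refine ENNReal.tsum_le_tsum fun n => ?_
    rw [lintegral_const_mul _ (hann.measurable_blockSup hw hT N n)]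
    calc _ ≤ ((2 : ℝ≥0∞) ^ (((n : ℝ) - 1) * β)) ^ (2 * N) * (chainConst (2 * N) ^ (2 * N) * (2 *
          (hyperConst N * ENNReal.ofReal (blockConst ρ R (e₀ + 2 * (3 / N)) * A *
          ((2 : ℝ) ^ n) ^ e) ^ N * ENNReal.ofReal (T + 1 + 2 * Real.pi) ^ 3))) := by
          gcongr
          exact hw.lintegral_blockSup_le ha hχφ hann hA hE hT n hN
      _ = _ := by
          have e1 : ENNReal.ofReal (blockConst ρ R (e₀ + 2 * (3 / N)) * A * ((2 : ℝ) ^ n) ^ e) =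
              ENNReal.ofReal (blockConst ρ R (e₀ + 2 * (3 / N))) * ENNReal.ofReal A *
              (2 : ℝ≥0∞) ^ (n * e) := by
            rw [ENNReal.ofReal_mul (by positivity), ENNReal.ofReal_mul hB, ← Real.rpow_natCast,
              ← Real.rpow_mul zero_le_two, two_rpow_ofReal]
          have e2 : ((2 : ℝ≥0∞) ^ (((n : ℝ) - 1) * β)) ^ (2 * N) * ((2 : ℝ≥0∞) ^ (n * e)) ^ N =
              (2 : ℝ≥0∞) ^ (-(β * (2 * N))) * r ^ n := by
            rw [hr, ← ENNReal.rpow_natCast, ← ENNReal.rpow_natCast, ← ENNReal.rpow_natCast,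
              ← ENNReal.rpow_mul, ← ENNReal.rpow_mul, ← ENNReal.rpow_mul,
              ← ENNReal.rpow_add _ _ (by simp) (by simp),
              ← ENNReal.rpow_add _ _ (by simp) (by simp)]
            congr 1
            push_cast; ring
          rw [e1, mul_pow, mul_pow, hC₀]
          calc _ = chainConst (2 * N) ^ (2 * N) * (2 * (hyperConst N *
                ENNReal.ofReal (blockConst ρ R (e₀ + 2 * (3 / N))) ^ N *
                ENNReal.ofReal (T + 1 + 2 * Real.pi) ^ 3)) * ENNReal.ofReal A ^ N *
                (((2 : ℝ≥0∞) ^ (((n : ℝ) - 1) * β)) ^ (2 * N) * ((2 : ℝ≥0∞) ^ (n * e)) ^ N) := by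
                ring
            _ = _ := by rw [e2]; ring

end PathNorm

/-! ### Trigonometric polynomials and Besov norms -/

section Trig

lemma expMode_mul (k m : ℤ) (x : ℝ) : expMode k x * expMode m x = expMode (k + m) x := by
  unfold expMode
  rw [← Complex.exp_add]
  congr 1; push_cast; ring

lemma integral_expMode (k : ℤ) :
    ∫ x in (0 : ℝ)..(2 * Real.pi), expMode k x = if k = 0 then (2 * Real.pi : ℂ) else 0 := by
  split_ifs with hk
  · subst hk
    simp [expMode]
  · unfold expMode
    have hc : Complex.I * k ≠ 0 := mul_ne_zero Complex.I_ne_zero (by exact_mod_cast hk)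
    rw [integral_exp_mul_complex hc]
    have h : Complex.exp (Complex.I * k * (2 * Real.pi : ℝ)) = 1 := by
      rw [Complex.exp_eq_one_iff]
      exact ⟨k, by push_cast; ring⟩
    rw [h]; simp

lemma torusCoeff_eq (f : ℝ → ℂ) (k : ℤ) :
    torusCoeff f k = (2 * Real.pi : ℂ)⁻¹ * ∫ x in (0 : ℝ)..(2 * Real.pi), expMode (-k) x * f x := by
  rw [torusCoeff, fourierCoeffOn_eq_integral, Complex.real_smul]
  have h : ∀ x : ℝ, fourier (-k) (x : AddCircle (2 * Real.pi - 0)) = expMode (-k) x := by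
    intro x
    rw [fourier_coe_apply, expMode]
    congr 1
    have : (Real.pi : ℂ) ≠ 0 := by exact_mod_cast Real.pi_ne_zero
    push_cast
    field_simp
    ring
  simp only [h, smul_eq_mul]
  push_cast
  simp

lemma torusCoeff_sum_expMode_comp {ι : Type*} (S : Finset ι) (ν : ι → ℤ) (c : ι → ℂ) (k : ℤ) :
    torusCoeff (fun x => ∑ i ∈ S, c i * expMode (ν i) x) k =
      ∑ i ∈ S, if ν i = k then c i else 0 := by
  rw [torusCoeff_eq]
  have e : ∀ x : ℝ, expMode (-k) x * ∑ i ∈ S, c i * expMode (ν i) x =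
      ∑ i ∈ S, c i * expMode (ν i - k) x := by
    intro x
    rw [Finset.mul_sum]
    refine Finset.sum_congr rfl fun m _ => ?_
    rw [sub_eq_neg_add, ← expMode_mul]; ring
  simp only [e]
  rw [intervalIntegral.integral_finsetSum fun m _ =>
    ((continuous_expMode _).const_mul _).intervalIntegrable _ _, Finset.mul_sum]
  refine Finset.sum_congr rfl fun i _ => ?_
  have h2 : (2 * Real.pi : ℂ) ≠ 0 := by exact_mod_cast Real.two_pi_pos.ne'
  rw [intervalIntegral.integral_const_mul, integral_expMode]
  simp only [sub_eq_zero]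
  split_ifs
  · field_simp
  · simp

lemma torusCoeff_sum_expMode (S : Finset ℤ) (c : ℤ → ℂ) (k : ℤ) :
    torusCoeff (fun x => ∑ m ∈ S, c m * expMode m x) k = if k ∈ S then c k else 0 := by
  rw [torusCoeff_sum_expMode_comp S (fun m => m), Finset.sum_ite_eq']

lemma contDiff_expMode (k : ℤ) : ContDiff ℝ (⊤ : ℕ∞) (expMode k) := by
  unfold expMode
  exact ((contDiff_const (c := Complex.I * (k : ℂ))).mul Complex.ofRealCLM.contDiff).cexp

/-- Trigonometric polynomials are smooth. -/
lemma isSmooth_of_finite {u : ℤ → ℂ} (S : Finset ℤ) (h : ∀ k ∉ S, u k = 0) : IsSmooth u := by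
  refine ⟨fun x => ∑ m ∈ S, u m * expMode m x, ?_, ?_, ?_⟩
  · exact ContDiff.sum fun m _ => contDiff_const.mul (contDiff_expMode m)
  · intro x
    simp only [expMode_add_two_pi _ x]
  · ext k
    rw [torusCoeff_sum_expMode]
    split_ifs with hk
    · rfl
    · exact h k hk

variable {χ φ : ℝ → ℝ} {ρ R : ℝ} {β : ℝ}

lemma HasAnnuli.lpBlock_add (h : HasAnnuli χ φ ρ R) (n : ℕ) (u v : ℤ → ℂ) (x : ℝ) :
    lpBlock χ φ n (u + v) x = lpBlock χ φ n u x + lpBlock χ φ n v x := by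
  simp only [h.lpBlock_eq, ← Finset.sum_add_distrib, Pi.add_apply]
  refine Finset.sum_congr rfl fun k _ => ?_
  ring

lemma HasAnnuli.besovNorm_add_le (h : HasAnnuli χ φ ρ R) (u v : ℤ → ℂ) :
    besovNorm χ φ β (u + v) ≤ besovNorm χ φ β u + besovNorm χ φ β v := by
  refine iSup_le fun n => ?_
  rw [ENNReal.mul_iSup]
  refine iSup_le fun x => ?_
  rw [h.lpBlock_add]
  refine (mul_le_mul_of_nonneg_left (enorm_add_le _ _) zero_le).trans ?_
  rw [mul_add]
  have : ∀ u : ℤ → ℂ, (2 : ℝ≥0∞) ^ (((n : ℝ) - 1) * β) * ‖lpBlock χ φ n u x‖ₑ ≤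
      besovNorm χ φ β u := fun u =>
    le_trans (mul_le_mul_of_nonneg_left (le_iSup (fun x => ‖lpBlock χ φ n u x‖ₑ) x) zero_le)
      (le_iSup (fun n : ℕ => (2 : ℝ≥0∞) ^ (((n : ℝ) - 1) * β) * ⨆ x, ‖lpBlock χ φ n u x‖ₑ) n)
  exact add_le_add (this u) (this v)

lemma enorm_lpBlock_le_besovNorm (n : ℕ) (u : ℤ → ℂ) (x : ℝ) :
    (2 : ℝ≥0∞) ^ (((n : ℝ) - 1) * β) * ‖lpBlock χ φ n u x‖ₑ ≤ besovNorm χ φ β u :=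
  le_trans (mul_le_mul_of_nonneg_left (le_iSup (fun x => ‖lpBlock χ φ n u x‖ₑ) x) zero_le)
    (le_iSup (fun n : ℕ => (2 : ℝ≥0∞) ^ (((n : ℝ) - 1) * β) * ⨆ x, ‖lpBlock χ φ n u x‖ₑ) n)

lemma besovNorm_neg (u : ℤ → ℂ) : besovNorm χ φ β (-u) = besovNorm χ φ β u := by
  have : ∀ n x, lpBlock χ φ n (-u) x = -lpBlock χ φ n u x := by
    intro n x
    rw [lpBlock, lpBlock, ← tsum_neg]
    simp
  unfold besovNorm
  simp only [this, enorm_neg]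

lemma besovNorm_sub_comm (u v : ℤ → ℂ) : besovNorm χ φ β (u - v) = besovNorm χ φ β (v - u) := by
  rw [← neg_sub, besovNorm_neg]

lemma HasAnnuli.besovNorm_sub_le (h : HasAnnuli χ φ ρ R) (u v r : ℤ → ℂ) :
    besovNorm χ φ β (u - r) ≤ besovNorm χ φ β (u - v) + besovNorm χ φ β (v - r) := by
  rw [← sub_add_sub_cancel u v r]
  exact h.besovNorm_add_le _ _

/-- The constant bounding the Besov norm of a trigonometric polynomial by its coefficients. -/
noncomputable def modeBound (ρ β : ℝ) (k : ℤ) : ℝ≥0∞ :=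
  ∑ n ∈ (Finset.range (⌈|(k : ℝ)| / ρ⌉₊ + 1)), (2 : ℝ≥0∞) ^ (((n : ℝ) - 1) * β)

lemma modeBound_ne_top (ρ β : ℝ) (k : ℤ) : modeBound ρ β k ≠ ∞ :=
  ENNReal.sum_ne_top.2 fun _ _ => ENNReal.rpow_ne_top_of_ne_zero (by simp) (by simp)

/-- The Besov norm of a trigonometric polynomial is bounded by its coefficients: a given frequency
meets only finitely many blocks. -/
lemma HasAnnuli.besovNorm_le_sum (h : HasAnnuli χ φ ρ R) (hχφ : IsDyadicPartition χ φ)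
    {u : ℤ → ℂ} (S : Finset ℤ) (hS : ∀ k ∉ S, u k = 0) (h0 : u 0 = 0) :
    besovNorm χ φ β u ≤ ∑ k ∈ S, ‖u k‖ₑ * modeBound ρ β k := by
  refine iSup_le fun n => ?_
  rw [ENNReal.mul_iSup]
  refine iSup_le fun x => ?_
  have e : lpBlock χ φ n u x = ∑ k ∈ S, (lpSymbol χ φ n (k : ℝ) : ℂ) * u k * expMode k x := by
    unfold lpBlock
    refine tsum_eq_sum fun k hk => ?_
    rw [hS k hk]; simp
  rw [e]
  calc _ ≤ (2 : ℝ≥0∞) ^ (((n : ℝ) - 1) * β) *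
        ∑ k ∈ S, ‖(lpSymbol χ φ n (k : ℝ) : ℂ) * u k * expMode k x‖ₑ := by
        gcongr; exact enorm_sum_le _ _
    _ = ∑ k ∈ S, (2 : ℝ≥0∞) ^ (((n : ℝ) - 1) * β) *
        ‖(lpSymbol χ φ n (k : ℝ) : ℂ) * u k * expMode k x‖ₑ := Finset.mul_sum _ _ _
    _ ≤ _ := by
        refine Finset.sum_le_sum fun k _ => ?_
        have e1 : ‖expMode k x‖ₑ = 1 := by rw [← ofReal_norm, norm_expMode]; simp
        rw [enorm_mul, enorm_mul, e1, mul_one]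
        by_cases hk : k = 0
        · rw [hk, h0]; simp
        by_cases hs : lpSymbol χ φ n (k : ℝ) = 0
        · rw [hs]; simp
        have hle : ‖(lpSymbol χ φ n (k : ℝ) : ℂ)‖ₑ ≤ 1 := by
          have := hχφ.lpSymbol_mem n (k : ℝ)
          rw [← ofReal_norm, Complex.norm_real, Real.norm_eq_abs, abs_of_nonneg this.1,
            ENNReal.ofReal_le_one]
          exact this.2
        have hn : n ∈ Finset.range (⌈|(k : ℝ)| / ρ⌉₊ + 1) := by
          have h1 := h.le_abs n k hk hs
          have h2 : (n : ℝ) ≤ |(k : ℝ)| / ρ := by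
            rw [le_div_iff₀ h.pos, mul_comm]
            refine le_trans ?_ h1
            have : (n : ℝ) ≤ 2 ^ n := by exact_mod_cast (Nat.lt_two_pow_self).le
            have := h.pos
            gcongr
          have : n ≤ ⌈|(k : ℝ)| / ρ⌉₊ := by exact_mod_cast h2.trans (Nat.le_ceil _)
          exact Finset.mem_range.2 (by omega)
        calc _ ≤ (2 : ℝ≥0∞) ^ (((n : ℝ) - 1) * β) * (1 * ‖u k‖ₑ) := by gcongr
          _ = ‖u k‖ₑ * (2 : ℝ≥0∞) ^ (((n : ℝ) - 1) * β) := by rw [one_mul, mul_comm]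
          _ ≤ _ := by
            gcongr
            exact Finset.single_le_sum (f := fun n : ℕ => (2 : ℝ≥0∞) ^ (((n : ℝ) - 1) * β))
              (fun _ _ => zero_le) hn

/-- Each Fourier coefficient is controlled by the Besov norm. -/
lemma HasAnnuli.exists_enorm_le_besovNorm (h : HasAnnuli χ φ ρ R) (hχφ : IsDyadicPartition χ φ)
    (β : ℝ) (k : ℤ) : ∃ C : ℝ≥0∞, C ≠ ∞ ∧ ∀ u : ℤ → ℂ, ‖u k‖ₑ ≤ C * besovNorm χ φ β u := by
  obtain ⟨n, hn⟩ := hχφ.exists_lpSymbol_ne_zero (k : ℝ)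
  set c : ℝ≥0∞ := (2 : ℝ≥0∞) ^ (((n : ℝ) - 1) * β) with hc
  have hc0 : c ≠ 0 := by simp [hc]
  have hct : c ≠ ∞ := ENNReal.rpow_ne_top_of_ne_zero (by simp) (by simp)
  set σ : ℝ≥0∞ := ‖(lpSymbol χ φ n (k : ℝ) : ℂ)‖ₑ with hσ
  have hσ0 : σ ≠ 0 := by simpa [hσ] using hn
  have hσt : σ ≠ ∞ := by simp [hσ]
  refine ⟨(σ * c)⁻¹, ENNReal.inv_ne_top.2 (mul_ne_zero hσ0 hc0), fun u => ?_⟩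
  have hk : k ∈ lpFreq R n := by
    have h1 := _root_.abs_le.1 (h.abs_le n k hn)
    refine Finset.mem_Icc.2 ⟨?_, Int.le_floor.2 h1.2⟩
    have : -k ≤ ⌊R * 2 ^ n⌋ := Int.le_floor.2 (by push_cast; linarith)
    omega
  have e : torusCoeff (lpBlock χ φ n u) k = (lpSymbol χ φ n (k : ℝ) : ℂ) * u k := by
    have : lpBlock χ φ n u =
        fun x => ∑ m ∈ lpFreq R n, (lpSymbol χ φ n (m : ℝ) : ℂ) * u m * expMode m x :=
      funext fun x => h.lpBlock_eq n u x
    rw [this, torusCoeff_sum_expMode, if_pos hk]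
  by_cases hB : besovNorm χ φ β u = ∞
  · rw [hB, ENNReal.mul_top]
    · exact le_top
    · simp [ENNReal.mul_eq_top, hσ0, hc0, hσt, hct]
  -- the Fourier coefficient of the block is bounded by its supremum
  have hsup : ∀ x, ‖lpBlock χ φ n u x‖ ≤ (besovNorm χ φ β u / c).toReal := by
    intro x
    rw [← toReal_enorm]
    refine ENNReal.toReal_mono (ENNReal.div_ne_top hB hc0) ?_
    rw [ENNReal.le_div_iff_mul_le (Or.inl hc0) (Or.inl hct), mul_comm]
    exact enorm_lpBlock_le_besovNorm n u x
  have hcoef : ‖torusCoeff (lpBlock χ φ n u) k‖ ≤ (besovNorm χ φ β u / c).toReal := by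
    rw [torusCoeff_eq, norm_mul]
    have h1 := intervalIntegral.norm_integral_le_of_norm_le_const (a := (0 : ℝ))
      (b := 2 * Real.pi) (f := fun x => expMode (-k) x * lpBlock χ φ n u x)
      (C := (besovNorm χ φ β u / c).toReal) fun x _ => by
        rw [norm_mul, norm_expMode, one_mul]; exact hsup x
    rw [sub_zero, abs_of_pos Real.two_pi_pos] at h1
    have h2 : ‖(2 * Real.pi : ℂ)⁻¹‖ = (2 * Real.pi)⁻¹ := by
      rw [norm_inv, ← Complex.ofReal_ofNat, ← Complex.ofReal_mul, Complex.norm_real,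
        Real.norm_eq_abs, abs_of_pos Real.two_pi_pos]
    rw [h2]
    calc _ ≤ (2 * Real.pi)⁻¹ * ((besovNorm χ φ β u / c).toReal * (2 * Real.pi)) := by gcongr
      _ = _ := by field_simp
  have hfin : σ * ‖u k‖ₑ ≤ besovNorm χ φ β u / c := by
    rw [hσ, ← enorm_mul, ← e, ← ofReal_norm]
    exact ENNReal.ofReal_le_of_le_toReal hcoef
  rw [← ENNReal.div_eq_inv_mul, ENNReal.le_div_iff_mul_le (Or.inl (mul_ne_zero hσ0 hc0))
    (Or.inl (ENNReal.mul_ne_top hσt hct))]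
  rw [ENNReal.le_div_iff_mul_le (Or.inl hc0) (Or.inl hct)] at hfin
  calc _ = σ * ‖u k‖ₑ * c := by ring
    _ ≤ _ := hfin

lemma besovNorm_le_pathNorm {T t : ℝ} (ht : t ∈ Icc 0 T) (u : ℝ → ℤ → ℂ) :
    besovNorm χ φ β (u t) ≤ pathNorm χ φ T β u :=
  le_iSup₂ (f := fun t (_ : t ∈ Icc 0 T) => besovNorm χ φ β (u t)) t ht

lemma HasAnnuli.pathNorm_add_le (h : HasAnnuli χ φ ρ R) {T : ℝ} (u v : ℝ → ℤ → ℂ) :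
    pathNorm χ φ T β (fun t => u t + v t) ≤ pathNorm χ φ T β u + pathNorm χ φ T β v :=
  iSup₂_le fun t ht => (h.besovNorm_add_le (u t) (v t)).trans
    (add_le_add (besovNorm_le_pathNorm ht u) (besovNorm_le_pathNorm ht v))

/-- Lower semicontinuity of the path norm under convergence of the Fourier modes. -/
lemma HasAnnuli.pathNorm_le_liminf (h : HasAnnuli χ φ ρ R) {T : ℝ} {u : ℝ → ℤ → ℂ}
    {v : ℕ → ℝ → ℤ → ℂ}
    (hv : ∀ t ∈ Icc 0 T, ∀ k, Tendsto (fun m => v m t k) atTop (𝓝 (u t k))) :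
    pathNorm χ φ T β u ≤ liminf (fun m => pathNorm χ φ T β (v m)) atTop := by
  refine iSup₂_le fun t ht => iSup_le fun n => ?_
  rw [ENNReal.mul_iSup]
  refine iSup_le fun x => ?_
  have hlim : Tendsto (fun m => (2 : ℝ≥0∞) ^ (((n : ℝ) - 1) * β) * ‖lpBlock χ φ n (v m t) x‖ₑ) atTop
      (𝓝 ((2 : ℝ≥0∞) ^ (((n : ℝ) - 1) * β) * ‖lpBlock χ φ n (u t) x‖ₑ)) := by
    refine ENNReal.Tendsto.const_mul ?_
      (Or.inr (ENNReal.rpow_ne_top_of_ne_zero (by simp) (by simp)))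
    simp only [h.lpBlock_eq]
    refine (tendsto_finsetSum _ fun k _ => ?_).enorm
    exact ((hv t ht k).const_mul _).mul_const _
  rw [← hlim.liminf_eq]
  exact liminf_le_liminf (Eventually.of_forall fun m =>
    (enorm_lpBlock_le_besovNorm n (v m t) x).trans (besovNorm_le_pathNorm ht (v m)))

/-- A uniform limit of continuous paths of trigonometric polynomials lies in the path space. -/
lemma HasAnnuli.mem_pathSpace_of_tendsto (h : HasAnnuli χ φ ρ R) (hχφ : IsDyadicPartition χ φ)
    {T : ℝ} {u : ℝ → ℤ → ℂ} {v : ℕ → ℝ → ℤ → ℂ}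
    (hfin : ∀ m, ∃ S : Finset ℤ, ∀ t, ∀ k ∉ S, v m t k = 0) (h0 : ∀ m t, v m t 0 = 0)
    (hcont : ∀ m k, Continuous fun t => v m t k)
    (hlim : Tendsto (fun m => pathNorm χ φ T β (fun t => v m t - u t)) atTop (𝓝 0)) :
    u ∈ pathSpace χ φ T β := by
  constructor
  · intro t ht δ hδ
    obtain ⟨m, hm⟩ := (hlim.eventually (gt_mem_nhds hδ)).exists
    obtain ⟨S, hS⟩ := hfin m
    refine ⟨v m t, isSmooth_of_finite S (hS t), lt_of_le_of_lt ?_ hm⟩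
    rw [besovNorm_sub_comm]
    exact besovNorm_le_pathNorm ht fun t => v m t - u t
  · intro t ht
    rw [ENNReal.tendsto_nhds_zero]
    intro δ hδ
    have hδ3 : 0 < δ / 3 := ENNReal.div_pos hδ.ne' (by simp)
    obtain ⟨m, hm⟩ := (hlim.eventually (gt_mem_nhds hδ3)).exists
    obtain ⟨S, hS⟩ := hfin m
    have hmid : Tendsto (fun s => ∑ k ∈ S, ‖v m s k - v m t k‖ₑ * modeBound ρ β k)
        (𝓝[Icc 0 T] t) (𝓝 0) := by
      have : Tendsto (fun s => ∑ k ∈ S, ‖v m s k - v m t k‖ₑ * modeBound ρ β k)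
          (𝓝 t) (𝓝 (∑ k ∈ S, ‖v m t k - v m t k‖ₑ * modeBound ρ β k)) := by
        refine tendsto_finsetSum _ fun k _ => ?_
        refine ENNReal.Tendsto.mul_const ?_ (Or.inr (modeBound_ne_top ρ β k))
        exact (((hcont m k).tendsto t).sub_const _).enorm
      simp only [sub_self, enorm_zero, zero_mul, Finset.sum_const_zero] at this
      exact this.mono_left nhdsWithin_le_nhds
    filter_upwards [hmid.eventually (gt_mem_nhds hδ3), self_mem_nhdsWithin] with s hs hsT
    have b1 : besovNorm χ φ β (v m s - u s) ≤ δ / 3 :=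
      (besovNorm_le_pathNorm hsT fun t => v m t - u t).trans hm.le
    have b2 : besovNorm χ φ β (v m t - u t) ≤ δ / 3 :=
      (besovNorm_le_pathNorm ht fun t => v m t - u t).trans hm.le
    have b3 : besovNorm χ φ β (v m s - v m t) ≤ δ / 3 := by
      refine (h.besovNorm_le_sum hχφ S (fun k hk => ?_) ?_).trans hs.le
      · rw [Pi.sub_apply, hS s k hk, hS t k hk, sub_zero]
      · rw [Pi.sub_apply, h0, h0, sub_zero]
    calc _ ≤ besovNorm χ φ β (u s - v m s) + besovNorm χ φ β (v m s - u t) :=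
          h.besovNorm_sub_le _ _ _
      _ ≤ besovNorm χ φ β (v m s - u s) + (besovNorm χ φ β (v m s - v m t) +
          besovNorm χ φ β (v m t - u t)) := by
          rw [besovNorm_sub_comm]
          gcongr
          exact h.besovNorm_sub_le _ _ _
      _ ≤ δ / 3 + (δ / 3 + δ / 3) := by gcongr
      _ = δ := by rw [← add_assoc]; exact ENNReal.add_thirds δ

end Trig

/-! ### The regularised objects as quadratic modes -/

section Regularised

/-- The symbol `ψ(εl) ψ(εm)` of the square of the regularised process. -/
noncomputable def regSymbol (ψ : ℝ → ℝ) (ε : ℝ) (l m : ℤ) : ℝ := ψ (ε * l) * ψ (ε * m)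

variable {ψ : ℝ → ℝ} {ε : ℝ} {F : Finset ℤ}

lemma isSymbol_regSymbol (hF : ∀ k ∉ F, ψ (ε * (k : ℤ)) = 0) : IsSymbol F (regSymbol ψ ε) :=
  ⟨fun l m => mul_comm _ _, fun l m hl => by rw [regSymbol, hF l hl, zero_mul]⟩

/-- The frequencies that survive the regularisation. -/
lemma exists_freq (hψ : HasCompactSupport ψ) (hε : 0 < ε) :
    ∃ F : Finset ℤ, ∀ k ∉ F, ψ (ε * (k : ℤ)) = 0 := by
  obtain ⟨L, hL⟩ := hψ.isCompact.isBounded.exists_norm_le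
  refine ⟨Finset.Icc (-⌊L / ε⌋) ⌊L / ε⌋, fun k hk => ?_⟩
  by_contra hne
  have h1 : ‖ε * (k : ℝ)‖ ≤ L := hL _ (subset_tsupport _ hne)
  rw [Real.norm_eq_abs, abs_mul, abs_of_pos hε, ← le_div_iff₀' hε] at h1
  have h2 := abs_le.1 h1
  refine hk (Finset.mem_Icc.2 ⟨?_, Int.le_floor.2 h2.2⟩)
  have : -k ≤ ⌊L / ε⌋ := Int.le_floor.2 (by push_cast; linarith)
  omega

lemma regularize_eq_sum (hF : ∀ k ∉ F, ψ (ε * (k : ℤ)) = 0) (u : ℤ → ℂ) (x : ℝ) :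
    regularize ψ ε u x = ∑ k ∈ F, (ψ (ε * k) : ℂ) * u k * expMode k x := by
  unfold regularize
  refine tsum_eq_sum fun k hk => ?_
  rw [hF k hk]; simp

lemma torusCoeff_sub_const {f : ℝ → ℂ} (hf : Continuous f) (c : ℂ) {k : ℤ} (hk : k ≠ 0) :
    torusCoeff (fun x => f x - c) k = torusCoeff f k := by
  rw [torusCoeff_eq, torusCoeff_eq]
  simp only [mul_sub]
  rw [intervalIntegral.integral_sub
    (Continuous.intervalIntegrable (by have := continuous_expMode (-k); fun_prop) _ _)
    (Continuous.intervalIntegrable (by have := continuous_expMode (-k); fun_prop) _ _),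
    intervalIntegral.integral_mul_const, integral_expMode, if_neg (neg_ne_zero.2 hk), zero_mul,
    sub_zero]

lemma sum_expMode_sq (F : Finset ℤ) (c : ℤ → ℂ) (x : ℝ) :
    (∑ k ∈ F, c k * expMode k x) ^ 2 =
      ∑ p ∈ F ×ˢ F, (c p.1 * c p.2) * expMode (p.1 + p.2) x := by
  rw [sq, Finset.sum_mul_sum, Finset.sum_product]
  refine Finset.sum_congr rfl fun l _ => Finset.sum_congr rfl fun m _ => ?_
  rw [← expMode_mul]; ring

variable {Ω : Type*} [mΩ : MeasurableSpace Ω] {P : Measure Ω} [IsProbabilityMeasure P]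
  {H : Submodule ℝ (Lp ℝ 2 P)} {w : ℤ → ℝ → Ω → ℂ} {q : ℤ → ℂ} {W : ℤ → ℝ≥0 → Ω → ℂ}

/-- The event on which the Wiener integrals are the modes of the given Ornstein–Uhlenbeck family. -/
def OUAgree (W : ℤ → ℝ≥0 → Ω → ℂ) (w : ℤ → ℝ → Ω → ℂ) (ω : Ω) : Prop :=
  ∀ k : ℤ, k ≠ 0 → ∀ t : ℝ, 0 ≤ t →
    wienerIntegral (fun s => Real.exp (-(k : ℝ) ^ 2 * (t - s))) (fun s => W k s ω) t = w k t ω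

lemma OUAgree.ouProcess_eq (hq0 : q 0 = 0) {ω : Ω} (h : OUAgree W w ω) {t : ℝ} (ht : 0 ≤ t)
    (k : ℤ) : ouProcess q W t ω k = q k * w k t ω := by
  unfold ouProcess
  rcases eq_or_ne k 0 with rfl | hk
  · rw [hq0, zero_mul, zero_mul]
  · rw [h k hk t ht]

/-- The expectation of the squared regularised process does not depend on the space variable. -/
lemma IsOUFamily.exists_integral_regularize_sq (hw : IsOUFamily H w) (hq0 : q 0 = 0)
    (hag : ∀ᵐ ω ∂P, OUAgree W w ω) (hF : ∀ k ∉ F, ψ (ε * (k : ℤ)) = 0) {t : ℝ} (ht : 0 ≤ t) :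
    ∃ c : ℂ, ∀ x, ∫ ω, regularize ψ ε (ouProcess q W t ω) x ^ 2 ∂P = c := by
  refine ⟨∑ p ∈ F ×ˢ F, (ψ (ε * p.1) * q p.1 * (ψ (ε * p.2) * q p.2)) *
    (if p.2 = -p.1 then (ouCov ((p.1 : ℝ) ^ 2) t t : ℂ) else 0), fun x => ?_⟩
  have h1 : (fun ω => regularize ψ ε (ouProcess q W t ω) x ^ 2) =ᵐ[P] fun ω =>
      ∑ p ∈ F ×ˢ F, (ψ (ε * p.1) * q p.1 * (ψ (ε * p.2) * q p.2) * expMode (p.1 + p.2) x) *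
        (w p.1 t ω * w p.2 t ω) := by
    filter_upwards [hag] with ω hω
    rw [regularize_eq_sum hF, sum_expMode_sq]
    refine Finset.sum_congr rfl fun p _ => ?_
    rw [hω.ouProcess_eq hq0 ht, hω.ouProcess_eq hq0 ht]; ring
  rw [integral_congr_ae h1, integral_finsetSum _ fun p _ =>
    ((hw.memLp_mul p.1 p.2 t).integrable one_le_two).const_mul _]
  refine Finset.sum_congr rfl fun p _ => ?_
  rw [integral_const_mul, hw.cov _ _ t ht t ht]
  split_ifs with hp
  · rw [hp, add_neg_cancel]; simp [expMode]
  · simp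

/-- The modes of the renormalised square at `k ≠ 0` are quadratic modes; the renormalisation constant
only affects the zero frequency. -/
lemma IsOUFamily.torusCoeff_wickSquare (hw : IsOUFamily H w) (hq0 : q 0 = 0)
    (hag : ∀ᵐ ω ∂P, OUAgree W w ω) (hF : ∀ k ∉ F, ψ (ε * (k : ℤ)) = 0) {ω : Ω}
    (hω : OUAgree W w ω) {t : ℝ} (ht : 0 ≤ t) {k : ℤ} (hk : k ≠ 0) :
    torusCoeff (wickSquare ψ q W P ε t ω) k = quadMode q w F (regSymbol ψ ε) t ω k := by
  obtain ⟨c, hc⟩ := hw.exists_integral_regularize_sq hq0 hag hF ht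
  have e : wickSquare ψ q W P ε t ω = fun x =>
      (∑ p ∈ F ×ˢ F, ((ψ (ε * p.1) * (q p.1 * w p.1 t ω)) * (ψ (ε * p.2) * (q p.2 * w p.2 t ω))) *
        expMode (p.1 + p.2) x) - c := by
    ext x
    rw [wickSquare, hc, regularize_eq_sum hF, ← sum_expMode_sq (c := fun l : ℤ =>
      (ψ (ε * l) : ℂ) * (q l * w l t ω))]
    simp only [hω.ouProcess_eq hq0 ht]
  have hcont : Continuous fun x => ∑ p ∈ F ×ˢ F, ((ψ (ε * p.1) * (q p.1 * w p.1 t ω)) *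
      (ψ (ε * p.2) * (q p.2 * w p.2 t ω))) * expMode (p.1 + p.2) x :=
    continuous_finsetSum _ fun p _ => continuous_const.mul (continuous_expMode _)
  rw [e, torusCoeff_sub_const hcont _ hk,
    torusCoeff_sum_expMode_comp (F ×ˢ F) (fun p => p.1 + p.2), Finset.sum_product, quadMode]
  refine Finset.sum_congr rfl fun l _ => ?_
  have e2 : ∀ m ∈ F, (if l + m = k then (ψ (ε * l) * (q l * w l t ω)) *
      (ψ (ε * m) * (q m * w m t ω)) else 0 : ℂ) = if m = k - l then
      (ψ (ε * l) * (q l * w l t ω)) * (ψ (ε * m) * (q m * w m t ω)) else 0 := fun m _ => by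
    by_cases h : l + m = k
    · rw [if_pos h, if_pos (by omega)]
    · rw [if_neg h, if_neg (by omega)]
  rw [Finset.sum_congr rfl e2, Finset.sum_ite_eq']
  by_cases h : k - l ∈ F
  · rw [if_pos h, regSymbol]; push_cast; ring
  · have := hF _ h
    rw [if_neg h, regSymbol, this]; simp

/-- The zero frequency is removed by the derivative, so that the identity holds at all modes. -/
lemma IsOUFamily.regularizedJ_eq (hw : IsOUFamily H w) (hq0 : q 0 = 0)
    (hag : ∀ᵐ ω ∂P, OUAgree W w ω) (hF : ∀ k ∉ F, ψ (ε * (k : ℤ)) = 0) {ω : Ω}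
    (hω : OUAgree W w ω) {t : ℝ} (ht : 0 ≤ t) :
    regularizedJ ψ q W P ε t ω = quadJ q w F (regSymbol ψ ε) t ω := by
  ext k
  refine intervalIntegral.integral_congr fun s hs => ?_
  rw [uIcc_of_le ht] at hs
  simp only [heat, derivX]
  rcases eq_or_ne k 0 with rfl | hk
  · simp
  · rw [hw.torusCoeff_wickSquare hq0 hag hF hω hs.1 hk]

/-! ### Estimates for the symbols -/

/-- Interpolation between the Lipschitz bound and the boundedness of `ψ`. -/
lemma exists_abs_sub_one_le (hψ : ContDiff ℝ (⊤ : ℕ∞) ψ) (hs : HasCompactSupport ψ)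
    (h0 : ψ 0 = 1) : ∃ D : ℝ, 1 ≤ D ∧ (∀ x, |ψ x| ≤ D) ∧
      ∀ s : ℝ, 0 ≤ s → s ≤ 1 → ∀ x, |ψ x - 1| ≤ D * |x| ^ s := by
  obtain ⟨L, hL⟩ := hψ.lipschitzWith_of_hasCompactSupport hs (by simp)
  obtain ⟨B, hB⟩ := hs.exists_bound_of_continuous hψ.continuous
  have hB0 : 0 ≤ B := (norm_nonneg _).trans (hB 0)
  have hL0 : (0 : ℝ) ≤ L := L.2
  refine ⟨L + B + 1, by linarith, fun x => (hB x).trans (by linarith), fun s hs0 hs1 x => ?_⟩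
  have h1 : |ψ x - 1| ≤ L * |x| := by
    have := hL.dist_le_mul x 0
    rwa [Real.dist_eq, Real.dist_eq, h0, sub_zero] at this
  have h2 : |ψ x - 1| ≤ B + 1 := by
    refine (abs_sub _ _).trans ?_
    rw [abs_one]
    have := hB x
    rw [Real.norm_eq_abs] at this
    linarith
  rcases le_total |x| 1 with hx | hx
  · have h3 : |x| ≤ |x| ^ s := by
      rcases (abs_nonneg x).eq_or_lt with h00 | h00
      · rw [← h00]; positivity
      · calc |x| = |x| ^ (1 : ℝ) := (Real.rpow_one _).symm
          _ ≤ _ := Real.rpow_le_rpow_of_exponent_ge h00 hx hs1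
    calc _ ≤ L * |x| := h1
      _ ≤ (L + B + 1) * |x| ^ s := by gcongr; linarith
  · have h3 : 1 ≤ |x| ^ s := Real.one_le_rpow hx hs0
    nlinarith

/-- Symbols with parameters at most `δ` differ by `O((δ max(|l|, |m|))^{κ/2})`: a small power of the
frequency is traded for a rate of convergence. -/
lemma exists_regSymbol_bounds (hψ : ContDiff ℝ (⊤ : ℕ∞) ψ) (hs : HasCompactSupport ψ)
    (h0 : ψ 0 = 1) : ∃ D : ℝ, 0 < D ∧ (∀ ε l m, regSymbol ψ ε l m ^ 2 ≤ D) ∧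
      ∀ κ : ℝ, 0 ≤ κ → κ ≤ 2 → ∀ δ ε ε' : ℝ, 0 < ε → 0 < ε' → ε ≤ δ → ε' ≤ δ → ∀ l m : ℤ,
        (regSymbol ψ ε l m - regSymbol ψ ε' l m) ^ 2 ≤
          D * δ ^ κ * (max |(l : ℝ)| |(m : ℝ)|) ^ κ := by
  obtain ⟨D, hD1, hDb, hD⟩ := exists_abs_sub_one_le hψ hs h0
  have hD0 : 0 < D := by linarith
  refine ⟨16 * D ^ 4, by positivity, fun ε l m => ?_, fun κ hκ0 hκ2 δ ε ε' hε hε' hδ hδ' l m => ?_⟩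
  · rw [regSymbol, mul_pow, ← sq_abs, ← sq_abs (ψ (ε * m))]
    calc _ ≤ D ^ 2 * D ^ 2 := by gcongr <;> exact hDb _
      _ ≤ _ := by nlinarith [pow_pos hD0 4]
  · set M := max |(l : ℝ)| |(m : ℝ)| with hM
    have hM0 : 0 ≤ M := (abs_nonneg _).trans (le_max_left _ _)
    have hδ0 : 0 < δ := hε.trans_le hδ
    have key : ∀ ε, 0 < ε → ε ≤ δ → |regSymbol ψ ε l m - 1| ≤ 2 * D ^ 2 * (δ * M) ^ (κ / 2) := by
      intro ε hε hεδ
      have hb : ∀ j : ℤ, |(j : ℝ)| ≤ M → |ψ (ε * j) - 1| ≤ D * (δ * M) ^ (κ / 2) := by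
        intro j hj
        refine (hD (κ / 2) (by linarith) (by linarith) _).trans ?_
        rw [abs_mul, abs_of_pos hε]
        gcongr
      have e : regSymbol ψ ε l m - 1 = (ψ (ε * l) - 1) * ψ (ε * m) + (ψ (ε * m) - 1) := by
        rw [regSymbol]; ring
      rw [e]
      refine (abs_add_le _ _).trans ?_
      rw [abs_mul]
      have h1 := hb l (le_max_left _ _)
      have h2 := hb m (le_max_right _ _)
      have hx : 0 ≤ (δ * M) ^ (κ / 2) := by positivity
      calc _ ≤ D * (δ * M) ^ (κ / 2) * D + D * (δ * M) ^ (κ / 2) := by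
            gcongr; exact hDb _
        _ ≤ _ := by nlinarith [mul_nonneg hx hD0.le]
    have h1 := key ε hε hδ
    have h2 := key ε' hε' hδ'
    have hx : 0 ≤ (δ * M) ^ (κ / 2) := by positivity
    have h3 : |regSymbol ψ ε l m - regSymbol ψ ε' l m| ≤ 4 * D ^ 2 * (δ * M) ^ (κ / 2) := by
      calc _ = |(regSymbol ψ ε l m - 1) - (regSymbol ψ ε' l m - 1)| := by ring_nf
        _ ≤ _ := abs_sub _ _
        _ ≤ _ := by linarith
    rw [← sq_abs]
    calc _ ≤ (4 * D ^ 2 * (δ * M) ^ (κ / 2)) ^ 2 := by gcongr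
      _ = 16 * D ^ 4 * ((δ * M) ^ (κ / 2)) ^ 2 := by ring
      _ = _ := by
        rw [← Real.rpow_mul_natCast (by positivity), Nat.cast_ofNat, div_mul_cancel₀ _ two_ne_zero,
          Real.mul_rpow hδ0.le hM0]
        ring

end Regularised

/-! ### Moments of non-measurable norms -/

section Moments

variable {Ω : Type*} [mΩ : MeasurableSpace Ω] {P : Measure Ω} {n : ℕ} {X Y : Ω → ℝ≥0∞} {B B' : ℝ≥0∞}

/-- The upper integral of `X ^ n` is at most `B`. Path norms are suprema over uncountable families,
so that their measurability is not available; domination by a measurable function replaces it. -/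
def MomentLE (P : Measure Ω) (n : ℕ) (X : Ω → ℝ≥0∞) (B : ℝ≥0∞) : Prop :=
  ∃ Z : Ω → ℝ≥0∞, Measurable Z ∧ (∀ᵐ ω ∂P, X ω ^ n ≤ Z ω) ∧ ∫⁻ ω, Z ω ∂P ≤ B

namespace MomentLE

lemma mono_ae (h : MomentLE P n X B) (hY : ∀ᵐ ω ∂P, Y ω ≤ X ω) : MomentLE P n Y B := by
  obtain ⟨Z, hZ, hXZ, hB⟩ := h
  refine ⟨Z, hZ, ?_, hB⟩
  filter_upwards [hXZ, hY] with ω h1 h2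
  exact (pow_le_pow_left' h2 n).trans h1

/-- Fatou's lemma. -/
lemma of_le_liminf {X : ℕ → Ω → ℝ≥0∞} (hX : ∀ᶠ m in atTop, MomentLE P n (X m) B)
    (hY : ∀ᵐ ω ∂P, Y ω ≤ liminf (fun m => X m ω) atTop) : MomentLE P n Y B := by
  obtain ⟨M, hM⟩ := eventually_atTop.1 hX
  choose Z hZ hXZ hB using fun m => hM (m + M) (by omega)
  refine ⟨fun ω => liminf (fun m => Z m ω) atTop, Measurable.liminf hZ, ?_, ?_⟩
  · filter_upwards [hY, ae_all_iff.2 hXZ] with ω h1 h2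
    have hmono : Monotone fun x : ℝ≥0∞ => x ^ n := fun x y h => pow_le_pow_left' h n
    calc _ ≤ (liminf (fun m => X m ω) atTop) ^ n := pow_le_pow_left' h1 n
      _ = (liminf (fun m => X (m + M) ω) atTop) ^ n := by
          rw [liminf_nat_add (fun m => X m ω) M]
      _ = liminf (fun m => X (m + M) ω ^ n) atTop :=
          hmono.map_liminf_of_continuousAt _ (ENNReal.continuous_pow n).continuousAt
      _ ≤ _ := liminf_le_liminf (Eventually.of_forall h2)
  · refine (lintegral_liminf_le hZ).trans ?_
    refine (liminf_le_liminf (Eventually.of_forall hB)).trans ?_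
    rw [liminf_const]

/-- Jensen's inequality. -/
lemma lintegral_rpow_le [IsProbabilityMeasure P] (hX : MomentLE P n X B) {p : ℝ} (hp : 0 ≤ p)
    (hpn : p ≤ n) (hn : n ≠ 0) : ∫⁻ ω, X ω ^ p ∂P ≤ B ^ (p / n) := by
  obtain ⟨Z, hZ, hXZ, hB⟩ := hX
  have hn' : (0 : ℝ) < n := by positivity
  have hs : 0 ≤ p / n := by positivity
  have hs1 : p / n ≤ 1 := by rwa [div_le_one hn']
  calc _ ≤ ∫⁻ ω, Z ω ^ (p / n) * (1 : ℝ≥0∞) ^ (1 - p / n) ∂P := by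
        refine lintegral_mono_ae ?_
        filter_upwards [hXZ] with ω h
        rw [ENNReal.one_rpow, mul_one]
        calc _ = (X ω ^ n) ^ (p / n) := by
              rw [← ENNReal.rpow_natCast, ← ENNReal.rpow_mul, mul_div_cancel₀ _ hn'.ne']
          _ ≤ _ := ENNReal.rpow_le_rpow h hs
    _ ≤ (∫⁻ ω, Z ω ∂P) ^ (p / n) * (∫⁻ _, (1 : ℝ≥0∞) ∂P) ^ (1 - p / n) :=
        ENNReal.lintegral_mul_norm_pow_le hZ.aemeasurable aemeasurable_const hs (by linarith)
          (by ring)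
    _ ≤ _ := by
        rw [lintegral_const, measure_univ, mul_one, ENNReal.one_rpow, mul_one]
        exact ENNReal.rpow_le_rpow hB hs

/-- If the moments decay geometrically, the sum is almost surely finite. -/
lemma ae_tsum_lt_top [IsProbabilityMeasure P] {X : ℕ → Ω → ℝ≥0∞} {r : ℝ≥0∞} (hn : n ≠ 0)
    (hB : B ≠ ∞) (hr : r < 1) (hX : ∀ m, MomentLE P n (X m) (B * r ^ m)) :
    ∀ᵐ ω ∂P, ∑' m, X m ω < ∞ := by
  have hn' : (0 : ℝ) < n := by positivity
  choose Z hZ hXZ hZB using hX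
  have hZ1 : ∀ m, MomentLE P n (fun ω => Z m ω ^ (1 / (n : ℝ))) (B * r ^ m) := fun m =>
    ⟨Z m, hZ m, ae_of_all _ fun ω => by
      rw [← ENNReal.rpow_natCast, ← ENNReal.rpow_mul, one_div_mul_cancel hn'.ne', ENNReal.rpow_one],
      hZB m⟩
  have hint : ∫⁻ ω, ∑' m, Z m ω ^ (1 / (n : ℝ)) ∂P ≠ ∞ := by
    rw [lintegral_tsum fun m => ((hZ m).pow_const _).aemeasurable]
    have hb : ∀ m, ∫⁻ ω, Z m ω ^ (1 / (n : ℝ)) ∂P ≤ B ^ (1 / (n : ℝ)) * (r ^ (1 / (n : ℝ))) ^ m := by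
      intro m
      have h1 := (hZ1 m).lintegral_rpow_le zero_le_one
        (by exact_mod_cast Nat.one_le_iff_ne_zero.2 hn) hn
      simp only [ENNReal.rpow_one] at h1
      refine h1.trans_eq ?_
      rw [ENNReal.mul_rpow_of_nonneg _ _ (by positivity), ← ENNReal.rpow_natCast,
        ← ENNReal.rpow_natCast, ← ENNReal.rpow_mul, ← ENNReal.rpow_mul, mul_comm (m : ℝ)]
    refine ne_top_of_le_ne_top ?_ (ENNReal.tsum_le_tsum hb)
    rw [ENNReal.tsum_mul_left, ENNReal.tsum_geometric]
    have h2 : r ^ (1 / (n : ℝ)) < 1 := ENNReal.rpow_lt_one hr (by positivity)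
    exact ENNReal.mul_ne_top (ENNReal.rpow_ne_top_of_nonneg (by positivity) hB)
      (ENNReal.inv_ne_top.2 (tsub_pos_of_lt h2).ne')
  filter_upwards [ae_lt_top (Measurable.tsum fun m => (hZ m).pow_const _) hint,
    ae_all_iff.2 hXZ] with ω h1 h2
  refine lt_of_le_of_lt (ENNReal.tsum_le_tsum fun m => ?_) h1
  rw [one_div, ENNReal.le_rpow_inv_iff hn', ENNReal.rpow_natCast]
  exact h2 m

end MomentLE

end Moments

/-! ### Convergence of the regularised processes -/

section Limit

variable {Ω : Type*} [mΩ : MeasurableSpace Ω] {P : Measure Ω} [IsProbabilityMeasure P]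
  {H : Submodule ℝ (Lp ℝ 2 P)} {w : ℤ → ℝ → Ω → ℂ} {q : ℤ → ℂ} {W : ℤ → ℝ≥0 → Ω → ℂ}
  {χ φ ψ : ℝ → ℝ} {γ c₂ : ℝ}

/-- The assumptions on the data, together with a realisation `w` of the Ornstein–Uhlenbeck modes in
a Gaussian space `H`. -/
structure IsOUSetup (H : Submodule ℝ (Lp ℝ 2 P)) (w : ℤ → ℝ → Ω → ℂ) (W : ℤ → ℝ≥0 → Ω → ℂ)
    (q : ℤ → ℂ) (χ φ ψ : ℝ → ℝ) (γ c₂ : ℝ) : Prop where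
  isOUFamily : IsOUFamily H w
  agree : ∀ᵐ ω ∂P, OUAgree W w ω
  partition : IsDyadicPartition χ φ
  contDiff : ContDiff ℝ (⊤ : ℕ∞) ψ
  hasCompactSupport : HasCompactSupport ψ
  map_zero : ψ 0 = 1
  half_le : 1 / 2 ≤ γ
  lt_one : γ < 1
  norm_le : ∀ k : ℤ, ‖q k‖ ≤ c₂ * |(k : ℝ)| ^ γ

lemma pathNorm_congr {T β : ℝ} {u v : ℝ → ℤ → ℂ} (h : ∀ t ∈ Icc 0 T, u t = v t) :
    pathNorm χ φ T β u = pathNorm χ φ T β v :=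
  iSup_congr fun t => iSup_congr fun ht => by rw [h t ht]

lemma IsSymbol.exists_quadJ_support {F : Finset ℤ} {a : ℤ → ℤ → ℝ}
    (ha : IsSymbol F a) : ∃ D : Finset ℤ, ∀ t ω, ∀ k ∉ D,
    quadJ q w F a t ω k = 0 := by
  refine ⟨(F ×ˢ F).image fun p => p.1 + p.2, fun t ω k hk => ?_⟩
  have h : ∀ s, quadMode q w F a s ω k = 0 := by
    intro s
    refine Finset.sum_eq_zero fun l hl => ?_
    have hm : k - l ∉ F := fun hm => hk (Finset.mem_image.2 ⟨(l, k - l), by simp [hl, hm], by simp⟩)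
    rw [ha.symm, ha.supp _ _ hm]; simp
  rw [quadJ_eq, quadInt]
  simp [h]

namespace IsOUSetup

lemma map_freq_zero (S : IsOUSetup (P := P) H w W q χ φ ψ γ c₂) : q 0 = 0 := by
  have h := S.norm_le 0
  rw [Int.cast_zero, abs_zero, Real.zero_rpow (by linarith [S.half_le]), mul_zero] at h
  simpa using h

lemma regularizedJ_eq (S : IsOUSetup (P := P) H w W q χ φ ψ γ c₂) {ε : ℝ} {F : Finset ℤ}
    (hF : ∀ k ∉ F, ψ (ε * (k : ℤ)) = 0) {ω : Ω} (hω : OUAgree W w ω) {t : ℝ} (ht : 0 ≤ t) :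
    regularizedJ ψ q W P ε t ω = quadJ q w F (regSymbol ψ ε) t ω :=
  S.isOUFamily.regularizedJ_eq S.map_freq_zero S.agree hF hω ht

/-- The moment bound for the path norm in terms of a bound `a(l, m)² ≤ K max(|l|, |m|)^κ` for the
symbol, with some `κ > 0` depending on the gap between `β` and `2 - 2γ`. -/
lemma exists_momentLE (S : IsOUSetup (P := P) H w W q χ φ ψ γ c₂) {T β : ℝ} (hT : 0 ≤ T)
    (hβ : β < 2 - 2 * γ) : ∃ κ : ℝ, 0 < κ ∧ κ ≤ 2 ∧ ∃ N₀ : ℕ, ∀ N : ℕ, N₀ ≤ N → ∃ C : ℝ≥0∞, C ≠ ∞ ∧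
      ∀ (K : ℝ) (F : Finset ℤ) (a : ℤ → ℤ → ℝ), 0 ≤ K → IsSymbol F a →
        (∀ l m, l ≠ 0 → m ≠ 0 → a l m ^ 2 ≤ K * (max |(l : ℝ)| |(m : ℝ)|) ^ κ) →
        MomentLE P (2 * N) (fun ω => pathNorm χ φ T β (fun t => quadJ q w F a t ω))
          (C * ENNReal.ofReal K ^ N) := by
  have hγ := S.half_le
  have hγ' := S.lt_one
  -- the gap is distributed among `κ`, `θ` and the loss `6 / N` of the chaining argument
  set σ : ℝ := 2 - 2 * γ - β with hσ
  have hσ0 : 0 < σ := by linarith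
  set κ : ℝ := min (4 - 4 * γ) (σ / 2) with hκ
  set θ : ℝ := min (2 - 2 * γ) (σ / 2) with hθ
  have hκ0 : 0 < κ := lt_min (by linarith) (by linarith)
  have hθ0 : 0 < θ := lt_min (by linarith) (by linarith)
  have hκ1 : κ ≤ 4 - 4 * γ := min_le_left _ _
  have hκ2 : κ ≤ σ / 2 := min_le_right _ _
  have hθ1 : θ ≤ 2 - 2 * γ := min_le_left _ _
  have hθ2 : θ ≤ σ / 2 := min_le_right _ _
  refine ⟨κ, hκ0, by linarith, max 3 ⌈12 / σ⌉₊, fun N hN => ?_⟩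
  have hN3 : 3 ≤ N := (le_max_left _ _).trans hN
  have hN0 : (0 : ℝ) < N := by positivity
  have hNσ : 6 / (N : ℝ) ≤ σ / 2 := by
    have h1 : 12 / σ ≤ N := (Nat.le_ceil _).trans (by exact_mod_cast (le_max_right _ _).trans hN)
    rw [div_le_iff₀ hσ0] at h1
    rw [div_le_iff₀ hN0]; linarith
  obtain ⟨ρ, R, hann⟩ := S.partition.exists_hasAnnuli
  obtain ⟨C, hC, hCb⟩ := S.partition.exists_lintegral_pathSup_le (P := P) (H := H) (w := w) (q := q)
    T β (4 * γ - 5 + κ + θ) hN3 hT (by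
      have : 2 * (3 / (N : ℝ)) = 6 / N := by ring
      rw [this]; linarith)
  refine ⟨C * ENNReal.ofReal (4 * c₂ ^ 4 * kernelConst γ κ θ) ^ N, by finiteness,
    fun K F a hK ha hb => ?_⟩
  have hk0 : 0 < kernelConst γ κ θ := kernelConst_pos (by linarith)
  refine ⟨fun ω => pathSup χ φ T β q w F a N ω, hann.measurable_pathSup S.isOUFamily hT β N,
    ae_of_all _ fun ω => hann.pathNorm_pow_le S.isOUFamily β (by omega) ω, ?_⟩
  refine (hCb (4 * c₂ ^ 4 * kernelConst γ κ θ * K) F a (by positivity) S.isOUFamily ha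
    fun k hk => quadEnergy_le hγ hγ' S.norm_le hθ0.le (by linarith) hθ1 (by linarith) hK hb
      hk).trans_eq ?_
  rw [ENNReal.ofReal_mul (by positivity), mul_pow, ← mul_assoc]

/-- The moment bounds for the regularised processes and for their differences. -/
lemma exists_momentLE_regularizedJ (S : IsOUSetup (P := P) H w W q χ φ ψ γ c₂) {T β : ℝ}
    (hT : 0 ≤ T) (hβ : β < 2 - 2 * γ) :
    ∃ κ : ℝ, 0 < κ ∧ ∃ N₀ : ℕ, ∀ N : ℕ, N₀ ≤ N → ∃ C : ℝ≥0∞, C ≠ ∞ ∧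
      (∀ ε : ℝ, 0 < ε → MomentLE P (2 * N)
        (fun ω => pathNorm χ φ T β (fun t => regularizedJ ψ q W P ε t ω)) C) ∧
      ∀ δ ε ε' : ℝ, 0 < ε → 0 < ε' → ε ≤ δ → ε' ≤ δ → MomentLE P (2 * N)
        (fun ω => pathNorm χ φ T β
          (fun t => regularizedJ ψ q W P ε t ω - regularizedJ ψ q W P ε' t ω))
        (C * ENNReal.ofReal (δ ^ κ) ^ N) := by
  obtain ⟨κ, hκ0, hκ2, N₀, h⟩ := S.exists_momentLE hT hβ
  obtain ⟨D, hD0, hD1, hD2⟩ := exists_regSymbol_bounds S.contDiff S.hasCompactSupport S.map_zero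
  refine ⟨κ, hκ0, N₀, fun N hN => ?_⟩
  obtain ⟨C, hC, hCb⟩ := h N hN
  refine ⟨C * ENNReal.ofReal D ^ N, by finiteness, fun ε hε => ?_,
    fun δ ε ε' hε hε' hδ hδ' => ?_⟩
  · obtain ⟨F, hF⟩ := exists_freq S.hasCompactSupport hε
    refine (hCb D F _ hD0.le (isSymbol_regSymbol hF) fun l m hl hm => ?_).mono_ae ?_
    · refine (hD1 ε l m).trans (le_mul_of_one_le_right hD0.le (Real.one_le_rpow ?_ hκ0.le))
      exact le_max_of_le_left (by exact_mod_cast Int.one_le_abs hl)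
    · filter_upwards [S.agree] with ω hω
      exact (pathNorm_congr fun t ht => S.regularizedJ_eq hF hω ht.1).le
  · have hδ0 : 0 < δ := hε.trans_le hδ
    obtain ⟨F, hF⟩ := exists_freq S.hasCompactSupport hε
    obtain ⟨F', hF'⟩ := exists_freq S.hasCompactSupport hε'
    have hU : ∀ k ∉ F ∪ F', ψ (ε * (k : ℤ)) = 0 := fun k hk =>
      hF k fun h => hk (Finset.mem_union_left _ h)
    have hU' : ∀ k ∉ F ∪ F', ψ (ε' * (k : ℤ)) = 0 := fun k hk =>
      hF' k fun h => hk (Finset.mem_union_right _ h)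
    have hm := hCb (D * δ ^ κ) (F ∪ F') _ (by positivity)
      ((isSymbol_regSymbol hU).sub (isSymbol_regSymbol hU'))
      (fun l m _ _ => hD2 κ hκ0.le hκ2 δ ε ε' hε hε' hδ hδ' l m)
    rw [ENNReal.ofReal_mul hD0.le, mul_pow, ← mul_assoc] at hm
    refine hm.mono_ae ?_
    filter_upwards [S.agree] with ω hω
    refine (pathNorm_congr fun t ht => ?_).le
    rw [S.regularizedJ_eq hU hω ht.1, S.regularizedJ_eq hU' hω ht.1]
    ext k
    rw [Pi.sub_apply, S.isOUFamily.quadJ_sub]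

/-- The limit process, along the sequence `ε = 2^{-n}`. -/
noncomputable def limitJ (ψ : ℝ → ℝ) (q : ℤ → ℂ) (W : ℤ → ℝ≥0 → Ω → ℂ) (P : Measure Ω) (t : ℝ)
    (ω : Ω) (k : ℤ) : ℂ :=
  limUnder atTop fun n : ℕ => regularizedJ ψ q W P ((1 / 2) ^ n) t ω k

/-- Almost surely, the processes with `ε = 2^{-n}` have summable increments. -/
lemma ae_tsum_pathNorm_lt_top (S : IsOUSetup (P := P) H w W q χ φ ψ γ c₂) {T β : ℝ} (hT : 0 ≤ T)
    (hβ : β < 2 - 2 * γ) : ∀ᵐ ω ∂P, ∑' n : ℕ, pathNorm χ φ T β (fun t =>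
      regularizedJ ψ q W P ((1 / 2) ^ n) t ω - regularizedJ ψ q W P ((1 / 2) ^ (n + 1)) t ω) < ∞ := by
  obtain ⟨κ, hκ, N₀, h⟩ := S.exists_momentLE_regularizedJ hT hβ
  obtain ⟨C, hC, -, hd⟩ := h (N₀ + 1) (by omega)
  refine MomentLE.ae_tsum_lt_top (n := 2 * (N₀ + 1)) (B := C)
    (r := ENNReal.ofReal ((1 / 2 : ℝ) ^ κ) ^ (N₀ + 1)) (by omega) hC ?_ fun m => ?_
  · refine pow_lt_one₀ zero_le ?_ (by omega)
    rw [ENNReal.ofReal_lt_one]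
    exact Real.rpow_lt_one (by norm_num) (by norm_num) hκ
  · have := hd ((1 / 2) ^ m) ((1 / 2) ^ m) ((1 / 2) ^ (m + 1)) (by positivity) (by positivity) le_rfl
      (pow_le_pow_of_le_one (by norm_num) (by norm_num) (by omega))
    convert this using 2
    rw [← pow_mul, mul_comm, pow_mul]
    congr 1
    rw [← ENNReal.ofReal_pow (by positivity), ← Real.rpow_natCast, ← Real.rpow_natCast,
      ← Real.rpow_mul (by norm_num), ← Real.rpow_mul (by norm_num), mul_comm κ]

/-- Almost surely, all modes converge at all times. -/
lemma ae_tendsto_limitJ (S : IsOUSetup (P := P) H w W q χ φ ψ γ c₂) {T : ℝ} (hT : 0 ≤ T) :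
    ∀ᵐ ω ∂P, ∀ t ∈ Icc 0 T, ∀ k : ℤ, Tendsto (fun n : ℕ =>
      regularizedJ ψ q W P ((1 / 2) ^ n) t ω k) atTop (𝓝 (limitJ ψ q W P t ω k)) := by
  obtain ⟨ρ, R, hann⟩ := S.partition.exists_hasAnnuli
  filter_upwards [S.ae_tsum_pathNorm_lt_top hT (β := 1 - 2 * γ) (by linarith)] with ω hω t ht k
  obtain ⟨C, hC, hk⟩ := hann.exists_enorm_le_besovNorm S.partition (1 - 2 * γ) k
  refine (cauchySeq_tendsto_of_complete ?_).elim fun z hz => tendsto_nhds_limUnder ⟨z, hz⟩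
  refine cauchySeq_of_edist_le_of_tsum_ne_top (fun n => C * pathNorm χ φ T (1 - 2 * γ) (fun t =>
      regularizedJ ψ q W P ((1 / 2) ^ n) t ω - regularizedJ ψ q W P ((1 / 2) ^ (n + 1)) t ω))
    (fun n => ?_) ?_
  · rw [edist_eq_enorm_sub]
    refine (hk (regularizedJ ψ q W P ((1 / 2) ^ n) t ω -
      regularizedJ ψ q W P ((1 / 2) ^ (n + 1)) t ω)).trans ?_
    gcongr
    exact besovNorm_le_pathNorm ht fun t =>
      regularizedJ ψ q W P ((1 / 2) ^ n) t ω - regularizedJ ψ q W P ((1 / 2) ^ (n + 1)) t ω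
  · rw [ENNReal.tsum_mul_left]
    exact ENNReal.mul_ne_top hC hω.ne

/-- Almost surely, the convergence along `ε = 2^{-n}` holds in the path norm. -/
lemma ae_tendsto_pathNorm (S : IsOUSetup (P := P) H w W q χ φ ψ γ c₂) {T β : ℝ} (hT : 0 ≤ T)
    (hβ : β < 2 - 2 * γ) : ∀ᵐ ω ∂P, Tendsto (fun n : ℕ => pathNorm χ φ T β (fun t =>
      regularizedJ ψ q W P ((1 / 2) ^ n) t ω - limitJ ψ q W P t ω)) atTop (𝓝 0) := by
  obtain ⟨ρ, R, hann⟩ := S.partition.exists_hasAnnuli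
  filter_upwards [S.ae_tsum_pathNorm_lt_top hT hβ, S.ae_tendsto_limitJ hT] with ω hω hlim
  set v : ℕ → ℝ → ℤ → ℂ := fun n t => regularizedJ ψ q W P ((1 / 2) ^ n) t ω with hv
  set d : ℕ → ℝ≥0∞ := fun n => pathNorm χ φ T β (fun t => v n t - v (n + 1) t) with hd
  have hsum : ∀ n i, pathNorm χ φ T β (fun t => v n t - v (n + i) t) ≤ ∑' j, d (j + n) := by
    intro n i
    refine le_trans ?_ (ENNReal.sum_le_tsum (Finset.range i))
    induction i with
    | zero =>
      simp only [add_zero, sub_self, Finset.range_zero, Finset.sum_empty, nonpos_iff_eq_zero]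
      simp [pathNorm, besovNorm, lpBlock]
    | succ i ih =>
      rw [Finset.sum_range_succ]
      have e : (fun t => v n t - v (n + (i + 1)) t) =
          fun t => (v n t - v (n + i) t) + (v (n + i) t - v (n + (i + 1)) t) := by
        ext t k; simp
      rw [e]
      refine (hann.pathNorm_add_le _ _).trans (add_le_add ih ?_)
      simp only [hd]
      rw [add_comm i n, add_assoc]
  refine tendsto_of_tendsto_of_tendsto_of_le_of_le tendsto_const_nhds
    (ENNReal.tendsto_sum_nat_add d hω.ne) (fun _ => zero_le) fun n => ?_
  refine (hann.pathNorm_le_liminf (v := fun i t => v n t - v (n + i) t) fun t ht k => ?_).trans ?_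
  · have h1 := (tendsto_add_atTop_iff_nat n).2 (hlim t ht k)
    simp only [add_comm _ n] at h1
    exact h1.const_sub (v n t k)
  · refine (liminf_le_liminf (Eventually.of_forall (hsum n))).trans ?_
    rw [liminf_const]

lemma aemeasurable_regularizedJ (S : IsOUSetup (P := P) H w W q χ φ ψ γ c₂) {ε : ℝ} (hε : 0 < ε)
    {t : ℝ} (ht : 0 ≤ t) (k : ℤ) : AEMeasurable (fun ω => regularizedJ ψ q W P ε t ω k) P := by
  obtain ⟨F, hF⟩ := exists_freq S.hasCompactSupport hε
  refine (S.isOUFamily.measurable_quadJ (q := q) (F := F) (a := regSymbol ψ ε) ht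
    k).aemeasurable.congr ?_
  filter_upwards [S.agree] with ω hω
  rw [S.regularizedJ_eq hF hω ht]

lemma memLpPath_regularizedJ (S : IsOUSetup (P := P) H w W q χ φ ψ γ c₂) {T β p ε : ℝ}
    (hT : 0 ≤ T) (hβ : β < 2 - 2 * γ) (hp : 1 < p) (hε : 0 < ε) :
    MemLpPath χ φ T β p (regularizedJ ψ q W P ε) P := by
  obtain ⟨ρ, R, hann⟩ := S.partition.exists_hasAnnuli
  refine ⟨fun t ht k => S.aemeasurable_regularizedJ hε ht.1 k, ?_, ?_⟩
  · obtain ⟨F, hF⟩ := exists_freq S.hasCompactSupport hε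
    filter_upwards [S.agree] with ω hω
    obtain ⟨D, hD⟩ := (isSymbol_regSymbol hF).exists_quadJ_support (q := q) (w := w)
    refine hann.mem_pathSpace_of_tendsto S.partition
      (v := fun _ t => quadJ q w F (regSymbol ψ ε) t ω) (fun _ => ⟨D, fun t k hk => hD t ω k hk⟩)
      (fun _ t => quadJ_freq_zero t ω) (fun _ k => S.isOUFamily.continuous_quadJ ω k) ?_
    have : pathNorm χ φ T β (fun t => quadJ q w F (regSymbol ψ ε) t ω -
        regularizedJ ψ q W P ε t ω) = 0 := by
      rw [pathNorm_congr (v := 0) fun t ht => by rw [S.regularizedJ_eq hF hω ht.1]; simp]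
      simp [pathNorm, besovNorm, lpBlock]
    simp only [this, tendsto_const_nhds]
  · obtain ⟨κ, hκ, N₀, h⟩ := S.exists_momentLE_regularizedJ hT hβ
    obtain ⟨C, hC, hm, -⟩ := h (max N₀ (⌈p⌉₊ + 1)) (le_max_left _ _)
    have hpN : p ≤ ((2 * max N₀ (⌈p⌉₊ + 1) : ℕ) : ℝ) := by
      refine (Nat.le_ceil p).trans ?_
      exact_mod_cast (by have := le_max_right N₀ (⌈p⌉₊ + 1); omega)
    refine lt_of_le_of_lt ((hm ε hε).lintegral_rpow_le (by linarith) hpN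
      (by have := le_max_right N₀ (⌈p⌉₊ + 1); omega)) ?_
    exact ENNReal.rpow_lt_top_of_nonneg (by positivity) hC

/-- The rate of convergence to the limit process. -/
lemma exists_momentLE_sub_limitJ (S : IsOUSetup (P := P) H w W q χ φ ψ γ c₂) {T β : ℝ}
    (hT : 0 ≤ T) (hβ : β < 2 - 2 * γ) :
    ∃ κ : ℝ, 0 < κ ∧ ∃ N₀ : ℕ, ∀ N : ℕ, N₀ ≤ N → ∃ C : ℝ≥0∞, C ≠ ∞ ∧
      MomentLE P (2 * N) (fun ω => pathNorm χ φ T β (fun t => limitJ ψ q W P t ω)) C ∧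
      ∀ ε : ℝ, 0 < ε → MomentLE P (2 * N)
        (fun ω => pathNorm χ φ T β (fun t => regularizedJ ψ q W P ε t ω - limitJ ψ q W P t ω))
        (C * ENNReal.ofReal (ε ^ κ) ^ N) := by
  obtain ⟨ρ, R, hann⟩ := S.partition.exists_hasAnnuli
  obtain ⟨κ, hκ, N₀, h⟩ := S.exists_momentLE_regularizedJ hT hβ
  refine ⟨κ, hκ, N₀, fun N hN => ?_⟩
  obtain ⟨C, hC, hm, hd⟩ := h N hN
  refine ⟨C, hC, ?_, fun ε hε => ?_⟩
  · refine MomentLE.of_le_liminf (X := fun m ω => pathNorm χ φ T β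
      (fun t => regularizedJ ψ q W P ((1 / 2) ^ m) t ω))
      (Eventually.of_forall fun m => hm _ (by positivity)) ?_
    filter_upwards [S.ae_tendsto_limitJ hT] with ω hω
    exact hann.pathNorm_le_liminf hω
  · refine MomentLE.of_le_liminf (X := fun m ω => pathNorm χ φ T β
      (fun t => regularizedJ ψ q W P ε t ω - regularizedJ ψ q W P ((1 / 2) ^ m) t ω)) ?_ ?_
    · have : Tendsto (fun m : ℕ => (1 / 2 : ℝ) ^ m) atTop (𝓝 0) :=
        tendsto_pow_atTop_nhds_zero_of_lt_one (by norm_num) (by norm_num)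
      filter_upwards [this.eventually (gt_mem_nhds hε)] with m hmε
      exact hd ε ε _ hε (by positivity) le_rfl hmε.le
    · filter_upwards [S.ae_tendsto_limitJ hT] with ω hω
      exact hann.pathNorm_le_liminf fun t ht k => (hω t ht k).const_sub _

lemma memLpPath_limitJ (S : IsOUSetup (P := P) H w W q χ φ ψ γ c₂) {T β p : ℝ}
    (hT : 0 ≤ T) (hβ : β < 2 - 2 * γ) (hp : 1 < p) :
    MemLpPath χ φ T β p (limitJ ψ q W P) P := by
  obtain ⟨ρ, R, hann⟩ := S.partition.exists_hasAnnuli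
  refine ⟨fun t ht k => ?_, ?_, ?_⟩
  · refine aemeasurable_of_tendsto_metrizable_ae atTop (fun n : ℕ =>
      S.aemeasurable_regularizedJ (ε := (1 / 2) ^ n) (by positivity) ht.1 k) ?_
    filter_upwards [S.ae_tendsto_limitJ hT] with ω hω
    exact hω t ht k
  · choose F hF using fun n : ℕ =>
      exists_freq (ε := (1 / 2) ^ n) S.hasCompactSupport (by positivity)
    choose D hD using fun n : ℕ => 
      (isSymbol_regSymbol (hF n)).exists_quadJ_support (q := q) (w := w)
    filter_upwards [S.agree, S.ae_tendsto_pathNorm hT hβ] with ω hω hlim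
    refine hann.mem_pathSpace_of_tendsto S.partition
      (v := fun n t => quadJ q w (F n) (regSymbol ψ ((1 / 2) ^ n)) t ω)
      (fun n => ⟨D n, fun t k hk => hD n t ω k hk⟩)
      (fun _ t => quadJ_freq_zero t ω) (fun _ k => S.isOUFamily.continuous_quadJ ω k) ?_
    refine hlim.congr fun n => pathNorm_congr fun t ht => ?_
    rw [S.regularizedJ_eq (hF n) hω ht.1]
  · obtain ⟨κ, hκ, N₀, h⟩ := S.exists_momentLE_sub_limitJ hT hβ
    obtain ⟨C, hC, hm, -⟩ := h (max N₀ (⌈p⌉₊ + 1)) (le_max_left _ _)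
    have hpN : p ≤ ((2 * max N₀ (⌈p⌉₊ + 1) : ℕ) : ℝ) := by
      refine (Nat.le_ceil p).trans ?_
      exact_mod_cast (by have := le_max_right N₀ (⌈p⌉₊ + 1); omega)
    refine lt_of_le_of_lt (hm.lintegral_rpow_le (by linarith) hpN
      (by have := le_max_right N₀ (⌈p⌉₊ + 1); omega)) ?_
    exact ENNReal.rpow_lt_top_of_nonneg (by positivity) hC

/-- Convergence of all moments of the path norm, as the real parameter `ε` tends to `0`. -/
lemma tendsto_lintegral_pathNorm (S : IsOUSetup (P := P) H w W q χ φ ψ γ c₂) {T β p : ℝ}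
    (hT : 0 ≤ T) (hβ : β < 2 - 2 * γ) (hp : 1 < p) :
    Tendsto (fun ε : ℝ => ∫⁻ ω,
      pathNorm χ φ T β (fun t => regularizedJ ψ q W P ε t ω - limitJ ψ q W P t ω) ^ p ∂P)
      (𝓝[>] 0) (𝓝 0) := by
  obtain ⟨κ, hκ, N₀, h⟩ := S.exists_momentLE_sub_limitJ hT hβ
  set N := max N₀ (⌈p⌉₊ + 1) with hN
  have hN1 : ⌈p⌉₊ + 1 ≤ N := le_max_right _ _
  obtain ⟨C, hC, -, hm⟩ := h N (le_max_left _ _)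
  have hpN : p ≤ ((2 * N : ℕ) : ℝ) := by
    refine (Nat.le_ceil p).trans ?_
    exact_mod_cast (by omega)
  have hN0 : (0 : ℝ) < ((2 * N : ℕ) : ℝ) := by linarith
  have hlim : Tendsto (fun ε : ℝ => (C * ENNReal.ofReal (ε ^ κ) ^ N) ^ (p / ((2 * N : ℕ) : ℝ)))
      (𝓝[>] 0) (𝓝 0) := by
    have h1 : Tendsto (fun ε : ℝ => ε ^ κ) (𝓝[>] 0) (𝓝 0) := by
      have := (Real.continuousAt_rpow_const 0 κ (Or.inr hκ.le)).tendsto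
      rw [Real.zero_rpow hκ.ne'] at this
      exact this.mono_left nhdsWithin_le_nhds
    have h2 := ((ENNReal.continuous_pow N).tendsto _).comp (ENNReal.tendsto_ofReal h1)
    rw [ENNReal.ofReal_zero, zero_pow (by omega)] at h2
    have h3 := ENNReal.Tendsto.const_mul (a := C) h2 (Or.inr hC)
    rw [mul_zero] at h3
    have h4 := h3.ennrpow_const (p / ((2 * N : ℕ) : ℝ))
    rwa [ENNReal.zero_rpow_of_pos (by positivity)] at h4
  refine tendsto_of_tendsto_of_tendsto_of_le_of_le' tendsto_const_nhds hlim
    (Eventually.of_forall fun _ => zero_le) ?_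
  filter_upwards [self_mem_nhdsWithin] with ε hε
  exact (hm ε hε).lintegral_rpow_le (by linarith) hpN (by omega)

/-! ### Variances of the limit process -/

/-- Fatou's lemma for second moments. -/
lemma lintegral_enorm_sq_le_of_tendsto {X : ℕ → Ω → ℂ} {Y : Ω → ℂ} {B : ℝ≥0∞}
    (hX : ∀ n, AEMeasurable (X n) P) (h : ∀ᵐ ω ∂P, Tendsto (fun n => X n ω) atTop (𝓝 (Y ω)))
    (hB : ∀ n, ∫⁻ ω, ‖X n ω‖ₑ ^ 2 ∂P ≤ B) : ∫⁻ ω, ‖Y ω‖ₑ ^ 2 ∂P ≤ B := by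
  calc _ = ∫⁻ ω, liminf (fun n => ‖X n ω‖ₑ ^ 2) atTop ∂P := by
        refine lintegral_congr_ae ?_
        filter_upwards [h] with ω hω
        exact ((ENNReal.continuous_pow 2).tendsto _ |>.comp hω.enorm).liminf_eq.symm
    _ ≤ liminf (fun n => ∫⁻ ω, ‖X n ω‖ₑ ^ 2 ∂P) atTop :=
        lintegral_liminf_le' fun n => ((hX n).enorm).pow_const 2
    _ ≤ _ := by
        refine (liminf_le_liminf (Eventually.of_forall hB)).trans ?_
        rw [liminf_const]

/-- The variance bounds are uniform in the regularisation, and pass to the limit. -/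
lemma exists_variance_bound (S : IsOUSetup (P := P) H w W q χ φ ψ γ c₂) {T : ℝ} (hT : 0 ≤ T)
    {η : ℝ} (hη : 0 ≤ η) (hηγ : γ = 1 / 2 → 0 < η) : ∃ C : ℝ, 0 < C ∧
      (∀ k : ℤ, k ≠ 0 → ∀ t ∈ Icc 0 T, ∫⁻ ω, ‖limitJ ψ q W P t ω k‖ₑ ^ 2 ∂P ≤
        ENNReal.ofReal (C / |(k : ℝ)| ^ (5 - 4 * γ - η))) ∧
      (∀ k : ℤ, k ≠ 0 → ∀ h ∈ Icc (0 : ℝ) 1, ∀ s ∈ Icc 0 T, ∀ t ∈ Icc 0 T,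
        ∫⁻ ω, ‖limitJ ψ q W P t ω k - limitJ ψ q W P s ω k‖ₑ ^ 2 ∂P ≤
          ENNReal.ofReal (C * |t - s| ^ h / |(k : ℝ)| ^ (5 - 4 * γ - η - 2 * h))) := by
  have hγ := S.half_le
  have hγ' := S.lt_one
  obtain ⟨D, hD0, hD1, -⟩ := exists_regSymbol_bounds S.contDiff S.hasCompactSupport S.map_zero
  set θ : ℝ := min η (2 - 2 * γ) with hθ
  have hθ0 : 0 ≤ θ := le_min hη (by linarith)
  have hθ1 : 0 < 2 * γ - 1 + θ := by
    rcases hγ.eq_or_lt with h | h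
    · have : 0 < θ := lt_min (hηγ h.symm) (by linarith)
      linarith
    · linarith
  have hθ2 : θ ≤ 2 - 2 * γ := min_le_right _ _
  have hθη : θ ≤ η := min_le_left _ _
  set A : ℝ := 4 * c₂ ^ 4 * kernelConst γ 0 θ * D with hA
  have hA0 : 0 ≤ A := by
    have := kernelConst_pos (κ := 0) hθ1
    positivity
  have hE : ∀ (F : Finset ℤ) (ε : ℝ) (k : ℤ), k ≠ 0 → quadEnergy q F (regSymbol ψ ε) k ≤
      A * |(k : ℝ)| ^ (-(5 - 4 * γ - η)) := by
    intro F ε k hk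
    have hk1 : (1 : ℝ) ≤ |(k : ℝ)| := by exact_mod_cast Int.one_le_abs hk
    refine (quadEnergy_le (κ := 0) hγ hγ' S.norm_le hθ0 hθ1 hθ2 (by linarith) hD0.le
      (fun l m _ _ => by simpa using hD1 ε l m) hk).trans ?_
    refine mul_le_mul_of_nonneg_left (Real.rpow_le_rpow_of_exponent_le hk1 ?_) hA0
    linarith
  choose F hF using fun n : ℕ =>
    exists_freq (ε := (1 / 2) ^ n) S.hasCompactSupport (by positivity)
  have hJ : ∀ (n : ℕ) {t : ℝ}, 0 ≤ t → ∀ k, ∀ᵐ ω ∂P, regularizedJ ψ q W P ((1 / 2) ^ n) t ω k =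
      quadJ q w (F n) (regSymbol ψ ((1 / 2) ^ n)) t ω k := by
    intro n t ht k
    filter_upwards [S.agree] with ω hω
    rw [S.regularizedJ_eq (hF n) hω ht]
  have hmem : ∀ (n : ℕ) {t : ℝ}, 0 ≤ t → ∀ k,
      MemLp (fun ω => quadJ q w (F n) (regSymbol ψ ((1 / 2) ^ n)) t ω k) 2 P := fun n t ht k =>
    (S.isOUFamily.inSub_quadJ (isSymbol_regSymbol (hF n)) k ht).memLp
  refine ⟨4 * A + 1, by positivity, fun k hk t ht => ?_, fun k hk h hh s hs t ht => ?_⟩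
  · have hk0 : 0 < |(k : ℝ)| := by positivity
    refine lintegral_enorm_sq_le_of_tendsto (fun n =>
      S.aemeasurable_regularizedJ (ε := (1 / 2) ^ n) (by positivity) ht.1 k)
      ((S.ae_tendsto_limitJ hT).mono fun ω hω => hω t ht k) fun n => ?_
    have e : ∫⁻ ω, ‖regularizedJ ψ q W P ((1 / 2) ^ n) t ω k‖ₑ ^ 2 ∂P =
        ∫⁻ ω, ‖quadJ q w (F n) (regSymbol ψ ((1 / 2) ^ n)) t ω k‖ₑ ^ 2 ∂P :=
      lintegral_congr_ae ((hJ n ht.1 k).mono fun ω hω => by simp only [hω])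
    rw [e, lintegral_enorm_sq_eq (hmem n ht.1 k)]
    refine ENNReal.ofReal_le_ofReal ?_
    refine ((S.isOUFamily.integral_norm_sq_quadJ_le (isSymbol_regSymbol (hF n)) hk ht.1).trans
      (hE _ _ k hk)).trans ?_
    rw [Real.rpow_neg hk0.le, div_eq_mul_inv]
    gcongr
    linarith
  · have hk0 : 0 < |(k : ℝ)| := by positivity
    refine lintegral_enorm_sq_le_of_tendsto (fun n =>
      (S.aemeasurable_regularizedJ (ε := (1 / 2) ^ n) (by positivity) ht.1 k).sub
        (S.aemeasurable_regularizedJ (ε := (1 / 2) ^ n) (by positivity) hs.1 k))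
      ((S.ae_tendsto_limitJ hT).mono fun ω hω => (hω t ht k).sub (hω s hs k)) fun n => ?_
    have e : ∫⁻ ω, ‖((fun ω => regularizedJ ψ q W P ((1 / 2) ^ n) t ω k) -
        fun ω => regularizedJ ψ q W P ((1 / 2) ^ n) s ω k) ω‖ₑ ^ 2 ∂P =
        ∫⁻ ω, ‖quadJ q w (F n) (regSymbol ψ ((1 / 2) ^ n)) t ω k -
          quadJ q w (F n) (regSymbol ψ ((1 / 2) ^ n)) s ω k‖ₑ ^ 2 ∂P := by
      refine lintegral_congr_ae ?_
      filter_upwards [hJ n ht.1 k, hJ n hs.1 k] with ω h1 h2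
      rw [Pi.sub_apply, h1, h2]
    have hms : MemLp (fun ω => quadJ q w (F n) (regSymbol ψ ((1 / 2) ^ n)) t ω k -
          quadJ q w (F n) (regSymbol ψ ((1 / 2) ^ n)) s ω k) 2 P := (hmem n ht.1 k).sub (hmem n hs.1 k)
    rw [e, lintegral_enorm_sq_eq hms]
    refine ENNReal.ofReal_le_ofReal ?_
    refine (S.isOUFamily.integral_norm_sq_quadJ_sub_le (isSymbol_regSymbol (hF n)) hk hs.1 ht.1
      hh.1 hh.2).trans ?_
    have e2 : |(k : ℝ)| ^ (-(5 - 4 * γ - η - 2 * h)) =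
        ((k : ℝ) ^ 2) ^ h * |(k : ℝ)| ^ (-(5 - 4 * γ - η)) := by
      rw [← sq_abs, ← Real.rpow_natCast, ← Real.rpow_mul hk0.le, ← Real.rpow_add hk0]
      congr 1; push_cast; ring
    rw [div_eq_mul_inv ((4 * A + 1) * |t - s| ^ h), ← Real.rpow_neg hk0.le, e2,
      Real.mul_rpow (sq_nonneg _) (abs_nonneg _)]
    calc _ ≤ 4 * (((k : ℝ) ^ 2) ^ h * |t - s| ^ h) * (A * |(k : ℝ)| ^ (-(5 - 4 * γ - η))) := by
          gcongr
          exact hE _ _ k hk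
      _ = (4 * A) * (|t - s| ^ h * (((k : ℝ) ^ 2) ^ h * |(k : ℝ)| ^ (-(5 - 4 * γ - η)))) := by ring
      _ ≤ (4 * A + 1) * (|t - s| ^ h * (((k : ℝ) ^ 2) ^ h * |(k : ℝ)| ^ (-(5 - 4 * γ - η)))) := by
          gcongr
          linarith
      _ = _ := by ring

end IsOUSetup

end Limit

/-! ### Divergence of the renormalised square -/

section Divergence

variable {Ω : Type*} [mΩ : MeasurableSpace Ω] {P : Measure Ω} [IsProbabilityMeasure P]
  {H : Submodule ℝ (Lp ℝ 2 P)} {w : ℤ → ℝ → Ω → ℂ} {q : ℤ → ℂ} {W : ℤ → ℝ≥0 → Ω → ℂ}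
  {χ φ ψ : ℝ → ℝ} {γ c₁ c₂ : ℝ}

/-- Paley–Zygmund: if the fourth moment is comparable to the square of the variance, and the
variance is large, then the variable is not small with high probability. -/
lemma paley_zygmund {X : Ω → ℂ} (hX : Measurable X) {C V : ℝ} (hC : 0 < C)
    (h2 : ∫ ω, ‖X ω‖ ^ 2 ∂P = V) (h4 : ∫ ω, ‖X ω‖ ^ 4 ∂P ≤ C * V ^ 2)
    (hi2 : Integrable (fun ω => ‖X ω‖ ^ 2) P) (hi4 : Integrable (fun ω => ‖X ω‖ ^ 4) P)
    (hV : 16 ≤ V) : 1 / (2 * C) ≤ P.real {ω | 2 ≤ ‖X ω‖} := by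
  set A : Set Ω := {ω | 2 ≤ ‖X ω‖} with hA
  have hAm : MeasurableSet A := measurableSet_le measurable_const hX.norm
  have hV0 : 0 < V := by linarith
  have hi1 : Integrable (A.indicator fun _ => V * C) P := (integrable_const _).indicator hAm
  have hpt : ∀ ω, ‖X ω‖ ^ 2 ≤ 4 + (1 / (4 * C * V) * ‖X ω‖ ^ 4 + A.indicator (fun _ => V * C) ω) := by
    intro ω
    by_cases h : ω ∈ A
    · rw [indicator_of_mem h]
      -- the inequality of arithmetic and geometric means, with weights making it sharp at `C V`
      have e : 1 / (4 * C * V) * ‖X ω‖ ^ 4 + V * C - ‖X ω‖ ^ 2 =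
          (‖X ω‖ ^ 2 - 2 * C * V) ^ 2 / (4 * C * V) := by
        field_simp; ring
      have : 0 ≤ (‖X ω‖ ^ 2 - 2 * C * V) ^ 2 / (4 * C * V) := by positivity
      linarith
    · rw [indicator_of_notMem h]
      have h' : ‖X ω‖ < 2 := not_le.1 h
      have : 0 ≤ 1 / (4 * C * V) * ‖X ω‖ ^ 4 := by positivity
      nlinarith [norm_nonneg (X ω)]
  have hi3 : Integrable (fun ω => 1 / (4 * C * V) * ‖X ω‖ ^ 4 + A.indicator (fun _ => V * C) ω) P :=
    (hi4.const_mul _).add hi1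
  have hint := integral_mono hi2 ((integrable_const 4).add hi3) hpt
  simp only [Pi.add_apply] at hint
  rw [h2, integral_add (integrable_const _) hi3] at hint
  rw [integral_add (hi4.const_mul _) hi1, integral_const_mul, integral_indicator_const _ hAm,
    integral_const, probReal_univ, one_smul, smul_eq_mul] at hint
  have h5 : 1 / (4 * C * V) * ∫ ω, ‖X ω‖ ^ 4 ∂P ≤ V / 4 := by
    calc _ ≤ 1 / (4 * C * V) * (C * V ^ 2) := by gcongr
      _ = V / 4 := by field_simp
  rw [div_le_iff₀ (by positivity)]
  have h6 : V * 1 ≤ V * (P.real A * (2 * C)) := by nlinarith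
  exact le_of_mul_le_mul_left h6 hV0

/-- A quadratic mode with large variance is large with a probability bounded below, uniformly in the
symbol: hypercontractivity provides the comparison of moments in the Paley–Zygmund inequality. -/
lemma IsOUFamily.measure_quadMode_ge (hw : IsOUFamily H w) {F : Finset ℤ} {a : ℤ → ℤ → ℝ}
    (ha : IsSymbol F a) {k : ℤ} (hk : k ≠ 0) {t : ℝ} (ht : 0 ≤ t) (hV : 16 ≤ quadCov q F a k t t) :
    1 / (2 * ((hyperConst 2).toReal + 1)) ≤ P.real {ω | 2 ≤ ‖quadMode q w F a t ω k‖} := by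
  have hS := hw.inSub_quadMode (q := q) (F := F) (a := a) hk ht
  have h2 := hw.integral_norm_sq_quadMode (q := q) ha hk ht
  have hyp := hypercontractivity hw.isGaussianSpace hS 2
  rw [lintegral_enorm_sq_eq hS.memLp, h2, show 2 * 2 = 4 by norm_num] at hyp
  have hm : Measurable fun ω => quadMode q w F a t ω k := hw.measurable_quadMode t k
  have e4 : ∫⁻ ω, ‖quadMode q w F a t ω k‖ₑ ^ 4 ∂P =
      ∫⁻ ω, ENNReal.ofReal (‖quadMode q w F a t ω k‖ ^ 4) ∂P := by
    refine lintegral_congr fun ω => ?_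
    rw [← ofReal_norm, ENNReal.ofReal_pow (norm_nonneg _)]
  have hfin : ∫⁻ ω, ENNReal.ofReal (‖quadMode q w F a t ω k‖ ^ 4) ∂P ≠ ∞ := by
    rw [← e4]
    refine ne_top_of_le_ne_top ?_ hyp
    have := hyperConst_ne_top 2
    finiteness
  have hi4 : Integrable (fun ω => ‖quadMode q w F a t ω k‖ ^ 4) P := by
    refine ⟨(hm.norm.pow_const 4).aestronglyMeasurable, ?_⟩
    rw [hasFiniteIntegral_iff_ofReal (ae_of_all _ fun ω => by positivity)]
    exact hfin.lt_top
  refine paley_zygmund hm (by positivity) h2 ?_ hS.memLp.norm.integrable_sq hi4 hV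
  rw [e4, ← ofReal_integral_eq_lintegral_ofReal hi4 (ae_of_all _ fun ω => by positivity),
    ← ENNReal.ofReal_toReal (hyperConst_ne_top 2), ← ENNReal.ofReal_pow (by linarith),
    ← ENNReal.ofReal_mul ENNReal.toReal_nonneg] at hyp
  rw [ENNReal.ofReal_le_ofReal_iff (by positivity)] at hyp
  refine hyp.trans ?_
  gcongr
  linarith

/-- The contribution of the pair of frequencies `(l, k - l)` to the variance. -/
noncomputable def pairVar (q : ℤ → ℂ) (k : ℤ) (t : ℝ) (l : ℤ) : ℝ :=
  2 * ((‖q l‖ ^ 2 * ouCov ((l : ℝ) ^ 2) t t) *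
    (‖q (k - l)‖ ^ 2 * ouCov (((k - l : ℤ) : ℝ) ^ 2) t t))

lemma pairVar_nonneg (q : ℤ → ℂ) (k : ℤ) {t : ℝ} (ht : 0 ≤ t) (l : ℤ) : 0 ≤ pairVar q k t l := by
  have := ouCov_nonneg (sq_nonneg (l : ℝ)) ht ht
  have := ouCov_nonneg (sq_nonneg ((k - l : ℤ) : ℝ)) ht ht
  unfold pairVar
  positivity

lemma quadCov_eq_sum_pairVar (q : ℤ → ℂ) (F : Finset ℤ) (a : ℤ → ℤ → ℝ) (k : ℤ) (t : ℝ) :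
    quadCov q F a k t t = ∑ l ∈ F, a l (k - l) ^ 2 * pairVar q k t l := by
  refine Finset.sum_congr rfl fun l _ => ?_
  rw [pairVar]; ring

/-- The variance of the mode `z_t(l)` is bounded below by a multiple of `|l|^{2γ-2}`. -/
lemma le_sq_mul_ouCov (hc₁ : 0 < c₁) (hq : ∀ k : ℤ, c₁ * |(k : ℝ)| ^ γ ≤ ‖q k‖) {t : ℝ}
    (ht : 0 ≤ t) {l : ℤ} (hl : l ≠ 0) : c₁ ^ 2 * ((1 - Real.exp (-(2 * t))) / 2) *
      |(l : ℝ)| ^ (2 * γ - 2) ≤ ‖q l‖ ^ 2 * ouCov ((l : ℝ) ^ 2) t t := by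
  have hl0 : 0 < |(l : ℝ)| := by positivity
  have hl1 : (1 : ℝ) ≤ |(l : ℝ)| := by exact_mod_cast Int.one_le_abs hl
  have hl2 : (1 : ℝ) ≤ (l : ℝ) ^ 2 := by rw [← sq_abs]; nlinarith
  have h1 : (c₁ * |(l : ℝ)| ^ γ) ^ 2 ≤ ‖q l‖ ^ 2 := by gcongr; exact hq l
  have h2 : (1 - Real.exp (-(2 * t))) / (2 * (l : ℝ) ^ 2) ≤ ouCov ((l : ℝ) ^ 2) t t := by
    unfold ouCov
    rw [sub_self, abs_zero, mul_zero, Real.exp_zero]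
    have : Real.exp (-(l : ℝ) ^ 2 * (t + t)) ≤ Real.exp (-(2 * t)) := by
      rw [Real.exp_le_exp]; nlinarith
    gcongr
  have h3 : 0 ≤ 1 - Real.exp (-(2 * t)) := by
    rw [sub_nonneg, Real.exp_le_one_iff]; linarith
  have e : |(l : ℝ)| ^ (2 * γ - 2) = (|(l : ℝ)| ^ γ) ^ 2 / (l : ℝ) ^ 2 := by
    rw [show 2 * γ - 2 = γ * (2 : ℕ) - (2 : ℕ) by push_cast; ring, Real.rpow_sub_natCast hl0.ne',
      Real.rpow_mul_natCast hl0.le, sq_abs]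
  rw [e]
  calc _ = (c₁ * |(l : ℝ)| ^ γ) ^ 2 * ((1 - Real.exp (-(2 * t))) / (2 * (l : ℝ) ^ 2)) := by
        field_simp
    _ ≤ _ := mul_le_mul h1 h2 (by positivity) (by positivity)

/-- For `γ ≥ 3/4` the variance of a mode of the renormalised square is a divergent series, bounded
below by a multiple of the harmonic series. -/
lemma exists_finset_pairVar_ge (hc₁ : 0 < c₁) (hq : ∀ k : ℤ, c₁ * |(k : ℝ)| ^ γ ≤ ‖q k‖)
    (hγ : 3 / 4 ≤ γ) (hγ' : γ < 1) {t : ℝ} (ht : 0 < t) {k : ℤ} (E : Finset ℤ) (M : ℝ) :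
    ∃ G : Finset ℤ, Disjoint G E ∧ M ≤ ∑ l ∈ G, pairVar q k t l := by
  set τ : ℝ := c₁ ^ 2 * ((1 - Real.exp (-(2 * t))) / 2) with hτ
  have hτ0 : 0 < τ := by
    have : Real.exp (-(2 * t)) < 1 := by rw [Real.exp_lt_one_iff]; linarith
    have : 0 < 1 - Real.exp (-(2 * t)) := by linarith
    positivity
  obtain ⟨L, hL1, hLk, hLE⟩ : ∃ L : ℕ, 1 ≤ L ∧ k.natAbs < L ∧ ∀ l ∈ E, l < L := by
    refine ⟨max (k.natAbs + 1) (E.sup Int.natAbs + 1), by omega, by omega, fun l hl => ?_⟩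
    have : l.natAbs ≤ E.sup Int.natAbs := Finset.le_sup (f := Int.natAbs) hl
    omega
  have hL0 : (0 : ℝ) < L := by positivity
  have hterm : ∀ j : ℕ, τ ^ 2 / L * (1 / ((j : ℝ) + 1)) ≤ pairVar q k t ((L + j : ℕ) : ℤ) := by
    intro j
    set l : ℤ := ((L + j : ℕ) : ℤ) with hl
    have hl0 : l ≠ 0 := by omega
    have hkl0 : k - l ≠ 0 := by omega
    have hlr : |(l : ℝ)| = L + j := by
      rw [hl, Int.cast_natCast, abs_of_nonneg (by positivity)]; push_cast; rfl
    have hx0 : (0 : ℝ) < L + j := by positivity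
    have hx1 : (1 : ℝ) ≤ L + j := by
      have : (1 : ℝ) ≤ L := by exact_mod_cast hL1
      linarith [Nat.cast_nonneg (α := ℝ) j]
    have hklr : |((k - l : ℤ) : ℝ)| ≤ 2 * (L + j) := by
      have h1 : |k - l| ≤ 2 * (L + j) := _root_.abs_le.2 ⟨by omega, by omega⟩
      calc |((k - l : ℤ) : ℝ)| = ((|k - l| : ℤ) : ℝ) := by push_cast; rfl
        _ ≤ ((2 * (L + j) : ℤ) : ℝ) := by exact_mod_cast h1
        _ = _ := by push_cast; ring
    have hkl1 : 0 < |((k - l : ℤ) : ℝ)| := abs_pos.2 (by exact_mod_cast hkl0)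
    have b1 : τ * (2 * ((L : ℝ) + j)) ^ (2 * γ - 2) ≤ ‖q l‖ ^ 2 * ouCov ((l : ℝ) ^ 2) t t := by
      refine le_trans ?_ (le_sq_mul_ouCov hc₁ hq ht.le hl0)
      refine mul_le_mul_of_nonneg_left ?_ hτ0.le
      exact Real.rpow_le_rpow_of_nonpos (by positivity) (by rw [hlr]; linarith) (by linarith)
    have b2 : τ * (2 * ((L : ℝ) + j)) ^ (2 * γ - 2) ≤
        ‖q (k - l)‖ ^ 2 * ouCov (((k - l : ℤ) : ℝ) ^ 2) t t := by
      refine le_trans ?_ (le_sq_mul_ouCov hc₁ hq ht.le hkl0)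
      refine mul_le_mul_of_nonneg_left ?_ hτ0.le
      exact Real.rpow_le_rpow_of_nonpos hkl1 hklr (by linarith)
    have b3 : (2 * ((L : ℝ) + j))⁻¹ ≤
        (2 * ((L : ℝ) + j)) ^ (2 * γ - 2) * (2 * ((L : ℝ) + j)) ^ (2 * γ - 2) := by
      rw [← Real.rpow_add (by positivity), ← Real.rpow_neg_one]
      exact Real.rpow_le_rpow_of_exponent_le (by linarith) (by linarith)
    have b4 := mul_le_mul b1 b2 (by positivity) (le_trans (by positivity) b1)
    have b5 : (L : ℝ) + j ≤ L * (j + 1) := by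
      have : (1 : ℝ) ≤ L := by exact_mod_cast hL1
      nlinarith [Nat.cast_nonneg (α := ℝ) j]
    unfold pairVar
    calc τ ^ 2 / L * (1 / ((j : ℝ) + 1)) = τ ^ 2 * (1 / (L * (j + 1))) := by field_simp
      _ ≤ τ ^ 2 * (1 / (L + j)) := by gcongr
      _ = 2 * (τ ^ 2 * (2 * ((L : ℝ) + j))⁻¹) := by field_simp
      _ ≤ 2 * (τ ^ 2 * ((2 * ((L : ℝ) + j)) ^ (2 * γ - 2) * (2 * ((L : ℝ) + j)) ^ (2 * γ - 2))) := by
          gcongr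
      _ = 2 * ((τ * (2 * ((L : ℝ) + j)) ^ (2 * γ - 2)) *
          (τ * (2 * ((L : ℝ) + j)) ^ (2 * γ - 2))) := by ring
      _ ≤ _ := by gcongr
  obtain ⟨N, hN⟩ := ((tendsto_atTop.1 Real.tendsto_sum_range_one_div_nat_succ_atTop)
    (M / (τ ^ 2 / L))).exists
  refine ⟨(Finset.range N).image fun j : ℕ => ((L + j : ℕ) : ℤ), ?_, ?_⟩
  · rw [Finset.disjoint_left]
    intro l hl hlE
    obtain ⟨j, -, rfl⟩ := Finset.mem_image.1 hl
    have := hLE _ hlE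
    omega
  · rw [Finset.sum_image fun x _ y _ h => by simpa using h]
    refine le_trans ?_ (Finset.sum_le_sum fun j _ => hterm j)
    rw [← Finset.mul_sum]
    rw [div_le_iff₀' (by positivity)] at hN
    exact hN

/-- The fixed-time modes of the renormalised square are not Cauchy in probability: the variance of
the increments diverges, and by hypercontractivity they cannot be small with high probability. -/
lemma IsOUSetup.not_tendstoInMeasure (S : IsOUSetup (P := P) H w W q χ φ ψ γ c₂) (hc₁ : 0 < c₁)
    (hq : ∀ k : ℤ, c₁ * |(k : ℝ)| ^ γ ≤ ‖q k‖) (hγ : 3 / 4 ≤ γ) {t : ℝ} (ht : 0 < t) {k : ℤ}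
    (hk : k ≠ 0) (Y : Ω → ℂ) :
    ¬ TendstoInMeasure P (fun (ε : ℝ) (ω : Ω) => torusCoeff (wickSquare ψ q W P ε t ω) k)
      (𝓝[>] 0) Y := by
  intro hY
  set c : ℝ := 1 / (2 * ((hyperConst 2).toReal + 1)) with hc
  have hc0 : 0 < c := by positivity
  have hsmall : ∀ᶠ ε in 𝓝[>] (0 : ℝ), P {ω | 1 ≤ edist (torusCoeff (wickSquare ψ q W P ε t ω) k)
      (Y ω)} < ENNReal.ofReal (c / 2) :=
    (hY 1 one_pos).eventually (gt_mem_nhds (by simpa using hc0))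
  have hpos : ∀ᶠ ε in 𝓝[>] (0 : ℝ), 0 < ε := self_mem_nhdsWithin
  obtain ⟨ε', hε', hs'⟩ := (hpos.and hsmall).exists
  obtain ⟨F', hF'⟩ := exists_freq S.hasCompactSupport hε'
  obtain ⟨G, hGF, hG⟩ := exists_finset_pairVar_ge (k := k) hc₁ hq hγ S.lt_one ht F' 17
  -- for small `ε` the frequencies in `G` contribute fully to the first term and, being outside the
  -- support of the second symbol, not at all to the second
  have hlim : Tendsto (fun ε : ℝ => ∑ l ∈ G, regSymbol ψ ε l (k - l) ^ 2 * pairVar q k t l)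
      (𝓝[>] 0) (𝓝 (∑ l ∈ G, pairVar q k t l)) := by
    have hcont : Continuous fun ε : ℝ => ∑ l ∈ G, regSymbol ψ ε l (k - l) ^ 2 * pairVar q k t l := by
      have hψ := S.contDiff.continuous
      unfold regSymbol
      fun_prop
    have h0 := hcont.tendsto 0
    simp only [regSymbol, zero_mul, S.map_zero, mul_one, one_pow, one_mul] at h0
    exact h0.mono_left nhdsWithin_le_nhds
  have hev := hlim.eventually (lt_mem_nhds (by linarith : (16 : ℝ) < _))
  obtain ⟨ε, ⟨hε, hs⟩, hge⟩ := ((hpos.and hsmall).and hev).exists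
  obtain ⟨F, hF⟩ := exists_freq S.hasCompactSupport hε
  have hU : ∀ l ∉ F ∪ F' ∪ G, ψ (ε * (l : ℤ)) = 0 := fun l hl => hF l fun h => hl (by simp [h])
  have hU' : ∀ l ∉ F ∪ F' ∪ G, ψ (ε' * (l : ℤ)) = 0 := fun l hl => hF' l fun h => hl (by simp [h])
  have hsym := (isSymbol_regSymbol hU).sub (isSymbol_regSymbol hU')
  have hV : 16 ≤ quadCov q (F ∪ F' ∪ G)
      (fun l m => regSymbol ψ ε l m - regSymbol ψ ε' l m) k t t := by
    rw [quadCov_eq_sum_pairVar]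
    refine hge.le.trans ?_
    refine le_trans (Finset.sum_le_sum fun l hl => ?_) (Finset.sum_le_sum_of_subset_of_nonneg
      Finset.subset_union_right fun l _ _ => mul_nonneg (sq_nonneg _) (pairVar_nonneg q k ht.le l))
    have h0 : regSymbol ψ ε' l (k - l) = 0 := by
      rw [regSymbol, hF' l (Finset.disjoint_left.1 hGF hl), zero_mul]
    rw [h0, sub_zero]
  have hlow := S.isOUFamily.measure_quadMode_ge hsym hk ht.le hV
  have hsub : ∀ᵐ ω ∂P, ω ∈ {ω | 2 ≤ ‖quadMode q w (F ∪ F' ∪ G)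
      (fun l m => regSymbol ψ ε l m - regSymbol ψ ε' l m) t ω k‖} →
      ω ∈ {ω | 1 ≤ edist (torusCoeff (wickSquare ψ q W P ε t ω) k) (Y ω)} ∪
        {ω | 1 ≤ edist (torusCoeff (wickSquare ψ q W P ε' t ω) k) (Y ω)} := by
    filter_upwards [S.agree] with ω hω h2
    have e : quadMode q w (F ∪ F' ∪ G) (fun l m => regSymbol ψ ε l m - regSymbol ψ ε' l m) t ω k =
        torusCoeff (wickSquare ψ q W P ε t ω) k - torusCoeff (wickSquare ψ q W P ε' t ω) k := by
      rw [S.isOUFamily.torusCoeff_wickSquare S.map_freq_zero S.agree hU hω ht.le hk,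
        S.isOUFamily.torusCoeff_wickSquare S.map_freq_zero S.agree hU' hω ht.le hk]
      simp only [quadMode]
      rw [← Finset.sum_sub_distrib]
      refine Finset.sum_congr rfl fun l _ => ?_
      push_cast; ring
    by_contra hn
    simp only [mem_union, mem_ofPred_eq, not_or, not_le] at hn
    have h3 : edist (torusCoeff (wickSquare ψ q W P ε t ω) k)
        (torusCoeff (wickSquare ψ q W P ε' t ω) k) < 2 := by
      refine (edist_triangle_right _ _ (Y ω)).trans_lt ?_
      rw [← one_add_one_eq_two]
      exact ENNReal.add_lt_add hn.1 hn.2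
    rw [edist_eq_enorm_sub, ← e, ← ofReal_norm] at h3
    have h4 : (2 : ℝ≥0∞) ≤ ENNReal.ofReal ‖quadMode q w (F ∪ F' ∪ G)
        (fun l m => regSymbol ψ ε l m - regSymbol ψ ε' l m) t ω k‖ := by
      rw [← ENNReal.ofReal_ofNat]
      exact ENNReal.ofReal_le_ofReal h2
    exact absurd h3 (not_lt.2 h4)
  have hup : P {ω | 2 ≤ ‖quadMode q w (F ∪ F' ∪ G)
      (fun l m => regSymbol ψ ε l m - regSymbol ψ ε' l m) t ω k‖} < ENNReal.ofReal c := by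
    refine (measure_mono_ae hsub).trans_lt ((measure_union_le _ _).trans_lt ?_)
    refine (ENNReal.add_lt_add hs hs').trans_eq ?_
    rw [← ENNReal.ofReal_add (by positivity) (by positivity), add_halves]
  rw [measureReal_def, ← ENNReal.ofReal_le_iff_le_toReal (measure_ne_top _ _)] at hlow
  exact absurd hup (not_lt.2 hlow)

end Divergence

end BurgersOU

open BurgersOU in
theorem propositionB7
    {Ω : Type*} [MeasurableSpace Ω] (P : Measure Ω) [IsProbabilityMeasure P]
    (χ φ : ℝ → ℝ) (hχφ : IsDyadicPartition χ φ)
    (ψ : ℝ → ℝ) (hψ_smooth : ContDiff ℝ (⊤ : ℕ∞) ψ) (hψ_even : ∀ x, ψ (-x) = ψ x)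
    (hψ_supp : HasCompactSupport ψ) (hψ_zero : ψ 0 = 1)
    (T : ℝ) (hT : 0 < T)
    (γ : ℝ) (hγ : 1 / 2 ≤ γ) (hγ' : γ < 1)
    (q : ℤ → ℂ) (c₁ c₂ : ℝ) (hc₁ : 0 < c₁)
    (hq : ∀ k : ℤ, c₁ * |(k : ℝ)| ^ γ ≤ ‖q k‖ ∧ ‖q k‖ ≤ c₂ * |(k : ℝ)| ^ γ)
    (W : ℤ → ℝ≥0 → Ω → ℂ) (hW : IsCylindricalBrownian W P) :
    (∃ J : ℝ → Ω → ℤ → ℂ,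
      (∀ η : ℝ, 0 ≤ η → (γ = 1 / 2 → 0 < η) → ∃ C : ℝ, 0 < C ∧
        (∀ k : ℤ, k ≠ 0 → ∀ t ∈ Icc 0 T,
          ∫⁻ ω, ‖J t ω k‖ₑ ^ 2 ∂P ≤
            ENNReal.ofReal (C / |(k : ℝ)| ^ (5 - 4 * γ - η))) ∧
        (∀ k : ℤ, k ≠ 0 → ∀ h ∈ Icc (0 : ℝ) 1, ∀ s ∈ Icc 0 T, ∀ t ∈ Icc 0 T,
          ∫⁻ ω, ‖J t ω k - J s ω k‖ₑ ^ 2 ∂P ≤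
            ENNReal.ofReal (C * |t - s| ^ h / |(k : ℝ)| ^ (5 - 4 * γ - η - 2 * h)))) ∧
      (∀ β : ℝ, β < 2 - 2 * γ → ∀ p : ℝ, 1 < p →
        MemLpPath χ φ T β p J P ∧
        (∀ ε : ℝ, 0 < ε → MemLpPath χ φ T β p (regularizedJ ψ q W P ε) P) ∧
        Tendsto
          (fun ε : ℝ => ∫⁻ ω,
            pathNorm χ φ T β (fun t => regularizedJ ψ q W P ε t ω - J t ω) ^ p ∂P)
          (𝓝[>] 0) (𝓝 0))) ∧
    (3 / 4 ≤ γ → ∀ t ∈ Ioc 0 T, ∀ k : ℤ, k ≠ 0 →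
      ¬ ∃ Y : Ω → ℂ, TendstoInMeasure P
        (fun (ε : ℝ) (ω : Ω) => torusCoeff (wickSquare ψ q W P ε t ω) k) (𝓝[>] 0) Y) := by
  obtain ⟨H, w, hw, hag⟩ := hW.exists_ouFamily
  have S : IsOUSetup (P := P) H w W q χ φ ψ γ c₂ :=
    ⟨hw, hag, hχφ, hψ_smooth, hψ_supp, hψ_zero, hγ, hγ', fun k => (hq k).2⟩
  refine ⟨⟨IsOUSetup.limitJ ψ q W P, fun η hη hηγ => S.exists_variance_bound hT.le hη hηγ,
    fun β hβ p hp => ⟨S.memLpPath_limitJ hT.le hβ hp,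
      fun ε hε => S.memLpPath_regularizedJ hT.le hβ hp hε,
      S.tendsto_lintegral_pathNorm hT.le hβ hp⟩⟩, ?_⟩
  rintro hγ'' t ht k hk ⟨Y, hY⟩
  exact S.not_tendstoInMeasure hc₁ (fun k => (hq k).1) hγ'' ht.1 hk Y hY
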